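/- Let $X$ be a regular one-dimensional diffusion on $(0,\infty)$ with drift $\mu$ (differentiable), volatility $\sigma>0$ (continuous) and natural boundaries $0$ and $\infty$, with generator $\mathcal A=\mu\frac{d}{dx}+\frac12\sigma^2\frac{d^2}{dx^2}$, scale density $S'$ and speed density $m'=2/(\sigma^2S')$. For $s>0$ let $\psi_s>0$ and $\varphi_s>0$ be the increasing and the decreasing solution of $(\mathcal A-s)f=0$ (unique up to positive factors), let $$B_s=\frac{\psi_s'}{S'}\varphi_s-\frac{\varphi_s'}{S'}\psi_s$$ be their constant Wronskian, and let $$(R_sf)(x)=\mathbb E_x\int_0^\infty e^{-st}f(X_t)\,dt=B_s^{-1}\varphi_s(x)\int_0^x\psi_sf\,m'\,dy+B_s^{-1}\psi_s(x)\int_x^\infty\varphi_sf\,m'\,dy ;$$ $f\in\mathcal L^s_1$ means that these integrals converge absolutely for every $x>0$. Let $r>0$, let $\gamma_d,\gamma_u$ be constants, $\pi:(0,\infty)\to\mathbb R$, and for $n\in\{d,u\}$ put $$\theta_n(x)=\pi(x)+\gamma_n(\mu(x)-rx),\qquad g_n(x)=\gamma_nx-(R_r\pi)(x).$$ Assume that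 (i) $\gamma_d<\gamma_u$; (ii) $\theta_d$, $\theta_u$ and the identity are in $\mathcal L_1^r$; (iii) $\pi$ is positive, continuous and non-decreasing; (iv) $\mu'<r$; (v) $\theta_n$ is differentiable and there is $x_n^*\ge0$ such that $\theta_n'(x)$ is positive, zero or negative according as $x<x_n^*$, $x=x_n^*$ or $x>x_n^*$; (vi) $\lim_{x\to0+}\theta_n(x)>0$ and $\lim_{x\to\infty}\theta_n(x)=-\infty$. For $s>0$ define $$L^s_f(x)=s\int_x^\infty f\varphi_s m'\,dy+\frac{\varphi_s'(x)}{S'(x)}f(x),\qquad K^s_f(x)=s\int_0^xf\psi_sm'\,dy-\frac{\psi_s'(x)}{S'(x)}f(x),$$ and, for $\lambda>0$ and $f\in\{\psi_r,\varphi_r\}$, $$H_{u,f}=\frac{f'K^{r+\lambda}_{g_u}-g_u'K^{r+\lambda}_{f}}{\psi_{r+\lambda}'},\qquad Q_{d,f}=\frac{g_d'L^{r+\lambda}_{f}-f'L^{r+\lambda}_{g_d}}{\varphi_{r+\lambda}'} .$$ Suppose that the threshold equations of the unconstrained singular control problem, $$K^r_{\theta_u}(a_s^*)=K^r_{\theta_d}(b_s^*),\qquad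 L^r_{\theta_u}(a_s^*)=L^r_{\theta_d}(b_s^*),$$ have a solution with $0<a_s^*\le x_u^*$ and $b_s^*\ge x_d^*$. Then: 1. $(a_s^*,b_s^*)$ is the only solution in $(0,x_u^*]\times[x_d^*,\infty)$. The map $$k=\big(L^r_{\theta_u}|_{(0,x_u^*]}\big)^{-1}\circ L^r_{\theta_d}\circ\big(K^r_{\theta_d}|_{[x_d^*,\infty)}\big)^{-1}\circ K^r_{\theta_u}$$ is well defined from $(0,a_s^*]$ to $(0,a_s^*]$, and $a_s^*$ is its unique fixed point. 2. For all sufficiently large $\lambda$ there are points $\hat x_\lambda,\tilde x_\lambda>0$ such that $L^{r+\lambda}_{\theta_d}$ is positive on $(0,\hat x_\lambda)$, zero at $\hat x_\lambda$ and negative on $(\hat x_\lambda,\infty)$, while $K^{r+\lambda}_{\theta_u}$ is negative on $(0,\tilde x_\lambda)$, zero at $\tilde x_\lambda$ and positive on $(\tilde x_\lambda,\infty)$. The map $$K_\lambda=\big(H_{u,\varphi_r}|_{(0,\tilde x_\lambda]}\big)^{-1}\circ Q_{d,\varphi_r}\circ\big(Q_{d,\psi_r}|_{[\hat x_\lambda,\infty)}\big)^{-1}\circ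 H_{u,\psi_r}$$ is well defined from $(0,\tilde x_\lambda]$ to $(0,\tilde x_\lambda]$ and has a unique fixed point $a^*_\lambda$. This $a^*_\lambda$ is the first component of the unique solution $(a_\lambda^*,b_\lambda^*)\in(0,\tilde x_\lambda]\times[\hat x_\lambda,\infty)$ of the threshold equations of the Poisson control problem with signal rate $\lambda$, $$H_{u,\psi_r}(a)=Q_{d,\psi_r}(b),\qquad H_{u,\varphi_r}(a)=Q_{d,\varphi_r}(b).$$ 3. $a^*_\lambda\to a^*_s$ as $\lambda\to\infty$. -/

import Mathlib

open Set Filter Topology MeasureTheory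

noncomputable section

namespace PoissonControl

/-! ### The diffusion `dX = μ(X) dt + σ(X) dW` on `(0, ∞)`

Functions on the state space are functions `ℝ → ℝ`; only their values on `(0, ∞)` matter. -/

/-- The generator `𝒜 f = μ f' + (1/2) σ² f''`. -/
def generator (μ σ f : ℝ → ℝ) (x : ℝ) : ℝ :=
  μ x * deriv f x + 1 / 2 * σ x ^ 2 * deriv (deriv f) x

/-- The scale density `S'(x) = exp (- ∫^x 2 μ(z) / σ²(z) dz)`. The base point of the indefinite
integral is `1`; another base point multiplies `S'` by a constant. -/
def scaleDensity (μ σ : ℝ → ℝ) (x : ℝ) : ℝ :=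
  Real.exp (-∫ z in (1 : ℝ)..x, 2 * μ z / σ z ^ 2)

/-- The density `m'(x) = 2 / (σ²(x) S'(x))` of the speed measure. -/
def speedDensity (μ σ : ℝ → ℝ) (x : ℝ) : ℝ :=
  2 / (σ x ^ 2 * scaleDensity μ σ x)

/-- Feller's test: the boundary `0` is natural, that is, neither exit nor entrance. -/
def NaturalAtZero (μ σ : ℝ → ℝ) : Prop :=
  (∫⁻ y in Ioc (0 : ℝ) 1, (∫⁻ z in Ioc y 1, ENNReal.ofReal (speedDensity μ σ z)) *
      ENNReal.ofReal (scaleDensity μ σ y)) = ⊤ ∧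
  (∫⁻ y in Ioc (0 : ℝ) 1, (∫⁻ z in Ioc y 1, ENNReal.ofReal (scaleDensity μ σ z)) *
      ENNReal.ofReal (speedDensity μ σ y)) = ⊤

/-- Feller's test: the boundary `∞` is natural, that is, neither exit nor entrance. -/
def NaturalAtInfinity (μ σ : ℝ → ℝ) : Prop :=
  (∫⁻ y in Ioi (1 : ℝ), (∫⁻ z in Ioc 1 y, ENNReal.ofReal (speedDensity μ σ z)) *
      ENNReal.ofReal (scaleDensity μ σ y)) = ⊤ ∧
  (∫⁻ y in Ioi (1 : ℝ), (∫⁻ z in Ioc 1 y, ENNReal.ofReal (scaleDensity μ σ z)) *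
      ENNReal.ofReal (speedDensity μ σ y)) = ⊤

/-- Coefficients of a regular diffusion on `(0, ∞)` with natural boundaries. -/
structure IsNaturalDiffusion (μ σ : ℝ → ℝ) : Prop where
  drift_differentiable : DifferentiableOn ℝ μ (Ioi 0)
  vol_continuous : ContinuousOn σ (Ioi 0)
  vol_pos : ∀ x, 0 < x → 0 < σ x
  natural_zero : NaturalAtZero μ σ
  natural_infinity : NaturalAtInfinity μ σ

/-- `f` is a positive twice continuously differentiable solution of `(𝒜 - s) f = 0`. -/
structure IsPositiveHarmonic (μ σ : ℝ → ℝ) (s : ℝ) (f : ℝ → ℝ) : Prop where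
  contDiff : ContDiffOn ℝ 2 f (Ioi 0)
  pos : ∀ x, 0 < x → 0 < f x
  harmonic : ∀ x, 0 < x → generator μ σ f x - s * f x = 0

/-- `ψ` is the increasing fundamental solution of `(𝒜 - s) f = 0`
(for natural boundaries it is unique up to a positive factor). -/
def IsIncreasingFundamental (μ σ : ℝ → ℝ) (s : ℝ) (ψ : ℝ → ℝ) : Prop :=
  IsPositiveHarmonic μ σ s ψ ∧ StrictMonoOn ψ (Ioi 0)

/-- `φ` is the decreasing fundamental solution of `(𝒜 - s) f = 0`
(for natural boundaries it is unique up to a positive factor). -/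
def IsDecreasingFundamental (μ σ : ℝ → ℝ) (s : ℝ) (φ : ℝ → ℝ) : Prop :=
  IsPositiveHarmonic μ σ s φ ∧ StrictAntiOn φ (Ioi 0)

/-! ### Resolvent -/

/-- The Wronskian `B = (ψ' / S') φ - (φ' / S') ψ`, a constant function of `x`. -/
def wronskian (μ σ ψ φ : ℝ → ℝ) (x : ℝ) : ℝ :=
  deriv ψ x / scaleDensity μ σ x * φ x - deriv φ x / scaleDensity μ σ x * ψ x

/-- The class `𝓛₁^s`, where `ψ`, `φ` are the fundamental solutions at rate `s`: the resolvent
`E_x ∫₀^∞ e^{-st} |f(X_t)| dt` is finite for every `x`. The resolvent is written through its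
(Green) kernel `B⁻¹ ψ(x ∧ y) φ(x ∨ y)` with respect to the speed measure. -/
def InL1 (μ σ ψ φ f : ℝ → ℝ) : Prop :=
  ∀ x, 0 < x →
    IntegrableOn (fun y => ψ y * f y * speedDensity μ σ y) (Ioc 0 x) ∧
    IntegrableOn (fun y => φ y * f y * speedDensity μ σ y) (Ioi x)

/-- The resolvent `(R_s f)(x) = E_x ∫₀^∞ e^{-st} f(X_t) dt`, where `ψ`, `φ` are the fundamental
solutions at rate `s`. -/
def resolvent (μ σ ψ φ f : ℝ → ℝ) (x : ℝ) : ℝ :=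
  (wronskian μ σ ψ φ x)⁻¹ * φ x * (∫ y in Ioc 0 x, ψ y * f y * speedDensity μ σ y) +
  (wronskian μ σ ψ φ x)⁻¹ * ψ x * (∫ y in Ioi x, φ y * f y * speedDensity μ σ y)

/-! ### Payoff functions and the standing assumptions -/

/-- The net convenience yield `θ(x) = π(x) + γ (μ(x) - r x)`. -/
def theta (μ π : ℝ → ℝ) (r γ : ℝ) (x : ℝ) : ℝ := π x + γ * (μ x - r * x)

/-- `g(x) = γ x - (R_r π)(x)`, where `ψ`, `φ` are the fundamental solutions at rate `r`. -/
def gain (μ σ π ψ φ : ℝ → ℝ) (γ : ℝ) (x : ℝ) : ℝ := γ * x - resolvent μ σ ψ φ π x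

/-- `θ` is differentiable on `(0, ∞)` and `θ'` is positive, zero or negative at a state according
as that state is below, at or above `x₀ ≥ 0`. -/
structure IsPeak (θ : ℝ → ℝ) (x₀ : ℝ) : Prop where
  nonneg : 0 ≤ x₀
  differentiable : DifferentiableOn ℝ θ (Ioi 0)
  deriv_pos : ∀ x, 0 < x → x < x₀ → 0 < deriv θ x
  deriv_zero : 0 < x₀ → deriv θ x₀ = 0
  deriv_neg : ∀ x, 0 < x → x₀ < x → deriv θ x < 0

/-- The standing assumptions on the payoff `π`, the prices `γd`, `γu` and the discount rate `r`;
`ψ`, `φ` are the fundamental solutions at rate `r`, and `xd`, `xu` are the states at which `θ_d`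
and `θ_u` peak. -/
structure MainAssumptions (μ σ π ψ φ : ℝ → ℝ) (r γd γu xd xu : ℝ) : Prop where
  price_lt : γd < γu
  theta_d_mem : InL1 μ σ ψ φ (theta μ π r γd)
  theta_u_mem : InL1 μ σ ψ φ (theta μ π r γu)
  id_mem : InL1 μ σ ψ φ (fun x => x)
  payoff_pos : ∀ x, 0 < x → 0 < π x
  payoff_continuous : ContinuousOn π (Ioi 0)
  payoff_mono : MonotoneOn π (Ioi 0)
  drift_deriv_lt : ∀ x, 0 < x → deriv μ x < r
  peak_d : IsPeak (theta μ π r γd) xd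
  peak_u : IsPeak (theta μ π r γu) xu
  limit_zero_d : ∃ l, 0 < l ∧ Tendsto (theta μ π r γd) (𝓝[>] 0) (𝓝 l)
  limit_zero_u : ∃ l, 0 < l ∧ Tendsto (theta μ π r γu) (𝓝[>] 0) (𝓝 l)
  limit_infinity_d : Tendsto (theta μ π r γd) atTop atBot
  limit_infinity_u : Tendsto (theta μ π r γu) atTop atBot

/-! ### The functionals `L`, `K`, `H`, `Q` -/

/-- `L_f^s(x) = s ∫_x^∞ f φ_s m' dy + (φ_s'(x) / S'(x)) f(x)`, with `φ = φ_s`. -/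
def Lfun (μ σ φ : ℝ → ℝ) (s : ℝ) (f : ℝ → ℝ) (x : ℝ) : ℝ :=
  s * (∫ y in Ioi x, f y * φ y * speedDensity μ σ y) + deriv φ x / scaleDensity μ σ x * f x

/-- `K_f^s(x) = s ∫_0^x f ψ_s m' dy - (ψ_s'(x) / S'(x)) f(x)`, with `ψ = ψ_s`. -/
def Kfun (μ σ ψ : ℝ → ℝ) (s : ℝ) (f : ℝ → ℝ) (x : ℝ) : ℝ :=
  s * (∫ y in Ioc 0 x, f y * ψ y * speedDensity μ σ y) - deriv ψ x / scaleDensity μ σ x * f x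

/-- `H(f, g; x) = (f'(x) K_g^s(x) - g'(x) K_f^s(x)) / ψ_s'(x)`, with `ψ = ψ_s`, `s = r + λ`. -/
def Hfun (μ σ ψ : ℝ → ℝ) (s : ℝ) (f g : ℝ → ℝ) (x : ℝ) : ℝ :=
  (deriv f x * Kfun μ σ ψ s g x - deriv g x * Kfun μ σ ψ s f x) / deriv ψ x

/-- `Q(g, f; x) = (g'(x) L_f^s(x) - f'(x) L_g^s(x)) / φ_s'(x)`, with `φ = φ_s`, `s = r + λ`. -/
def Qfun (μ σ φ : ℝ → ℝ) (s : ℝ) (g f : ℝ → ℝ) (x : ℝ) : ℝ :=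
  (deriv g x * Lfun μ σ φ s f x - deriv f x * Lfun μ σ φ s g x) / deriv φ x

/-! ### Compositions with inverses of restrictions -/

/-- `x ↦ (h₂|_A)⁻¹ (q₂ ((q₁|_B)⁻¹ (h₁ x)))`. -/
def compInv (h₁ h₂ q₁ q₂ : ℝ → ℝ) (A B : Set ℝ) (x : ℝ) : ℝ :=
  Function.invFunOn h₂ A (q₂ (Function.invFunOn q₁ B (h₁ x)))

/-- The composition `compInv` is meaningful on `D`: the restrictions that are inverted are
injective, and the inverses are only applied to points of the respective images. -/
def CompInvWellDefined (h₁ h₂ q₁ q₂ : ℝ → ℝ) (A B D : Set ℝ) : Prop :=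
  InjOn h₂ A ∧ InjOn q₁ B ∧ MapsTo h₁ D (q₁ '' B) ∧
    MapsTo (fun x => q₂ (Function.invFunOn q₁ B (h₁ x))) D (h₂ '' A)

/-- `F` is a self-map of `D` with exactly one fixed point in `D`, namely `a`. -/
def IsSelfMapWithUniqueFixedPoint (F : ℝ → ℝ) (D : Set ℝ) (a : ℝ) : Prop :=
  MapsTo F D D ∧ a ∈ D ∧ F a = a ∧ ∀ x ∈ D, F x = x → x = a

/-- `(a, b)` is the only solution in `A × B` of the pair `h₁(a) = q₁(b)`, `h₂(a) = q₂(b)`. -/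
def IsUniqueSolution (h₁ h₂ q₁ q₂ : ℝ → ℝ) (A B : Set ℝ) (a b : ℝ) : Prop :=
  a ∈ A ∧ b ∈ B ∧ h₁ a = q₁ b ∧ h₂ a = q₂ b ∧
    ∀ a' ∈ A, ∀ b' ∈ B, h₁ a' = q₁ b' → h₂ a' = q₂ b' → a' = a ∧ b' = b

/-- `xhat` is the point `x̂` at which `L_{θ_d}^s` changes sign from `+` to `-`. -/
def IsSignChangeL (μ σ φ : ℝ → ℝ) (s : ℝ) (θ : ℝ → ℝ) (xhat : ℝ) : Prop :=
  0 < xhat ∧ Lfun μ σ φ s θ xhat = 0 ∧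
    (∀ x, 0 < x → x < xhat → 0 < Lfun μ σ φ s θ x) ∧ (∀ x, xhat < x → Lfun μ σ φ s θ x < 0)

/-- `xtil` is the point `x̃` at which `K_{θ_u}^s` changes sign from `-` to `+`. -/
def IsSignChangeK (μ σ ψ : ℝ → ℝ) (s : ℝ) (θ : ℝ → ℝ) (xtil : ℝ) : Prop :=
  0 < xtil ∧ Kfun μ σ ψ s θ xtil = 0 ∧
    (∀ x, 0 < x → x < xtil → Kfun μ σ ψ s θ x < 0) ∧ (∀ x, xtil < x → 0 < Kfun μ σ ψ s θ x)

end PoissonControl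

end

noncomputable section

namespace PoissonControl

/-! ### Monotone functions with a limit at an end of the interval -/

/-! Write `p = ψ'/S'` and `q = -φ'/S'` for the fluxes. For a payoff `θ` one has `K_θ' = -p θ'` and
`L_θ' = -q θ'`. The singular threshold equations therefore ask where two curves in the `(K,
L)`-plane meet: the `u`-curve with parameter `a ≤ x_u*` and the `d`-curve with parameter `b ≥ x_d*`.
Both have slope `q_r/p_r` at the parameter, and this ratio is positive and strictly decreasing.
Since `γ_d < γ_u` and `μ' < r` give `θ_u' < θ_d'`, the peaks satisfy `x_u* < x_d*`; with `x₀`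
strictly between them and `c = q_r(x₀)/p_r(x₀)`, the first curve is steeper than `c` and the second
flatter. Two such curves cross at most once, and the composed map moves every other point strictly
towards the side of the crossing, so the crossing is its only fixed point (`solution_unique`,
`exists_image_of_ordering`, `uniqueSolution_and_fixedPoint`).

The Poisson equations have the same shape. The identity `R_r(μ - r·) = -id` gives `g = -R_r θ`
(`gain_eq_neg_green`), and Green's formula at the rates `r` and `s = r + λ` gives `λ H_{u,ψ} =
-(K^r_{θ_u} - (p_r/p_s) K^s_{θ_u})`, `λ H_{u,φ} = L^r_{θ_u} - (q_r/p_s) K^s_{θ_u}`, and the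
analogues for `Q` with `L^s_{θ_d}` and `q_s` (`Hfun_inc`, `Hfun_dec`, `Qfun_inc`, `Qfun_dec`). So
the Poisson curves are the singular curves with correction terms. When these are differentiated,
`θ'` cancels and only a multiple of `K^s_{θ_u}` or `L^s_{θ_d}` remains. That is why the sign changes
`x̃` and `x̂` take over the role of the peaks. The slopes stay separated by the same `c`, because
the error is a Wronskian term of the favourable sign (`orderedThresholds`).

As `λ → ∞`, fluxes concentrate: `p_s(y)/p_s(x) → 0` for `y < x`. Hence `x̃ < x₀ < x̂` eventually,
and `K^s_{θ_u}/p_s → 0` on `(0, x_u*]`, `L^s_{θ_d}/q_s → 0` on `[x_d*, ∞)`, so the correction terms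
vanish pointwise (`tendsto_kFun_div`, `tendsto_lFun_div`). Each `x < a_s*` has a partner `y` at
which both singular equations fail by strict inequalities of known direction (`singular_test_left`).
These persist for large `λ`; they produce a solution by connectedness (`exists_solution`) and force
`x < a_λ*` (`lt_solution`). Points to the right of `a_s*` force `a_λ* < x` in the same way, which is
the convergence.

The naturality of the boundaries enters through vanishing boundary terms: `ψ_s`, `p_s` vanish at `0`
and `φ_s`, `q_s` at `∞`, and so do the Wronskians that mix two rates (`tendsto_mixed_zero`,
`tendsto_mixed_atTop`). -/

theorem pos_of_strictMonoOn_of_tendsto {f : ℝ → ℝ} {x : ℝ} (hx : 0 < x)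
    (hf : StrictMonoOn f (Ioc 0 x)) (h0 : Tendsto f (𝓝[>] 0) (𝓝 0)) : 0 < f x := by
  have h2 : f (x / 2) < f x := hf ⟨by linarith, by linarith⟩ ⟨hx, le_rfl⟩ (by linarith)
  refine lt_of_le_of_lt (le_of_tendsto h0 ?_) h2
  filter_upwards [Ioo_mem_nhdsGT (half_pos hx)] with y hy
  exact (hf ⟨hy.1, by linarith [hy.2]⟩ ⟨by linarith, by linarith⟩ hy.2).le

theorem nonneg_of_monotoneOn_of_tendsto {f : ℝ → ℝ} {x : ℝ} (hx : 0 < x)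
    (hf : MonotoneOn f (Ioc 0 x)) (h0 : Tendsto f (𝓝[>] 0) (𝓝 0)) : 0 ≤ f x := by
  refine le_of_tendsto h0 ?_
  filter_upwards [Ioo_mem_nhdsGT hx] with y hy
  exact hf ⟨hy.1, hy.2.le⟩ ⟨hx, le_rfl⟩ hy.2.le

theorem pos_of_strictAntiOn_of_tendsto {f : ℝ → ℝ} {x : ℝ}
    (hf : StrictAntiOn f (Ici x)) (h0 : Tendsto f atTop (𝓝 0)) : 0 < f x := by
  have h2 : f (x + 1) < f x := hf (mem_Ici.2 le_rfl) (mem_Ici.2 (by linarith)) (by linarith)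
  refine lt_of_le_of_lt (le_of_tendsto h0 ?_) h2
  filter_upwards [eventually_gt_atTop (x + 1)] with y hy
  exact (hf (mem_Ici.2 (by linarith)) (mem_Ici.2 (by linarith)) hy).le

theorem nonneg_of_antitoneOn_of_tendsto {f : ℝ → ℝ} {x : ℝ}
    (hf : AntitoneOn f (Ici x)) (h0 : Tendsto f atTop (𝓝 0)) : 0 ≤ f x := by
  refine le_of_tendsto h0 ?_
  filter_upwards [eventually_gt_atTop x] with y hy
  exact hf (mem_Ici.2 le_rfl) (mem_Ici.2 hy.le) hy.le

/-! ### Monotonicity from the sign of the derivative -/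

theorem strictMonoOn_of_hasDerivAt_pos {D : Set ℝ} (hD : Convex ℝ D) {f f' : ℝ → ℝ}
    (hd : ∀ x ∈ D, HasDerivAt f (f' x) x) (hp : ∀ x ∈ interior D, 0 < f' x) :
    StrictMonoOn f D :=
  strictMonoOn_of_deriv_pos hD (fun x hx => (hd x hx).continuousAt.continuousWithinAt)
    fun x hx => by rw [(hd x (interior_subset hx)).deriv]; exact hp x hx

theorem strictAntiOn_of_hasDerivAt_neg {D : Set ℝ} (hD : Convex ℝ D) {f f' : ℝ → ℝ}
    (hd : ∀ x ∈ D, HasDerivAt f (f' x) x) (hp : ∀ x ∈ interior D, f' x < 0) :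
    StrictAntiOn f D :=
  strictAntiOn_of_deriv_neg hD (fun x hx => (hd x hx).continuousAt.continuousWithinAt)
    fun x hx => by rw [(hd x (interior_subset hx)).deriv]; exact hp x hx

theorem monotoneOn_of_hasDerivAt_nonneg {D : Set ℝ} (hD : Convex ℝ D) {f f' : ℝ → ℝ}
    (hd : ∀ x ∈ D, HasDerivAt f (f' x) x) (hp : ∀ x ∈ interior D, 0 ≤ f' x) :
    MonotoneOn f D :=
  monotoneOn_of_deriv_nonneg hD (fun x hx => (hd x hx).continuousAt.continuousWithinAt)
    (fun x hx => (hd x (interior_subset hx)).differentiableAt.differentiableWithinAt)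
    fun x hx => by rw [(hd x (interior_subset hx)).deriv]; exact hp x hx

theorem antitoneOn_of_hasDerivAt_nonpos {D : Set ℝ} (hD : Convex ℝ D) {f f' : ℝ → ℝ}
    (hd : ∀ x ∈ D, HasDerivAt f (f' x) x) (hp : ∀ x ∈ interior D, f' x ≤ 0) :
    AntitoneOn f D :=
  antitoneOn_of_deriv_nonpos hD (fun x hx => (hd x hx).continuousAt.continuousWithinAt)
    (fun x hx => (hd x (interior_subset hx)).differentiableAt.differentiableWithinAt)
    fun x hx => by rw [(hd x (interior_subset hx)).deriv]; exact hp x hx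

theorem eq_of_hasDerivAt_zero {f : ℝ → ℝ} (hd : ∀ x, 0 < x → HasDerivAt f 0 x) {x y : ℝ}
    (hx : 0 < x) (hy : 0 < y) : f x = f y :=
  (convex_Ioi (0 : ℝ)).is_const_of_fderivWithin_eq_zero (𝕜 := ℝ)
    (fun z hz => (hd z hz).differentiableAt.differentiableWithinAt)
    (fun z hz => by
      rw [fderivWithin_of_isOpen isOpen_Ioi hz, (hd z hz).hasFDerivAt.fderiv]
      ext; simp) (mem_Ioi.2 hx) (mem_Ioi.2 hy)

/-! ### Integrals over `(0, x]` and `(x, ∞)` -/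

theorem integrableOn_Ioc_of_continuousOn {f : ℝ → ℝ} (hf : ContinuousOn f (Ioi 0)) {a b : ℝ}
    (ha : 0 < a) : IntegrableOn f (Ioc a b) :=
  ((hf.mono fun _ hy => lt_of_lt_of_le ha hy.1).integrableOn_Icc).mono_set Ioc_subset_Icc_self

/-- On `(e, x]` the integral of `f'` is `f x - f e ≤ f x`, a bound uniform in `e`. Nothing about the
behaviour of `f` at `0` is needed beyond its sign. -/
theorem integrableOn_Ioc_zero_of_deriv_nonneg {f f' : ℝ → ℝ} {x : ℝ}
    (hd : ∀ y ∈ Ioc 0 x, HasDerivAt f (f' y) y) (hn : ∀ y ∈ Ioc 0 x, 0 ≤ f' y)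
    (hf : ∀ y ∈ Ioc 0 x, 0 ≤ f y) : IntegrableOn f' (Ioc 0 x) := by
  rcases le_or_gt x 0 with hx | hx
  · simp [Ioc_eq_empty_of_le hx]
  have hi : ∀ e, 0 < e → e ≤ x → IntegrableOn f' (Ioc e x) := fun e he _ =>
    intervalIntegral.integrableOn_deriv_of_nonneg
      (fun y hy => (hd y ⟨by linarith [hy.1], hy.2⟩).continuousAt.continuousWithinAt)
      (fun y hy => hd y ⟨by linarith [hy.1], hy.2.le⟩)
      (fun y hy => hn y ⟨by linarith [hy.1], hy.2.le⟩)
  have hmin : ∀ n : ℕ, 0 < x / ((n : ℝ) + 1) ∧ x / ((n : ℝ) + 1) ≤ x := fun n =>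
    ⟨by positivity, div_le_self hx.le (by linarith [n.cast_nonneg (α := ℝ)])⟩
  refine integrableOn_Ioc_of_intervalIntegral_norm_bounded_left (l := atTop)
    (a := fun n : ℕ => x / ((n : ℝ) + 1)) (I := f x)
    (fun n => hi _ (hmin n).1 (hmin n).2) ?_ (Eventually.of_forall fun n => ?_)
  · exact tendsto_const_div_atTop_nhds_zero_nat x |>.comp (tendsto_add_atTop_nat 1) |>.congr
      fun n => by simp
  · obtain ⟨h1, h2⟩ := hmin n
    set e := x / ((n : ℝ) + 1)
    have : ∫ y in Ioc e x, ‖f' y‖ = f x - f e := by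
      rw [setIntegral_congr_fun (g := f') measurableSet_Ioc
        (fun y hy => by rw [Real.norm_of_nonneg (hn y ⟨by linarith [hy.1], hy.2⟩)])]
      rw [← intervalIntegral.integral_of_le h2]
      refine intervalIntegral.integral_eq_sub_of_hasDerivAt (fun y hy => ?_) ?_
      · rw [uIcc_of_le h2] at hy
        exact hd y ⟨by linarith [hy.1], hy.2⟩
      · exact (intervalIntegrable_iff_integrableOn_Ioc_of_le h2).2 (hi e h1 h2)
    rw [this]
    linarith [hf e ⟨h1, h2⟩]

theorem integrableOn_Ioi_of_deriv_nonpos {f f' : ℝ → ℝ} {x : ℝ}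
    (hd : ∀ y ∈ Ici x, HasDerivAt f (f' y) y) (hn : ∀ y ∈ Ici x, f' y ≤ 0)
    (hf : ∀ y ∈ Ici x, 0 ≤ f y) : IntegrableOn f' (Ioi x) := by
  have hanti : AntitoneOn f (Ici x) := antitoneOn_of_hasDerivAt_nonpos (convex_Ici x) hd
    fun y hy => hn y (interior_subset hy)
  have hg : Antitone fun y => f (max x y) := fun a b hab =>
    hanti (mem_Ici.2 (le_max_left _ _)) (mem_Ici.2 (le_max_left _ _)) (max_le_max le_rfl hab)
  have hlim := tendsto_atTop_ciInf hg ⟨0, by rintro _ ⟨y, rfl⟩; exact hf _ (mem_Ici.2 (le_max_left _ _))⟩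
  refine integrableOn_Ioi_deriv_of_nonpos' hd (fun y hy => hn y (mem_Ici.2 (le_of_lt hy)))
    (hlim.congr' ?_)
  filter_upwards [eventually_ge_atTop x] with y hy
  simp [max_eq_right hy]

theorem integral_Ioc_zero_of_hasDerivAt {f f' : ℝ → ℝ} {x : ℝ} (hx : 0 < x)
    (hd : ∀ y ∈ Ioc 0 x, HasDerivAt f (f' y) y) (h0 : Tendsto f (𝓝[>] 0) (𝓝 0))
    (hi : IntegrableOn f' (Ioc 0 x)) : ∫ y in Ioc 0 x, f' y = f x := by
  rw [← intervalIntegral.integral_of_le hx.le,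
    intervalIntegral.integral_eq_sub_of_hasDerivAt_of_tendsto hx
      (fun y hy => hd y ⟨hy.1, hy.2.le⟩)
      ((intervalIntegrable_iff_integrableOn_Ioc_of_le hx.le).2 hi) h0
      ((hd x ⟨hx, le_rfl⟩).continuousAt.tendsto.mono_left nhdsWithin_le_nhds), sub_zero]

theorem integral_Ioi_of_hasDerivAt {f f' : ℝ → ℝ} {x : ℝ}
    (hd : ∀ y ∈ Ici x, HasDerivAt f (f' y) y) (h0 : Tendsto f atTop (𝓝 0))
    (hi : IntegrableOn f' (Ioi x)) : ∫ y in Ioi x, f' y = -f x := by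
  rw [integral_Ioi_of_hasDerivAt_of_tendsto' hd hi h0, zero_sub]

theorem hasDerivAt_integral_Ioc {F : ℝ → ℝ} (hc : ContinuousOn F (Ioi 0))
    (hi : ∀ x, 0 < x → IntegrableOn F (Ioc 0 x)) {x : ℝ} (hx : 0 < x) :
    HasDerivAt (fun x => ∫ y in Ioc 0 x, F y) (F x) x := by
  have h := intervalIntegral.integral_hasDerivAt_right (a := 0)
    ((intervalIntegrable_iff_integrableOn_Ioc_of_le hx.le).2 (hi x hx))
    (hc.stronglyMeasurableAtFilter isOpen_Ioi x hx) (hc.continuousAt (Ioi_mem_nhds hx))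
  refine h.congr_of_eventuallyEq ?_
  filter_upwards [Ioi_mem_nhds hx] with y hy
  rw [intervalIntegral.integral_of_le (le_of_lt hy)]

theorem hasDerivAt_integral_Ioi {F : ℝ → ℝ} (hc : ContinuousOn F (Ioi 0))
    (hi : ∀ x, 0 < x → IntegrableOn F (Ioi x)) {x : ℝ} (hx : 0 < x) :
    HasDerivAt (fun x => ∫ y in Ioi x, F y) (-F x) x := by
  have hii : IntervalIntegrable F volume (x / 2) x :=
    (intervalIntegrable_iff_integrableOn_Ioc_of_le (by linarith)).2
      (integrableOn_Ioc_of_continuousOn hc (half_pos hx))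
  have h := intervalIntegral.integral_hasDerivAt_right hii
    (hc.stronglyMeasurableAtFilter isOpen_Ioi x hx) (hc.continuousAt (Ioi_mem_nhds hx))
  refine (h.const_sub (∫ y in Ioi (x / 2), F y)).congr_of_eventuallyEq ?_
  filter_upwards [Ioi_mem_nhds hx] with y hy
  rw [← intervalIntegral.integral_Ioi_sub_Ioi' (hi _ (half_pos hx)) (hi y hy), sub_sub_cancel]

theorem tendsto_integral_Ioc {F : ℝ → ℝ} (hi : IntegrableOn F (Ioc 0 1)) :
    Tendsto (fun x => ∫ y in Ioc 0 x, F y) (𝓝[>] 0) (𝓝 0) := by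
  have h := intervalIntegral.continuousOn_primitive (f := F) (μ := volume) (a := 0) (b := 1)
    ((integrableOn_Icc_iff_integrableOn_Ioc).2 hi) 0 ⟨le_rfl, zero_le_one⟩
  have h2 := h.tendsto
  simp only [Ioc_self, Measure.restrict_empty, integral_zero_measure] at h2
  refine h2.mono_left ?_
  rw [← nhdsWithin_Ioc_eq_nhdsGT zero_lt_one]
  exact nhdsWithin_mono _ Ioc_subset_Icc_self

/-! ### Feller's test and the boundary values of solutions -/

/-- `α` is increasing, so if it does not tend to `0` it stays above some `ε > 0`. Then the finite
integral of `(∫_y^1 A) B α` bounds the Feller integral, contradicting its divergence. The abstract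
roles of `A`, `B` allow one use for the solution and one for its flux. -/
theorem tendsto_zero_of_lintegral_eq_top {A B α β : ℝ → ℝ} {c : ℝ} (hc : 0 < c) (hA : ContinuousOn A (Ioi 0))
    (hApos : ∀ x, 0 < x → 0 < A x) (hBpos : ∀ x, 0 < x → 0 < B x)
    (hα : ∀ x, 0 < x → HasDerivAt α (A x * β x) x)
    (hβ : ∀ x, 0 < x → HasDerivAt β (c * (B x * α x)) x)
    (αpos : ∀ x, 0 < x → 0 < α x) (βpos : ∀ x, 0 < x → 0 < β x)
    (h : (∫⁻ y in Ioc (0 : ℝ) 1, (∫⁻ z in Ioc y 1, ENNReal.ofReal (A z)) *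
      ENNReal.ofReal (B y)) = ⊤) :
    Tendsto α (𝓝[>] 0) (𝓝 0) := by
  have hmono : MonotoneOn α (Ioi 0) := monotoneOn_of_hasDerivAt_nonneg (convex_Ioi 0)
    (fun x hx => hα x hx) fun x hx =>
      (mul_pos (hApos x (interior_subset hx)) (βpos x (interior_subset hx))).le
  have key : ∀ ε > 0, ∃ x, 0 < x ∧ α x < ε := by
    intro ε hε
    by_contra! hcon
    set a : ℝ → ℝ := fun y => ∫ z in (1 : ℝ)..y, A z
    have ha : ∀ y, 0 < y → HasDerivAt a (A y) y := fun y hy => by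
      refine intervalIntegral.integral_hasDerivAt_right ?_
        (hA.stronglyMeasurableAtFilter isOpen_Ioi y hy) (hA.continuousAt (Ioi_mem_nhds hy))
      refine (hA.mono fun z hz => ?_).intervalIntegrable
      exact lt_of_lt_of_le (lt_min zero_lt_one hy) hz.1
    have ha0 : ∀ y ∈ Ioc (0 : ℝ) 1, 0 ≤ -a y := fun y hy => by
      simp only [a]
      rw [← intervalIntegral.integral_symm]
      exact intervalIntegral.integral_nonneg hy.2 fun z hz =>
        (hApos z (lt_of_lt_of_le hy.1 hz.1)).le
    -- In the derivative of `α - a β` the terms `A β` cancel and `-c a B α` is left; both `α - a β`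
    -- and this derivative are nonnegative on `(0, 1]`, where `a ≤ 0`.
    have hint : IntegrableOn (fun y => -a y * (c * (B y * α y))) (Ioc 0 1) := by
      refine integrableOn_Ioc_zero_of_deriv_nonneg (f := fun y => α y + -a y * β y)
        (fun y hy => ?_) (fun y hy => ?_) (fun y hy => ?_)
      · refine ((hα y hy.1).add ((ha y hy.1).neg.mul (hβ y hy.1))).congr_deriv ?_
        simp only [Pi.neg_apply]
        ring
      · exact mul_nonneg (ha0 y hy) (mul_pos hc (mul_pos (hBpos y hy.1) (αpos y hy.1))).le
      · exact add_nonneg (αpos y hy.1).le (mul_nonneg (ha0 y hy) (βpos y hy.1).le)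
    have hlt := (hint.div_const (c * ε)).lintegral_lt_top
    refine absurd h (ne_of_lt (lt_of_le_of_lt ?_ hlt))
    refine setLIntegral_mono' measurableSet_Ioc fun y hy => ?_
    have e1 : ∫⁻ z in Ioc y 1, ENNReal.ofReal (A z) = ENNReal.ofReal (-a y) := by
      rw [← ofReal_integral_eq_lintegral_ofReal]
      · rw [← intervalIntegral.integral_of_le hy.2, intervalIntegral.integral_symm]
      · exact integrableOn_Ioc_of_continuousOn hA hy.1
      · exact (ae_restrict_iff' measurableSet_Ioc).2 (Eventually.of_forall fun z hz =>
          (hApos z (lt_trans hy.1 hz.1)).le)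
    rw [e1, ← ENNReal.ofReal_mul (ha0 y hy)]
    refine ENNReal.ofReal_le_ofReal ?_
    rw [mul_div_assoc, mul_div_mul_left _ _ hc.ne', mul_div_assoc]
    refine mul_le_mul_of_nonneg_left ?_ (ha0 y hy)
    refine le_mul_of_one_le_right (hBpos y hy.1).le ?_
    rw [one_le_div hε]
    exact hcon y hy.1
  rw [Metric.tendsto_nhds]
  intro ε hε
  obtain ⟨x, hx, hxe⟩ := key ε hε
  filter_upwards [Ioo_mem_nhdsGT hx] with y hy
  rw [Real.dist_eq, sub_zero, abs_of_pos (αpos y hy.1)]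
  exact lt_of_le_of_lt (hmono hy.1 hx hy.2.le) hxe

/-- The mirror image at `∞`: here `α + a β` is nonnegative and decreasing on `[1, ∞)`, with
derivative `-c a B α`. -/
theorem tendsto_atTop_zero_of_lintegral_eq_top {A B α β : ℝ → ℝ} {c : ℝ} (hc : 0 < c) (hA : ContinuousOn A (Ioi 0))
    (hApos : ∀ x, 0 < x → 0 < A x) (hBpos : ∀ x, 0 < x → 0 < B x)
    (hα : ∀ x, 0 < x → HasDerivAt α (-(A x * β x)) x)
    (hβ : ∀ x, 0 < x → HasDerivAt β (-(c * (B x * α x))) x)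
    (αpos : ∀ x, 0 < x → 0 < α x) (βpos : ∀ x, 0 < x → 0 < β x)
    (h : (∫⁻ y in Ioi (1 : ℝ), (∫⁻ z in Ioc 1 y, ENNReal.ofReal (A z)) *
      ENNReal.ofReal (B y)) = ⊤) :
    Tendsto α atTop (𝓝 0) := by
  have hanti : AntitoneOn α (Ioi 0) := antitoneOn_of_hasDerivAt_nonpos (convex_Ioi 0)
    (fun x hx => hα x hx) fun x hx => neg_nonpos.2
      (mul_pos (hApos x (interior_subset hx)) (βpos x (interior_subset hx))).le
  have key : ∀ ε > 0, ∃ x, 0 < x ∧ α x < ε := by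
    intro ε hε
    by_contra! hcon
    set a : ℝ → ℝ := fun y => ∫ z in (1 : ℝ)..y, A z
    have ha : ∀ y, 0 < y → HasDerivAt a (A y) y := fun y hy => by
      refine intervalIntegral.integral_hasDerivAt_right ?_
        (hA.stronglyMeasurableAtFilter isOpen_Ioi y hy) (hA.continuousAt (Ioi_mem_nhds hy))
      refine (hA.mono fun z hz => ?_).intervalIntegrable
      exact lt_of_lt_of_le (lt_min zero_lt_one hy) hz.1
    have ha0 : ∀ y ∈ Ici (1 : ℝ), 0 ≤ a y := fun y hy =>
      intervalIntegral.integral_nonneg hy fun z hz =>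
        (hApos z (lt_of_lt_of_le zero_lt_one hz.1)).le
    have hpos : ∀ y ∈ Ici (1 : ℝ), 0 < y := fun y hy => lt_of_lt_of_le zero_lt_one hy
    have hint : IntegrableOn (fun y => -(a y * (c * (B y * α y)))) (Ioi 1) := by
      refine integrableOn_Ioi_of_deriv_nonpos (f := fun y => α y + a y * β y)
        (fun y hy => ?_) (fun y hy => ?_) (fun y hy => ?_)
      · refine ((hα y (hpos y hy)).add ((ha y (hpos y hy)).mul (hβ y (hpos y hy)))).congr_deriv ?_
        ring
      · exact neg_nonpos.2
          (mul_nonneg (ha0 y hy)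
            (mul_pos hc (mul_pos (hBpos y (hpos y hy)) (αpos y (hpos y hy)))).le)
      · exact add_nonneg (αpos y (hpos y hy)).le
          (mul_nonneg (ha0 y hy) (βpos y (hpos y hy)).le)
    have hlt := (hint.neg.div_const (c * ε)).lintegral_lt_top
    refine absurd h (ne_of_lt (lt_of_le_of_lt ?_ hlt))
    refine setLIntegral_mono' measurableSet_Ioi fun y hy => ?_
    have hy1 : y ∈ Ici (1 : ℝ) := mem_Ici.2 (le_of_lt hy)
    have e1 : ∫⁻ z in Ioc 1 y, ENNReal.ofReal (A z) = ENNReal.ofReal (a y) := by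
      rw [← ofReal_integral_eq_lintegral_ofReal]
      · rw [← intervalIntegral.integral_of_le hy1]
      · exact integrableOn_Ioc_of_continuousOn hA zero_lt_one
      · exact (ae_restrict_iff' measurableSet_Ioc).2 (Eventually.of_forall fun z hz =>
          (hApos z (lt_trans zero_lt_one hz.1)).le)
    rw [e1, ← ENNReal.ofReal_mul (ha0 y hy1)]
    refine ENNReal.ofReal_le_ofReal ?_
    simp only [Pi.neg_apply, neg_neg]
    rw [mul_div_assoc, mul_div_mul_left _ _ hc.ne', mul_div_assoc]
    refine mul_le_mul_of_nonneg_left ?_ (ha0 y hy1)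
    refine le_mul_of_one_le_right (hBpos y (hpos y hy1)).le ?_
    rw [one_le_div hε]
    exact hcon y (hpos y hy1)
  rw [Metric.tendsto_nhds]
  intro ε hε
  obtain ⟨x, hx, hxe⟩ := key ε hε
  filter_upwards [eventually_gt_atTop x] with y hy
  rw [Real.dist_eq, sub_zero, abs_of_pos (αpos y (hx.trans hy))]
  exact lt_of_le_of_lt (hanti hx (hx.trans hy) hy.le) hxe

/-! ### Fundamental solutions and their fluxes as first-order systems -/

/-- Positive continuous scale and speed densities on `(0, ∞)`. -/
structure IsDensityPair (S m : ℝ → ℝ) : Prop where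
  scale_continuous : ContinuousOn S (Ioi 0)
  speed_continuous : ContinuousOn m (Ioi 0)
  scale_pos : ∀ x, 0 < x → 0 < S x
  speed_pos : ∀ x, 0 < x → 0 < m x

/-- `ψ` is a positive solution of `(d/dm)(d/dS) ψ = s ψ` with positive flux `p = dψ/dS`, both of
which vanish at `0`. -/
structure IncreasingPair (S m : ℝ → ℝ) (s : ℝ) (ψ p : ℝ → ℝ) : Prop where
  pos : ∀ x, 0 < x → 0 < ψ x
  flux_pos : ∀ x, 0 < x → 0 < p x
  hasDerivAt : ∀ x, 0 < x → HasDerivAt ψ (S x * p x) x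
  flux_hasDerivAt : ∀ x, 0 < x → HasDerivAt p (s * m x * ψ x) x
  tendsto : Tendsto ψ (𝓝[>] 0) (𝓝 0)
  flux_tendsto : Tendsto p (𝓝[>] 0) (𝓝 0)

/-- `φ` is a positive solution of `(d/dm)(d/dS) φ = s φ` with negative flux `-q = dφ/dS`, both of
which vanish at `∞`. -/
structure DecreasingPair (S m : ℝ → ℝ) (s : ℝ) (φ q : ℝ → ℝ) : Prop where
  pos : ∀ x, 0 < x → 0 < φ x
  flux_pos : ∀ x, 0 < x → 0 < q x
  hasDerivAt : ∀ x, 0 < x → HasDerivAt φ (-(S x * q x)) x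
  flux_hasDerivAt : ∀ x, 0 < x → HasDerivAt q (-(s * m x * φ x)) x
  tendsto : Tendsto φ atTop (𝓝 0)
  flux_tendsto : Tendsto q atTop (𝓝 0)

theorem hasDerivAt_scaleDensity {μ σ : ℝ → ℝ} (hX : IsNaturalDiffusion μ σ) {x : ℝ} (hx : 0 < x) :
    HasDerivAt (scaleDensity μ σ) (-(2 * μ x / σ x ^ 2) * scaleDensity μ σ x) x := by
  have hc : ContinuousOn (fun z => 2 * μ z / σ z ^ 2) (Ioi 0) :=
    (continuousOn_const.mul hX.drift_differentiable.continuousOn).div (hX.vol_continuous.pow 2)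
      fun y hy => (pow_pos (hX.vol_pos y hy) 2).ne'
  have hi : IntervalIntegrable (fun z => 2 * μ z / σ z ^ 2) volume 1 x :=
    (hc.mono fun z hz => lt_of_lt_of_le (lt_min zero_lt_one hx) hz.1).intervalIntegrable
  have h := (intervalIntegral.integral_hasDerivAt_right hi
    (hc.stronglyMeasurableAtFilter isOpen_Ioi x hx) (hc.continuousAt (Ioi_mem_nhds hx))).neg.exp
  refine h.congr_deriv ?_
  simp only [scaleDensity, Pi.neg_apply]
  ring

theorem isDensityPair {μ σ : ℝ → ℝ} (hX : IsNaturalDiffusion μ σ) :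
    IsDensityPair (scaleDensity μ σ) (speedDensity μ σ) := by
  have hS : ContinuousOn (scaleDensity μ σ) (Ioi 0) := fun x hx =>
    (hasDerivAt_scaleDensity hX hx).continuousAt.continuousWithinAt
  have hpos : ∀ x, 0 < scaleDensity μ σ x := fun x => Real.exp_pos _
  refine ⟨hS, ?_, fun x _ => hpos x, fun x hx => ?_⟩
  · exact continuousOn_const.div ((hX.vol_continuous.pow 2).mul hS)
      fun x hx => (mul_pos (pow_pos (hX.vol_pos x hx) 2) (hpos x)).ne'
  · exact div_pos two_pos (mul_pos (pow_pos (hX.vol_pos x hx) 2) (hpos x))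

theorem IsPositiveHarmonic.hasDerivAt {μ σ f : ℝ → ℝ} {s : ℝ} (hf : IsPositiveHarmonic μ σ s f)
    {x : ℝ} (hx : 0 < x) : HasDerivAt f (deriv f x) x :=
  ((hf.contDiff.differentiableOn (by norm_num)).differentiableAt (Ioi_mem_nhds hx)).hasDerivAt

theorem IsPositiveHarmonic.hasDerivAt_scale {μ σ f : ℝ → ℝ} {s : ℝ}
    (hf : IsPositiveHarmonic μ σ s f) {x : ℝ} (hx : 0 < x) :
    HasDerivAt f (scaleDensity μ σ x * (deriv f x / scaleDensity μ σ x)) x := by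
  rw [mul_div_cancel₀ _ (show scaleDensity μ σ x ≠ 0 from (Real.exp_pos _).ne')]
  exact hf.hasDerivAt hx

theorem IsPositiveHarmonic.hasDerivAt_flux {μ σ f : ℝ → ℝ} {s : ℝ} (hX : IsNaturalDiffusion μ σ)
    (hf : IsPositiveHarmonic μ σ s f) {x : ℝ} (hx : 0 < x) :
    HasDerivAt (fun y => deriv f y / scaleDensity μ σ y) (s * speedDensity μ σ x * f x) x := by
  have h2 : ContDiffOn ℝ 1 (deriv f) (Ioi 0) :=
    ((contDiffOn_succ_iff_deriv_of_isOpen (n := 1) isOpen_Ioi).1 hf.contDiff).2.2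
  have hd : HasDerivAt (deriv f) (deriv (deriv f) x) x :=
    ((h2.differentiableOn (by norm_num)).differentiableAt (Ioi_mem_nhds hx)).hasDerivAt
  have hS : scaleDensity μ σ x ≠ 0 := (Real.exp_pos _).ne'
  have hσ : σ x ≠ 0 := (hX.vol_pos x hx).ne'
  refine (hd.div (hasDerivAt_scaleDensity hX hx) hS).congr_deriv ?_
  have hh := hf.harmonic x hx
  rw [generator] at hh
  have : s * f x = μ x * deriv f x + 1 / 2 * σ x ^ 2 * deriv (deriv f) x := by linarith
  rw [show s * speedDensity μ σ x * f x = speedDensity μ σ x * (s * f x) by ring, this,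
    speedDensity]
  field_simp
  ring

theorem IsIncreasingFundamental.increasingPair {μ σ ψ : ℝ → ℝ} {s : ℝ} (hs : 0 < s)
    (hX : IsNaturalDiffusion μ σ) (hψ : IsIncreasingFundamental μ σ s ψ) :
    IncreasingPair (scaleDensity μ σ) (speedDensity μ σ) s ψ
      (fun x => deriv ψ x / scaleDensity μ σ x) := by
  obtain ⟨hf, hm⟩ := hψ
  have hD := isDensityPair hX
  have hd := fun x (hx : 0 < x) => hf.hasDerivAt_scale hx
  have hd2 := fun x (hx : 0 < x) => hf.hasDerivAt_flux hX hx
  set p : ℝ → ℝ := fun x => deriv ψ x / scaleDensity μ σ x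
  have hp0 : ∀ x, 0 < x → 0 ≤ p x := fun x hx => by
    refine div_nonneg ?_ (Real.exp_pos _).le
    rw [← derivWithin_of_isOpen isOpen_Ioi (mem_Ioi.2 hx)]
    exact hm.monotoneOn.derivWithin_nonneg
  -- Monotonicity of `ψ` only gives `p ≥ 0`; the equation `p' = s m ψ > 0` upgrades this to `p > 0`.
  have hpm : StrictMonoOn p (Ioi 0) := strictMonoOn_of_hasDerivAt_pos (convex_Ioi 0)
    (fun x hx => hd2 x hx) fun x hx => by
      rw [interior_Ioi] at hx
      exact mul_pos (mul_pos hs (hD.speed_pos x hx)) (hf.pos x hx)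
  have hp : ∀ x, 0 < x → 0 < p x := fun x hx =>
    (hp0 _ (half_pos hx)).trans_lt (hpm (half_pos hx) hx (half_lt_self hx))
  refine ⟨hf.pos, hp, hd, hd2, ?_, ?_⟩
  · exact tendsto_zero_of_lintegral_eq_top hs hD.scale_continuous hD.scale_pos hD.speed_pos hd
      (fun x hx => (hd2 x hx).congr_deriv (by ring)) hf.pos hp hX.natural_zero.2
  -- The roles of scale and speed are exchanged: `p' = m (s ψ)` and `(s ψ)' = s S p`. This uses the
  -- other half of Feller's test.
  · exact tendsto_zero_of_lintegral_eq_top (β := fun x => s * ψ x) hs hD.speed_continuous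
      hD.speed_pos hD.scale_pos (fun x hx => (hd2 x hx).congr_deriv (by ring))
      (fun x hx => (hd x hx).const_mul s) hp (fun x hx => mul_pos hs (hf.pos x hx))
      hX.natural_zero.1

theorem IsDecreasingFundamental.decreasingPair {μ σ φ : ℝ → ℝ} {s : ℝ} (hs : 0 < s)
    (hX : IsNaturalDiffusion μ σ) (hφ : IsDecreasingFundamental μ σ s φ) :
    DecreasingPair (scaleDensity μ σ) (speedDensity μ σ) s φ
      (fun x => -(deriv φ x / scaleDensity μ σ x)) := by
  obtain ⟨hf, hm⟩ := hφ
  have hD := isDensityPair hX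
  set q : ℝ → ℝ := fun x => -(deriv φ x / scaleDensity μ σ x)
  have hd : ∀ x, 0 < x → HasDerivAt φ (-(scaleDensity μ σ x * q x)) x := fun x hx =>
    (hf.hasDerivAt_scale hx).congr_deriv (by simp only [q]; ring)
  have hd2 : ∀ x, 0 < x → HasDerivAt q (-(s * speedDensity μ σ x * φ x)) x := fun x hx =>
    (hf.hasDerivAt_flux hX hx).neg
  have hq0 : ∀ x, 0 < x → 0 ≤ q x := fun x hx => by
    refine neg_nonneg.2 (div_nonpos_of_nonpos_of_nonneg ?_ (Real.exp_pos _).le)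
    rw [← derivWithin_of_isOpen isOpen_Ioi (mem_Ioi.2 hx)]
    exact hm.antitoneOn.derivWithin_nonpos
  have hqm : StrictAntiOn q (Ioi 0) := strictAntiOn_of_hasDerivAt_neg (convex_Ioi 0)
    (fun x hx => hd2 x hx) fun x hx => by
      rw [interior_Ioi] at hx
      exact neg_neg_of_pos (mul_pos (mul_pos hs (hD.speed_pos x hx)) (hf.pos x hx))
  have hq : ∀ x, 0 < x → 0 < q x := fun x hx =>
    (hq0 (x + 1) (by linarith)).trans_lt
      (hqm (mem_Ioi.2 hx) (mem_Ioi.2 (by linarith)) (by linarith))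
  refine ⟨hf.pos, hq, hd, hd2, ?_, ?_⟩
  · exact tendsto_atTop_zero_of_lintegral_eq_top hs hD.scale_continuous hD.scale_pos hD.speed_pos
      hd (fun x hx => (hd2 x hx).congr_deriv (by ring)) hf.pos hq hX.natural_infinity.2
  · exact tendsto_atTop_zero_of_lintegral_eq_top (β := fun x => s * φ x) hs hD.speed_continuous
      hD.speed_pos hD.scale_pos (fun x hx => (hd2 x hx).congr_deriv (by ring))
      (fun x hx => ((hd x hx).const_mul s).congr_deriv (by ring)) hq
      (fun x hx => mul_pos hs (hf.pos x hx)) hX.natural_infinity.1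

/-! ### Comparison of solutions at two rates -/

section Ratios

variable {S m ψr pr ψs ps φr qr φs qs : ℝ → ℝ} {r s : ℝ}

theorem IncreasingPair.strictMonoOn (hD : IsDensityPair S m) (h : IncreasingPair S m s ψs ps) :
    StrictMonoOn ψs (Ioi 0) :=
  strictMonoOn_of_hasDerivAt_pos (convex_Ioi 0) (fun x hx => h.hasDerivAt x hx) fun x hx => by
    rw [interior_Ioi] at hx
    exact mul_pos (hD.scale_pos x hx) (h.flux_pos x hx)

theorem IncreasingPair.flux_strictMonoOn (hD : IsDensityPair S m) (hs : 0 < s)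
    (h : IncreasingPair S m s ψs ps) : StrictMonoOn ps (Ioi 0) :=
  strictMonoOn_of_hasDerivAt_pos (convex_Ioi 0) (fun x hx => h.flux_hasDerivAt x hx)
    fun x hx => by
      rw [interior_Ioi] at hx
      exact mul_pos (mul_pos hs (hD.speed_pos x hx)) (h.pos x hx)

theorem DecreasingPair.strictAntiOn (hD : IsDensityPair S m) (h : DecreasingPair S m s φs qs) :
    StrictAntiOn φs (Ioi 0) :=
  strictAntiOn_of_hasDerivAt_neg (convex_Ioi 0) (fun x hx => h.hasDerivAt x hx) fun x hx => by
    rw [interior_Ioi] at hx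
    exact neg_neg_of_pos (mul_pos (hD.scale_pos x hx) (h.flux_pos x hx))

theorem DecreasingPair.flux_strictAntiOn (hD : IsDensityPair S m) (hs : 0 < s)
    (h : DecreasingPair S m s φs qs) : StrictAntiOn qs (Ioi 0) :=
  strictAntiOn_of_hasDerivAt_neg (convex_Ioi 0) (fun x hx => h.flux_hasDerivAt x hx)
    fun x hx => by
      rw [interior_Ioi] at hx
      exact neg_neg_of_pos (mul_pos (mul_pos hs (hD.speed_pos x hx)) (h.pos x hx))

/-- The Wronskian of the fundamental solutions is constant. -/
theorem exists_wronskian_eq (hr : IncreasingPair S m r ψr pr) (hr' : DecreasingPair S m r φr qr) :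
    ∃ B, 0 < B ∧ ∀ x, 0 < x → φr x * pr x + qr x * ψr x = B := by
  refine ⟨φr 1 * pr 1 + qr 1 * ψr 1, add_pos
    (mul_pos (hr'.pos 1 one_pos) (hr.flux_pos 1 one_pos))
    (mul_pos (hr'.flux_pos 1 one_pos) (hr.pos 1 one_pos)), fun x hx => ?_⟩
  exact eq_of_hasDerivAt_zero (f := fun y => φr y * pr y + qr y * ψr y) (fun y hy =>
    (((hr'.hasDerivAt y hy).mul (hr.flux_hasDerivAt y hy)).add
      ((hr'.flux_hasDerivAt y hy).mul (hr.hasDerivAt y hy))).congr_deriv (by ring)) hx one_pos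

theorem IncreasingPair.hasDerivAt_det (h : IncreasingPair S m r ψr pr)
    (h' : IncreasingPair S m s ψs ps) {x : ℝ} (hx : 0 < x) :
    HasDerivAt (fun x => ψr x * ps x - ψs x * pr x) ((s - r) * (m x * ψr x * ψs x)) x :=
  (((h.hasDerivAt x hx).mul (h'.flux_hasDerivAt x hx)).sub
    ((h'.hasDerivAt x hx).mul (h.flux_hasDerivAt x hx))).congr_deriv (by ring)

/-- The determinant vanishes at `0` and has derivative `(s - r) m ψ_r ψ_s > 0`. Up to the factor `S
/ ψ_r²` it is the derivative of `ψ_s / ψ_r`. -/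
theorem IncreasingPair.det_pos (hD : IsDensityPair S m) (hrs : r < s)
    (h : IncreasingPair S m r ψr pr) (h' : IncreasingPair S m s ψs ps) {x : ℝ} (hx : 0 < x) :
    0 < ψr x * ps x - ψs x * pr x := by
  refine pos_of_strictMonoOn_of_tendsto (f := fun x => ψr x * ps x - ψs x * pr x) hx
    (strictMonoOn_of_hasDerivAt_pos (convex_Ioc 0 x) (fun y hy => h.hasDerivAt_det h' hy.1)
      fun y hy => ?_) ?_
  · have hy := (interior_subset hy).1
    exact mul_pos (sub_pos.2 hrs) (mul_pos (mul_pos (hD.speed_pos y hy) (h.pos y hy))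
      (h'.pos y hy))
  · simpa using (h.tendsto.mul h'.flux_tendsto).sub (h'.tendsto.mul h.flux_tendsto)

/-- Again zero at `0`, now with derivative `(s - r) S p_r p_s > 0`. Up to the factor `m / p_r²` it
is the derivative of `p_s / p_r`. -/
theorem IncreasingPair.flux_det_pos (hD : IsDensityPair S m) (hrs : r < s)
    (h : IncreasingPair S m r ψr pr) (h' : IncreasingPair S m s ψs ps) {x : ℝ} (hx : 0 < x) :
    0 < s * ψs x * pr x - r * ψr x * ps x := by
  refine pos_of_strictMonoOn_of_tendsto (f := fun x => s * ψs x * pr x - r * ψr x * ps x) hx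
    (strictMonoOn_of_hasDerivAt_pos (f' := fun x => (s - r) * (S x * pr x * ps x))
      (convex_Ioc 0 x) (fun y hy => ?_) fun y hy => ?_) ?_
  · exact ((((h'.hasDerivAt y hy.1).const_mul s).mul (h.flux_hasDerivAt y hy.1)).sub
      (((h.hasDerivAt y hy.1).const_mul r).mul (h'.flux_hasDerivAt y hy.1))).congr_deriv (by ring)
  · have hy := (interior_subset hy).1
    exact mul_pos (sub_pos.2 hrs) (mul_pos (mul_pos (hD.scale_pos y hy) (h.flux_pos y hy))
      (h'.flux_pos y hy))
  · simpa using ((h'.tendsto.const_mul s).mul h.flux_tendsto).sub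
      ((h.tendsto.const_mul r).mul h'.flux_tendsto)

theorem DecreasingPair.det_pos (hD : IsDensityPair S m) (hrs : r < s)
    (h : DecreasingPair S m r φr qr) (h' : DecreasingPair S m s φs qs) {x : ℝ} (hx : 0 < x) :
    0 < φr x * qs x - φs x * qr x := by
  refine pos_of_strictAntiOn_of_tendsto (f := fun x => φr x * qs x - φs x * qr x)
    (strictAntiOn_of_hasDerivAt_neg (f' := fun x => -((s - r) * (m x * φr x * φs x)))
      (convex_Ici x) (fun y hy => ?_) fun y hy => ?_) ?_
  · have hy : 0 < y := hx.trans_le hy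
    exact (((h.hasDerivAt y hy).mul (h'.flux_hasDerivAt y hy)).sub
      ((h'.hasDerivAt y hy).mul (h.flux_hasDerivAt y hy))).congr_deriv (by ring)
  · have hy : 0 < y := hx.trans_le (interior_subset hy)
    exact neg_neg_of_pos (mul_pos (sub_pos.2 hrs)
      (mul_pos (mul_pos (hD.speed_pos y hy) (h.pos y hy)) (h'.pos y hy)))
  · simpa using (h.tendsto.mul h'.flux_tendsto).sub (h'.tendsto.mul h.flux_tendsto)

theorem DecreasingPair.flux_det_pos (hD : IsDensityPair S m) (hrs : r < s)
    (h : DecreasingPair S m r φr qr) (h' : DecreasingPair S m s φs qs) {x : ℝ} (hx : 0 < x) :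
    0 < s * φs x * qr x - r * φr x * qs x := by
  refine pos_of_strictAntiOn_of_tendsto (f := fun x => s * φs x * qr x - r * φr x * qs x)
    (strictAntiOn_of_hasDerivAt_neg (f' := fun x => -((s - r) * (S x * qr x * qs x)))
      (convex_Ici x) (fun y hy => ?_) fun y hy => ?_) ?_
  · have hy : 0 < y := hx.trans_le hy
    exact ((((h'.hasDerivAt y hy).const_mul s).mul (h.flux_hasDerivAt y hy)).sub
      (((h.hasDerivAt y hy).const_mul r).mul (h'.flux_hasDerivAt y hy))).congr_deriv (by ring)
  · have hy : 0 < y := hx.trans_le (interior_subset hy)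
    exact neg_neg_of_pos (mul_pos (sub_pos.2 hrs)
      (mul_pos (mul_pos (hD.scale_pos y hy) (h.flux_pos y hy)) (h'.flux_pos y hy)))
  · simpa using ((h'.tendsto.const_mul s).mul h.flux_tendsto).sub
      ((h.tendsto.const_mul r).mul h'.flux_tendsto)

theorem IncreasingPair.ratio_monotoneOn (hD : IsDensityPair S m) (hrs : r < s)
    (h : IncreasingPair S m r ψr pr) (h' : IncreasingPair S m s ψs ps) :
    MonotoneOn (fun x => ψs x / ψr x) (Ioi 0) :=
  monotoneOn_of_hasDerivAt_nonneg
    (f' := fun x => S x * (ψr x * ps x - ψs x * pr x) / ψr x ^ 2) (convex_Ioi 0)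
    (fun x hx => ((h'.hasDerivAt x hx).div (h.hasDerivAt x hx) (h.pos x hx).ne').congr_deriv
      (by ring))
    fun x hx => by
      rw [interior_Ioi] at hx
      exact div_nonneg (mul_nonneg (hD.scale_pos x hx).le (h.det_pos hD hrs h' hx).le)
        (sq_nonneg _)

theorem IncreasingPair.flux_ratio_monotoneOn (hD : IsDensityPair S m) (hrs : r < s)
    (h : IncreasingPair S m r ψr pr) (h' : IncreasingPair S m s ψs ps) :
    MonotoneOn (fun x => ps x / pr x) (Ioi 0) :=
  monotoneOn_of_hasDerivAt_nonneg
    (f' := fun x => m x * (s * ψs x * pr x - r * ψr x * ps x) / pr x ^ 2) (convex_Ioi 0)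
    (fun x hx => ((h'.flux_hasDerivAt x hx).div (h.flux_hasDerivAt x hx)
      (h.flux_pos x hx).ne').congr_deriv (by ring))
    fun x hx => by
      rw [interior_Ioi] at hx
      exact div_nonneg (mul_nonneg (hD.speed_pos x hx).le (h.flux_det_pos hD hrs h' hx).le)
        (sq_nonneg _)

theorem DecreasingPair.ratio_antitoneOn (hD : IsDensityPair S m) (hrs : r < s)
    (h : DecreasingPair S m r φr qr) (h' : DecreasingPair S m s φs qs) :
    AntitoneOn (fun x => φs x / φr x) (Ioi 0) :=
  antitoneOn_of_hasDerivAt_nonpos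
    (f' := fun x => -(S x * (φr x * qs x - φs x * qr x) / φr x ^ 2)) (convex_Ioi 0)
    (fun x hx => ((h'.hasDerivAt x hx).div (h.hasDerivAt x hx) (h.pos x hx).ne').congr_deriv
      (by ring))
    fun x hx => by
      rw [interior_Ioi] at hx
      exact neg_nonpos.2 (div_nonneg
        (mul_nonneg (hD.scale_pos x hx).le (h.det_pos hD hrs h' hx).le) (sq_nonneg _))

theorem DecreasingPair.flux_ratio_antitoneOn (hD : IsDensityPair S m) (hrs : r < s)
    (h : DecreasingPair S m r φr qr) (h' : DecreasingPair S m s φs qs) :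
    AntitoneOn (fun x => qs x / qr x) (Ioi 0) :=
  antitoneOn_of_hasDerivAt_nonpos
    (f' := fun x => -(m x * (s * φs x * qr x - r * φr x * qs x) / qr x ^ 2)) (convex_Ioi 0)
    (fun x hx => ((h'.flux_hasDerivAt x hx).div (h.flux_hasDerivAt x hx)
      (h.flux_pos x hx).ne').congr_deriv (by ring))
    fun x hx => by
      rw [interior_Ioi] at hx
      exact neg_nonpos.2 (div_nonneg
        (mul_nonneg (hD.speed_pos x hx).le (h.flux_det_pos hD hrs h' hx).le) (sq_nonneg _))

/-! ### Limits of ratios and of mixed Wronskians at the boundaries. -/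

theorem exists_tendsto_of_monotoneOn {f : ℝ → ℝ} (hf : MonotoneOn f (Ioi 0))
    (h0 : ∀ x, 0 < x → 0 ≤ f x) :
    ∃ l, 0 ≤ l ∧ Tendsto f (𝓝[>] 0) (𝓝 l) ∧ ∀ x, 0 < x → l ≤ f x := by
  have h1 := hf.tendsto_nhdsGT (α := ℝ) (x := 0)
    ⟨0, by rintro _ ⟨y, hy, rfl⟩; exact h0 y hy⟩
  refine ⟨_, ?_, h1, fun x hx => le_of_tendsto h1 ?_⟩
  · exact ge_of_tendsto h1 (by filter_upwards [self_mem_nhdsWithin] with y hy using h0 y hy)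
  · filter_upwards [Ioo_mem_nhdsGT hx] with y hy using hf hy.1 hx hy.2.le

theorem exists_tendsto_of_antitoneOn {f : ℝ → ℝ} (hf : AntitoneOn f (Ioi 0))
    (h0 : ∀ x, 0 < x → 0 ≤ f x) :
    ∃ l, 0 ≤ l ∧ Tendsto f atTop (𝓝 l) ∧ ∀ x, 0 < x → l ≤ f x := by
  have hp : ∀ x : ℝ, 0 < max 1 x := fun x => lt_max_of_lt_left one_pos
  have hg : Antitone fun y => f (max 1 y) := fun a b hab =>
    hf (hp a) (hp b) (max_le_max le_rfl hab)
  have h1 := (tendsto_atTop_ciInf hg ⟨0, by rintro _ ⟨y, rfl⟩; exact h0 _ (hp y)⟩).congr'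
    (f₂ := f) (by
      filter_upwards [eventually_ge_atTop 1] with y hy
      simp [max_eq_right hy])
  refine ⟨_, ?_, h1, fun x hx => le_of_tendsto h1 ?_⟩
  · exact ge_of_tendsto h1 (by filter_upwards [eventually_gt_atTop 0] with y hy using h0 y hy)
  · filter_upwards [eventually_gt_atTop x] with y hy using hf hx (hx.trans hy) hy.le

/-- At a natural boundary the solutions at a larger rate are of smaller order. -/
theorem IncreasingPair.tendsto_ratio (hD : IsDensityPair S m) (hr : 0 < r) (hrs : r < s)
    (h : IncreasingPair S m r ψr pr) (h' : IncreasingPair S m s ψs ps) :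
    Tendsto (fun x => ψs x / ψr x) (𝓝[>] 0) (𝓝 0) ∧
      Tendsto (fun x => ps x / pr x) (𝓝[>] 0) (𝓝 0) := by
  obtain ⟨u, hu0, hu, hul⟩ := exists_tendsto_of_monotoneOn (h.ratio_monotoneOn hD hrs h')
    fun x hx => (div_pos (h'.pos x hx) (h.pos x hx)).le
  obtain ⟨v, hv0, hv, hvl⟩ := exists_tendsto_of_monotoneOn (h.flux_ratio_monotoneOn hD hrs h')
    fun x hx => (div_pos (h'.flux_pos x hx) (h.flux_pos x hx)).le
  -- Since `p_s ≥ v p_r`, the function `ψ_s - v ψ_r` is increasing from `0`, so `v ≤ ψ_s / ψ_r`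
  -- everywhere.
  have h1 : v ≤ u := by
    refine ge_of_tendsto hu ?_
    filter_upwards [self_mem_nhdsWithin] with x hx
    rw [le_div_iff₀ (h.pos x hx), ← sub_nonneg]
    refine nonneg_of_monotoneOn_of_tendsto (f := fun x => ψs x - v * ψr x) hx
      (monotoneOn_of_hasDerivAt_nonneg (f' := fun x => S x * (ps x - v * pr x)) (convex_Ioc 0 x)
        (fun y hy => ((h'.hasDerivAt y hy.1).sub
          ((h.hasDerivAt y hy.1).const_mul v)).congr_deriv (by ring)) fun y hy => ?_) ?_
    · have hy := (interior_subset hy).1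
      have := hvl y hy
      rw [le_div_iff₀ (h.flux_pos y hy)] at this
      exact mul_nonneg (hD.scale_pos y hy).le (sub_nonneg.2 this)
    · simpa using h'.tendsto.sub (h.tendsto.const_mul v)
  -- Since `ψ_s ≥ u ψ_r`, the function `p_s - (s/r) u p_r` is increasing from `0`. The factor `s/r`
  -- arises because the flux equations carry the rates. Together with `v ≤ u` and `s/r > 1` it
  -- forces `u = v = 0`.
  have h2 : s / r * u ≤ v := by
    refine ge_of_tendsto hv ?_
    filter_upwards [self_mem_nhdsWithin] with x hx
    rw [le_div_iff₀ (h.flux_pos x hx), ← sub_nonneg]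
    refine nonneg_of_monotoneOn_of_tendsto (f := fun x => ps x - s / r * u * pr x) hx
      (monotoneOn_of_hasDerivAt_nonneg (f' := fun x => s * m x * (ψs x - u * ψr x))
        (convex_Ioc 0 x)
        (fun y hy => ((h'.flux_hasDerivAt y hy.1).sub
          ((h.flux_hasDerivAt y hy.1).const_mul (s / r * u))).congr_deriv
            (by field_simp)) fun y hy => ?_) ?_
    · have hy := (interior_subset hy).1
      have := hul y hy
      rw [le_div_iff₀ (h.pos y hy)] at this
      exact mul_nonneg (mul_pos (hr.trans hrs) (hD.speed_pos y hy)).le (sub_nonneg.2 this)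
    · simpa using h'.flux_tendsto.sub (h.flux_tendsto.const_mul (s / r * u))
  have h3 : 1 < s / r := (one_lt_div hr).2 hrs
  have hu' : u = 0 := by nlinarith
  have hv' : v = 0 := by linarith
  exact ⟨hu' ▸ hu, hv' ▸ hv⟩

theorem DecreasingPair.tendsto_ratio (hD : IsDensityPair S m) (hr : 0 < r) (hrs : r < s)
    (h : DecreasingPair S m r φr qr) (h' : DecreasingPair S m s φs qs) :
    Tendsto (fun x => φs x / φr x) atTop (𝓝 0) ∧
      Tendsto (fun x => qs x / qr x) atTop (𝓝 0) := by
  obtain ⟨u, hu0, hu, hul⟩ := exists_tendsto_of_antitoneOn (h.ratio_antitoneOn hD hrs h')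
    fun x hx => (div_pos (h'.pos x hx) (h.pos x hx)).le
  obtain ⟨v, hv0, hv, hvl⟩ := exists_tendsto_of_antitoneOn (h.flux_ratio_antitoneOn hD hrs h')
    fun x hx => (div_pos (h'.flux_pos x hx) (h.flux_pos x hx)).le
  have h1 : v ≤ u := by
    refine ge_of_tendsto hu ?_
    filter_upwards [eventually_gt_atTop 0] with x hx
    rw [le_div_iff₀ (h.pos x hx), ← sub_nonneg]
    refine nonneg_of_antitoneOn_of_tendsto (f := fun x => φs x - v * φr x)
      (antitoneOn_of_hasDerivAt_nonpos (f' := fun x => -(S x * (qs x - v * qr x))) (convex_Ici x)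
        (fun y hy => ((h'.hasDerivAt y (hx.trans_le hy)).sub
          ((h.hasDerivAt y (hx.trans_le hy)).const_mul v)).congr_deriv (by ring))
          fun y hy => ?_) ?_
    · have hy : 0 < y := hx.trans_le (interior_subset hy)
      have := hvl y hy
      rw [le_div_iff₀ (h.flux_pos y hy)] at this
      exact neg_nonpos.2 (mul_nonneg (hD.scale_pos y hy).le (sub_nonneg.2 this))
    · simpa using h'.tendsto.sub (h.tendsto.const_mul v)
  have h2 : s / r * u ≤ v := by
    refine ge_of_tendsto hv ?_
    filter_upwards [eventually_gt_atTop 0] with x hx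
    rw [le_div_iff₀ (h.flux_pos x hx), ← sub_nonneg]
    refine nonneg_of_antitoneOn_of_tendsto (f := fun x => qs x - s / r * u * qr x)
      (antitoneOn_of_hasDerivAt_nonpos (f' := fun x => -(s * m x * (φs x - u * φr x)))
        (convex_Ici x)
        (fun y hy => ((h'.flux_hasDerivAt y (hx.trans_le hy)).sub
          ((h.flux_hasDerivAt y (hx.trans_le hy)).const_mul (s / r * u))).congr_deriv
            (by field_simp; ring)) fun y hy => ?_) ?_
    · have hy : 0 < y := hx.trans_le (interior_subset hy)
      have := hul y hy
      rw [le_div_iff₀ (h.pos y hy)] at this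
      exact neg_nonpos.2
        (mul_nonneg (mul_pos (hr.trans hrs) (hD.speed_pos y hy)).le (sub_nonneg.2 this))
    · simpa using h'.flux_tendsto.sub (h.flux_tendsto.const_mul (s / r * u))
  have h3 : 1 < s / r := (one_lt_div hr).2 hrs
  have hu' : u = 0 := by nlinarith
  have hv' : v = 0 := by linarith
  exact ⟨hu' ▸ hu, hv' ▸ hv⟩

/-- Multiplying the Wronskian `B = φ_r p_r + q_r ψ_r` by `ψ_s/ψ_r + p_s/p_r`, which tends to `0`,
yields the mixed Wronskian plus positive terms. This covers the case in which `φ_r` and `q_r` blow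
up at `0`. -/
theorem tendsto_mixed_zero (hD : IsDensityPair S m) (hr : 0 < r) (hrs : r < s)
    (h : IncreasingPair S m r ψr pr) (h' : IncreasingPair S m s ψs ps)
    (hd : DecreasingPair S m r φr qr) :
    Tendsto (fun x => φr x * ps x + qr x * ψs x) (𝓝[>] 0) (𝓝 0) := by
  obtain ⟨B, hB, hw⟩ := exists_wronskian_eq h hd
  obtain ⟨hu, hv⟩ := h.tendsto_ratio hD hr hrs h'
  have hlim : Tendsto (fun x => (ψs x / ψr x + ps x / pr x) * B) (𝓝[>] 0) (𝓝 0) := by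
    simpa using (hu.add hv).mul_const B
  refine squeeze_zero' ?_ ?_ hlim
  · filter_upwards [self_mem_nhdsWithin] with x hx
    exact (add_pos (mul_pos (hd.pos x hx) (h'.flux_pos x hx))
      (mul_pos (hd.flux_pos x hx) (h'.pos x hx))).le
  · filter_upwards [self_mem_nhdsWithin] with x hx
    have h1 := h.pos x hx
    have h2 := h.flux_pos x hx
    have h3 := h'.pos x hx
    have h4 := h'.flux_pos x hx
    have h5 := hd.pos x hx
    have h6 := hd.flux_pos x hx
    have e : (ψs x / ψr x + ps x / pr x) * B = φr x * ps x + qr x * ψs x +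
        (ψs x / ψr x * (φr x * pr x) + ps x / pr x * (qr x * ψr x)) := by
      rw [← hw x hx]
      field_simp
      ring
    rw [e]
    exact le_add_of_nonneg_right (by positivity)

theorem tendsto_mixed_atTop (hD : IsDensityPair S m) (hr : 0 < r) (hrs : r < s)
    (h : DecreasingPair S m r φr qr) (h' : DecreasingPair S m s φs qs)
    (hd : IncreasingPair S m r ψr pr) :
    Tendsto (fun x => ψr x * qs x + pr x * φs x) atTop (𝓝 0) := by
  obtain ⟨B, hB, hw⟩ := exists_wronskian_eq hd h
  obtain ⟨hu, hv⟩ := h.tendsto_ratio hD hr hrs h'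
  have hlim : Tendsto (fun x => (φs x / φr x + qs x / qr x) * B) atTop (𝓝 0) := by
    simpa using (hu.add hv).mul_const B
  refine squeeze_zero' ?_ ?_ hlim
  · filter_upwards [eventually_gt_atTop 0] with x hx
    exact (add_pos (mul_pos (hd.pos x hx) (h'.flux_pos x hx))
      (mul_pos (hd.flux_pos x hx) (h'.pos x hx))).le
  · filter_upwards [eventually_gt_atTop 0] with x hx
    have h1 := h.pos x hx
    have h2 := h.flux_pos x hx
    have h3 := h'.pos x hx
    have h4 := h'.flux_pos x hx
    have h5 := hd.pos x hx
    have h6 := hd.flux_pos x hx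
    have e : (φs x / φr x + qs x / qr x) * B = ψr x * qs x + pr x * φs x +
        (φs x / φr x * (qr x * ψr x) + qs x / qr x * (φr x * pr x)) := by
      rw [← hw x hx]
      field_simp
      ring
    rw [e]
    exact le_add_of_nonneg_right (by positivity)

theorem tendsto_increasing_div_decreasing (hD : IsDensityPair S m)
    (h : IncreasingPair S m r ψr pr) (hd : DecreasingPair S m r φr qr) :
    Tendsto (fun x => ψr x / φr x) (𝓝[>] 0) (𝓝 0) := by
  have hlim : Tendsto (fun x => ψr x / φr 1) (𝓝[>] 0) (𝓝 0) := by
    simpa using h.tendsto.div_const (φr 1)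
  refine squeeze_zero' ?_ ?_ hlim
  · filter_upwards [self_mem_nhdsWithin] with x hx
    exact (div_pos (h.pos x hx) (hd.pos x hx)).le
  · filter_upwards [Ioo_mem_nhdsGT one_pos] with x hx
    exact div_le_div_of_nonneg_left (h.pos x hx.1).le (hd.pos 1 one_pos)
      ((hd.strictAntiOn hD).antitoneOn hx.1 (mem_Ioi.2 one_pos) hx.2.le)

theorem tendsto_decreasing_div_increasing (hD : IsDensityPair S m)
    (h : IncreasingPair S m r ψr pr) (hd : DecreasingPair S m r φr qr) :
    Tendsto (fun x => φr x / ψr x) atTop (𝓝 0) := by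
  have hlim : Tendsto (fun x => φr x / ψr 1) atTop (𝓝 0) := by
    simpa using hd.tendsto.div_const (ψr 1)
  refine squeeze_zero' ?_ ?_ hlim
  · filter_upwards [eventually_gt_atTop 0] with x hx
    exact (div_pos (hd.pos x hx) (h.pos x hx)).le
  · filter_upwards [eventually_gt_atTop 1] with x hx
    exact div_le_div_of_nonneg_left (hd.pos x (one_pos.trans hx)).le (h.pos 1 one_pos)
      ((h.strictMonoOn hD).monotoneOn (mem_Ioi.2 one_pos) (mem_Ioi.2 (one_pos.trans hx)) hx.le)

/-- The derivative is `-r m B / p_r²` with `B` the Wronskian. The ratio is the slope `dL/dK` of the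
threshold curves, and its strict decrease is what separates them. -/
theorem strictAntiOn_flux_ratio (hD : IsDensityPair S m) (hr : 0 < r)
    (h : IncreasingPair S m r ψr pr) (hd : DecreasingPair S m r φr qr) :
    StrictAntiOn (fun x => qr x / pr x) (Ioi 0) :=
  strictAntiOn_of_hasDerivAt_neg
    (f' := fun x => -(r * m x * (φr x * pr x + qr x * ψr x) / pr x ^ 2)) (convex_Ioi 0)
    (fun x hx => ((hd.flux_hasDerivAt x hx).div (h.flux_hasDerivAt x hx)
      (h.flux_pos x hx).ne').congr_deriv (by ring))
    fun x hx => by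
      rw [interior_Ioi] at hx
      have h1 := h.pos x hx
      have h2 := h.flux_pos x hx
      have h5 := hd.pos x hx
      have h6 := hd.flux_pos x hx
      have h7 := hD.speed_pos x hx
      exact neg_neg_of_pos (by positivity)

end Ratios

/-! ### Fluxes at large rates -/

theorem exists_primitive {f : ℝ → ℝ} (hf : ContinuousOn f (Ioi 0)) (hp : ∀ x, 0 < x → 0 < f x) :
    ∃ F : ℝ → ℝ, StrictMonoOn F (Ioi 0) ∧ ∀ x, 0 < x → HasDerivAt F (f x) x := by
  have hF : ∀ x, 0 < x → HasDerivAt (fun u => ∫ z in (1 : ℝ)..u, f z) (f x) x := fun x hx => by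
    refine intervalIntegral.integral_hasDerivAt_right ?_
      (hf.stronglyMeasurableAtFilter isOpen_Ioi x hx) (hf.continuousAt (Ioi_mem_nhds hx))
    exact (hf.mono fun z hz =>
      lt_of_lt_of_le (lt_min zero_lt_one hx) hz.1).intervalIntegrable
  exact ⟨_, strictMonoOn_of_hasDerivAt_pos (convex_Ioi 0) (fun x hx => hF x hx)
    fun x hx => hp x (interior_subset hx), hF⟩

/-- With `y < z < x`, integrating `ψ_s' ≥ S p_s(y)` over `[y, z]` and then `p_s' ≥ s m ψ_s(z)` over
`[z, x]` gives `p_s(x) ≥ s p_s(y) ∫_y^z S ∫_z^x m`, so the ratio is `O(1/s)`. -/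
theorem tendsto_flux_ratio_increasing {S m : ℝ → ℝ} {ψ p : ℝ → ℝ → ℝ} (hD : IsDensityPair S m)
    (h : ∀ s, 0 < s → IncreasingPair S m s (ψ s) (p s)) {x y : ℝ} (hy : 0 < y) (hyx : y < x) :
    Tendsto (fun s => p s y / p s x) atTop (𝓝 0) := by
  obtain ⟨F, hFm, hF⟩ := exists_primitive hD.scale_continuous hD.scale_pos
  obtain ⟨G, hGm, hG⟩ := exists_primitive hD.speed_continuous hD.speed_pos
  obtain ⟨z, hyz, hzx⟩ := exists_between hyx
  have hz := hy.trans hyz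
  have hF0 : 0 < F z - F y := sub_pos.2 (hFm hy hz hyz)
  have hG0 : 0 < G x - G z := sub_pos.2 (hGm hz (hz.trans hzx) hzx)
  have hlim : Tendsto (fun s : ℝ => (s * ((F z - F y) * (G x - G z)))⁻¹) atTop (𝓝 0) :=
    (tendsto_id.atTop_mul_const (mul_pos hF0 hG0)).inv_tendsto_atTop
  refine squeeze_zero' ?_ ?_ hlim
  · filter_upwards [eventually_gt_atTop 0] with s hs
    exact (div_pos ((h s hs).flux_pos y hy) ((h s hs).flux_pos x (hy.trans hyx))).le
  · filter_upwards [eventually_gt_atTop 0] with s hs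
    have hI := h s hs
    have h1 : ψ s y - p s y * F y ≤ ψ s z - p s y * F z := by
      refine monotoneOn_of_hasDerivAt_nonneg (f := fun t => ψ s t - p s y * F t)
        (f' := fun t => S t * (p s t - p s y)) (convex_Icc y z)
        (fun t ht => ((hI.hasDerivAt t (hy.trans_le ht.1)).sub
          ((hF t (hy.trans_le ht.1)).const_mul _)).congr_deriv (by ring)) (fun t ht => ?_)
        (left_mem_Icc.2 hyz.le) (right_mem_Icc.2 hyz.le) hyz.le
      have ht := (interior_subset ht).1
      exact mul_nonneg (hD.scale_pos t (hy.trans_le ht)).le (sub_nonneg.2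
        ((hI.flux_strictMonoOn hD hs).monotoneOn hy (hy.trans_le ht) ht))
    have h2 : p s z - s * ψ s z * G z ≤ p s x - s * ψ s z * G x := by
      refine monotoneOn_of_hasDerivAt_nonneg (f := fun t => p s t - s * ψ s z * G t)
        (f' := fun t => s * m t * (ψ s t - ψ s z)) (convex_Icc z x)
        (fun t ht => ((hI.flux_hasDerivAt t (hz.trans_le ht.1)).sub
          ((hG t (hz.trans_le ht.1)).const_mul _)).congr_deriv (by ring)) (fun t ht => ?_)
        (left_mem_Icc.2 hzx.le) (right_mem_Icc.2 hzx.le) hzx.le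
      have ht := (interior_subset ht).1
      exact mul_nonneg (mul_pos hs (hD.speed_pos t (hz.trans_le ht))).le (sub_nonneg.2
        ((hI.strictMonoOn hD).monotoneOn hz (hz.trans_le ht) ht))
    have h3 := hI.flux_pos y hy
    have h4 := hI.flux_pos z hz
    have h5 := hI.pos y hy
    have h6 : p s y * (F z - F y) ≤ ψ s z := by linarith
    have h7 : s * (p s y * (F z - F y)) * (G x - G z) ≤ s * ψ s z * (G x - G z) := by gcongr
    rw [div_le_iff₀ (hI.flux_pos x (hy.trans hyx)), inv_mul_eq_div, le_div_iff₀ (by positivity)]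
    nlinarith

theorem tendsto_flux_ratio_decreasing {S m : ℝ → ℝ} {φ q : ℝ → ℝ → ℝ} (hD : IsDensityPair S m)
    (h : ∀ s, 0 < s → DecreasingPair S m s (φ s) (q s)) {x y : ℝ} (hx : 0 < x) (hxy : x < y) :
    Tendsto (fun s => q s y / q s x) atTop (𝓝 0) := by
  obtain ⟨F, hFm, hF⟩ := exists_primitive hD.scale_continuous hD.scale_pos
  obtain ⟨G, hGm, hG⟩ := exists_primitive hD.speed_continuous hD.speed_pos
  obtain ⟨z, hxz, hzy⟩ := exists_between hxy
  have hz := hx.trans hxz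
  have hF0 : 0 < F y - F z := sub_pos.2 (hFm hz (hz.trans hzy) hzy)
  have hG0 : 0 < G z - G x := sub_pos.2 (hGm hx hz hxz)
  have hlim : Tendsto (fun s : ℝ => (s * ((F y - F z) * (G z - G x)))⁻¹) atTop (𝓝 0) :=
    (tendsto_id.atTop_mul_const (mul_pos hF0 hG0)).inv_tendsto_atTop
  refine squeeze_zero' ?_ ?_ hlim
  · filter_upwards [eventually_gt_atTop 0] with s hs
    exact (div_pos ((h s hs).flux_pos y (hx.trans hxy)) ((h s hs).flux_pos x hx)).le
  · filter_upwards [eventually_gt_atTop 0] with s hs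
    have hI := h s hs
    have h1 : φ s y + q s y * F y ≤ φ s z + q s y * F z := by
      refine antitoneOn_of_hasDerivAt_nonpos (f := fun t => φ s t + q s y * F t)
        (f' := fun t => -(S t * (q s t - q s y))) (convex_Icc z y)
        (fun t ht => ((hI.hasDerivAt t (hz.trans_le ht.1)).add
          ((hF t (hz.trans_le ht.1)).const_mul _)).congr_deriv (by ring)) (fun t ht => ?_)
        (left_mem_Icc.2 hzy.le) (right_mem_Icc.2 hzy.le) hzy.le
      have ht := interior_subset ht
      have ht0 := hz.trans_le ht.1
      exact neg_nonpos.2 (mul_nonneg (hD.scale_pos t ht0).le (sub_nonneg.2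
        ((hI.flux_strictAntiOn hD hs).antitoneOn ht0 (ht0.trans_le ht.2) ht.2)))
    have h2 : q s z + s * φ s z * G z ≤ q s x + s * φ s z * G x := by
      refine antitoneOn_of_hasDerivAt_nonpos (f := fun t => q s t + s * φ s z * G t)
        (f' := fun t => -(s * m t * (φ s t - φ s z))) (convex_Icc x z)
        (fun t ht => ((hI.flux_hasDerivAt t (hx.trans_le ht.1)).add
          ((hG t (hx.trans_le ht.1)).const_mul _)).congr_deriv (by ring)) (fun t ht => ?_)
        (left_mem_Icc.2 hxz.le) (right_mem_Icc.2 hxz.le) hxz.le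
      have ht := interior_subset ht
      have ht0 := hx.trans_le ht.1
      exact neg_nonpos.2 (mul_nonneg (mul_pos hs (hD.speed_pos t ht0)).le (sub_nonneg.2
        ((hI.strictAntiOn hD).antitoneOn ht0 (ht0.trans_le ht.2) ht.2)))
    have h3 := hI.flux_pos y (hx.trans hxy)
    have h4 := hI.flux_pos z hz
    have h5 := hI.pos y (hx.trans hxy)
    have h6 : q s y * (F y - F z) ≤ φ s z := by linarith
    have h7 : s * (q s y * (F y - F z)) * (G z - G x) ≤ s * φ s z * (G z - G x) := by gcongr
    rw [div_le_iff₀ (hI.flux_pos x hx), inv_mul_eq_div, le_div_iff₀ (by positivity)]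
    nlinarith

/-! ### Two ordered threshold curves -/

section Ordering

variable {h₁ h₂ q₁ q₂ H₁ H₂ Q₁ Q₂ : ℝ → ℝ} {A B : Set ℝ} {α β δ a b c k₁ k₂ : ℝ}

/-- A point above the first and below the second threshold curve lies to the left of the
solutions. -/
theorem lt_solution (hA₂ : StrictAntiOn h₂ A)
    (hB₂ : StrictMonoOn q₂ B)
    (hc : StrictAntiOn (fun x => h₂ x - c * h₁ x) A)
    (qc : StrictAntiOn (fun x => q₂ x - c * q₁ x) B) (hcpos : 0 ≤ c)
    (ha : a ∈ A) (hb : b ∈ B) (e₁ : h₁ a = q₁ b) (e₂ : h₂ a = q₂ b) {x y : ℝ} (hx : x ∈ A)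
    (hy : y ∈ B) (t₁ : h₁ x < q₁ y) (t₂ : q₂ y < h₂ x) : x < a := by
  by_contra! hle
  -- If `a ≤ x`, comparing the values of `h₂ - c h₁` and `q₂ - c q₁` gives `b < y`, and then `q₂ b <
  -- q₂ y < h₂ x ≤ h₂ a = q₂ b` is absurd.
  have i1 : h₂ x - c * h₁ x ≤ h₂ a - c * h₁ a := hc.antitoneOn ha hx hle
  have i2 : q₂ y - c * q₁ y < q₂ b - c * q₁ b := by
    rw [← e₁, ← e₂]
    nlinarith
  have i3 : b < y := (qc.lt_iff_gt hy hb).1 i2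
  have i4 := hB₂ hb hy i3
  have i5 := hA₂.antitoneOn ha hx hle
  linarith

/-- A point below the first and above the second threshold curve lies to the right of the
solutions. -/
theorem solution_lt (hA₂ : StrictAntiOn h₂ A)
    (hB₂ : StrictMonoOn q₂ B)
    (hc : StrictAntiOn (fun x => h₂ x - c * h₁ x) A)
    (qc : StrictAntiOn (fun x => q₂ x - c * q₁ x) B) (hcpos : 0 ≤ c)
    (ha : a ∈ A) (hb : b ∈ B) (e₁ : h₁ a = q₁ b) (e₂ : h₂ a = q₂ b) {x y : ℝ} (hx : x ∈ A)
    (hy : y ∈ B) (t₁ : q₁ y < h₁ x) (t₂ : h₂ x < q₂ y) : a < x := by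
  by_contra! hle
  have i1 : h₂ a - c * h₁ a ≤ h₂ x - c * h₁ x := hc.antitoneOn hx ha hle
  have i2 : q₂ b - c * q₁ b < q₂ y - c * q₁ y := by
    rw [← e₁, ← e₂]
    nlinarith
  have i3 : y < b := (qc.lt_iff_gt hb hy).1 i2
  have i4 := hB₂ hy hb i3
  have i5 := hA₂.antitoneOn hx ha hle
  linarith

/-- At a solution `h₂ - c h₁` and `q₂ - c q₁` agree. Moving `a` to the left raises the first; the
first equation then moves `b` to the right, which lowers the second. So two solutions cannot differ.
-/
theorem solution_unique (hA₁ : StrictAntiOn h₁ A) (hB₁ : StrictMonoOn q₁ B)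
    (hc : StrictAntiOn (fun x => h₂ x - c * h₁ x) A)
    (qc : StrictAntiOn (fun x => q₂ x - c * q₁ x) B)
    (ha : a ∈ A) (hb : b ∈ B) (e₁ : h₁ a = q₁ b) (e₂ : h₂ a = q₂ b) {x y : ℝ} (hx : x ∈ A)
    (hy : y ∈ B) (f₁ : h₁ x = q₁ y) (f₂ : h₂ x = q₂ y) : x = a ∧ y = b := by
  rcases lt_trichotomy x a with h | h | h
  · have i1 := hA₁ hx ha h
    rw [f₁, e₁, hB₁.lt_iff_lt hb hy] at i1
    have i2 := qc hb hy i1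
    have i3 := hc hx ha h
    simp only at i2 i3
    rw [f₁, f₂, e₁, e₂] at i3
    linarith
  · subst h
    exact ⟨rfl, hB₁.injOn hy hb (by rw [← f₁, e₁])⟩
  · have i1 := hA₁ ha hx h
    rw [f₁, e₁, hB₁.lt_iff_lt hy hb] at i1
    have i2 := qc hy hb i1
    have i3 := hc ha hx h
    simp only at i2 i3
    rw [f₁, f₂, e₁, e₂] at i3
    linarith

/-- `t` is the image of `x` under the composed map. For `x < a` the slope conditions give `q₂ y < h₂
x`, hence `t > x`, while `low` keeps `t ≤ δ`. For `x > a` they give `h₂ x < q₂ y < h₂ a`, hence `a <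
t < x`. Either way `x` is not fixed. -/
theorem exists_image_of_ordering (hδ : δ ≤ α) (hA₁ : StrictAntiOn h₁ (Ioc 0 α))
    (hA₂c : ContinuousOn h₂ (Ioc 0 α))
    (hB₁ : StrictMonoOn q₁ (Ici β)) (hB₂ : StrictMonoOn q₂ (Ici β))
    (hc : StrictAntiOn (fun x => h₂ x - c * h₁ x) (Ioc 0 α))
    (qc : StrictAntiOn (fun x => q₂ x - c * q₁ x) (Ici β))
    (ha : a ∈ Ioc 0 δ) (hb : b ∈ Ici β) (e₁ : h₁ a = q₁ b) (e₂ : h₂ a = q₂ b) {x y : ℝ}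
    (hx : x ∈ Ioc 0 δ) (hy : y ∈ Ici β) (f₁ : q₁ y = h₁ x) (low : h₂ δ ≤ q₂ y) :
    ∃ t ∈ Ioc 0 δ, h₂ t = q₂ y ∧ (t = x → x = a) ∧ (x = a → t = a) := by
  have hsub : Ioc 0 δ ⊆ Ioc 0 α := Ioc_subset_Ioc_right hδ
  rcases lt_trichotomy x a with h | h | h
  · have i1 := hA₁ (hsub hx) (hsub ha) h
    rw [← f₁, e₁, hB₁.lt_iff_lt hb hy] at i1
    have i2 := qc hb hy i1
    have i3 := hc (hsub hx) (hsub ha) h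
    simp only at i2 i3
    rw [← f₁, e₁, e₂] at i3
    obtain ⟨t, ht, hte⟩ := intermediate_value_Icc' hx.2
      (hA₂c.mono fun z hz => hsub ⟨hx.1.trans_le hz.1, hz.2⟩) ⟨low, by linarith⟩
    refine ⟨t, ⟨hx.1.trans_le ht.1, ht.2⟩, hte, ?_, fun h' => absurd h' h.ne⟩
    rintro rfl
    linarith
  · subst h
    refine ⟨x, hx, ?_, fun _ => rfl, fun _ => rfl⟩
    rw [e₂, hB₁.injOn hy hb (by rw [f₁, e₁])]
  · have i1 := hA₁ (hsub ha) (hsub hx) h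
    rw [← f₁, e₁, hB₁.lt_iff_lt hy hb] at i1
    have i2 := qc hy hb i1
    have i3 := hc (hsub ha) (hsub hx) h
    simp only at i2 i3
    rw [← f₁, e₁, e₂] at i3
    have i4 := hB₂ hy hb i1
    obtain ⟨t, ht, hte⟩ := intermediate_value_Icc' h.le
      (hA₂c.mono fun z hz => hsub ⟨ha.1.trans_le hz.1, hz.2.trans hx.2⟩)
      (show q₂ y ∈ Icc (h₂ x) (h₂ a) from ⟨by linarith, by linarith⟩)
    refine ⟨t, ⟨ha.1.trans_le ht.1, ht.2.trans hx.2⟩, hte, ?_, fun h' => absurd h' h.ne'⟩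
    rintro rfl
    linarith

/-- Uniqueness of the solution of a pair of threshold equations, and the fixed-point
characterization of its first component. -/
theorem uniqueSolution_and_fixedPoint (hδ : δ ≤ α) (hA₁ : StrictAntiOn h₁ (Ioc 0 α))
    (hA₂ : StrictAntiOn h₂ (Ioc 0 α)) (hA₂c : ContinuousOn h₂ (Ioc 0 α))
    (hB₁ : StrictMonoOn q₁ (Ici β)) (hB₂ : StrictMonoOn q₂ (Ici β))
    (hc : StrictAntiOn (fun x => h₂ x - c * h₁ x) (Ioc 0 α))
    (qc : StrictAntiOn (fun x => q₂ x - c * q₁ x) (Ici β))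
    (cover : ∀ x ∈ Ioc 0 δ, ∃ y ∈ Ici β, q₁ y = h₁ x)
    (low : ∀ x ∈ Ioc 0 δ, ∀ y ∈ Ici β, q₁ y = h₁ x → h₂ δ ≤ q₂ y)
    (ha : a ∈ Ioc 0 δ) (hb : b ∈ Ici β) (e₁ : h₁ a = q₁ b) (e₂ : h₂ a = q₂ b)
    (hk₁ : k₁ ≠ 0) (hk₂ : k₂ ≠ 0) (hH₁ : ∀ x ∈ Ioc 0 α, h₁ x = k₁ * H₁ x)
    (hH₂ : ∀ x ∈ Ioc 0 α, h₂ x = k₂ * H₂ x) (hQ₁ : ∀ x ∈ Ici β, q₁ x = k₁ * Q₁ x)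
    (hQ₂ : ∀ x ∈ Ici β, q₂ x = k₂ * Q₂ x) :
    IsUniqueSolution H₁ H₂ Q₁ Q₂ (Ioc 0 α) (Ici β) a b ∧
      CompInvWellDefined H₁ H₂ Q₁ Q₂ (Ioc 0 α) (Ici β) (Ioc 0 δ) ∧
      IsSelfMapWithUniqueFixedPoint (compInv H₁ H₂ Q₁ Q₂ (Ioc 0 α) (Ici β)) (Ioc 0 δ) a := by
  have hsub : Ioc 0 δ ⊆ Ioc 0 α := Ioc_subset_Ioc_right hδ
  -- Only the equations matter, so common nonzero factors are harmless: they are `1` for the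
  -- singular problem and `-λ`, `λ` for the Poisson problem.
  have iff₁ : ∀ x ∈ Ioc 0 α, ∀ y ∈ Ici β, (h₁ x = q₁ y ↔ H₁ x = Q₁ y) := fun x hx y hy => by
    rw [hH₁ x hx, hQ₁ y hy, mul_right_inj' hk₁]
  have iff₂ : ∀ x ∈ Ioc 0 α, ∀ y ∈ Ici β, (h₂ x = q₂ y ↔ H₂ x = Q₂ y) := fun x hx y hy => by
    rw [hH₂ x hx, hQ₂ y hy, mul_right_inj' hk₂]
  have inj₂ : InjOn H₂ (Ioc 0 α) := fun x hx y hy hxy =>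
    hA₂.injOn hx hy (by rw [hH₂ x hx, hH₂ y hy, hxy])
  have inj₁ : InjOn Q₁ (Ici β) := fun x hx y hy hxy =>
    hB₁.injOn hx hy (by rw [hQ₁ x hx, hQ₁ y hy, hxy])
  have key : ∀ x ∈ Ioc 0 δ, ∃ y ∈ Ici β, Q₁ y = H₁ x ∧
      Function.invFunOn Q₁ (Ici β) (H₁ x) = y ∧
      ∃ t ∈ Ioc 0 δ, H₂ t = Q₂ y ∧ (t = x → x = a) ∧ (x = a → t = a) := by
    intro x hx
    obtain ⟨y, hy, hyx⟩ := cover x hx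
    obtain ⟨t, ht, hte, ht1, ht2⟩ := exists_image_of_ordering hδ hA₁ hA₂c hB₁ hB₂ hc qc ha hb
      e₁ e₂ hx hy hyx (low x hx y hy hyx)
    have hQ : Q₁ y = H₁ x := ((iff₁ x (hsub hx) y hy).1 hyx.symm).symm
    refine ⟨y, hy, hQ, ?_, t, ht, (iff₂ t (hsub ht) y hy).1 hte, ht1, ht2⟩
    rw [← hQ]
    exact inj₁.leftInvOn_invFunOn hy
  have comp : ∀ x ∈ Ioc 0 δ, ∃ t ∈ Ioc 0 δ, compInv H₁ H₂ Q₁ Q₂ (Ioc 0 α) (Ici β) x = t ∧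
      (t = x → x = a) ∧ (x = a → t = a) := by
    intro x hx
    obtain ⟨y, hy, hQ, hinv, t, ht, hte, ht1, ht2⟩ := key x hx
    refine ⟨t, ht, ?_, ht1, ht2⟩
    rw [compInv, hinv, ← hte]
    exact inj₂.leftInvOn_invFunOn (hsub ht)
  refine ⟨⟨hsub ha, hb, (iff₁ a (hsub ha) b hb).1 e₁, (iff₂ a (hsub ha) b hb).1 e₂,
    fun x hx y hy f₁ f₂ => solution_unique hA₁ hB₁ hc qc (hsub ha) hb e₁ e₂ hx hy
      ((iff₁ x hx y hy).2 f₁) ((iff₂ x hx y hy).2 f₂)⟩, ⟨inj₂, inj₁, ?_, ?_⟩, ?_, ha, ?_, ?_⟩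
  · intro x hx
    obtain ⟨y, hy, hQ, _⟩ := key x hx
    exact ⟨y, hy, hQ⟩
  · intro x hx
    obtain ⟨y, hy, hQ, hinv, t, ht, hte, _⟩ := key x hx
    exact ⟨t, hsub ht, by simp only [hinv, hte]⟩
  · intro x hx
    obtain ⟨t, ht, hte, _⟩ := comp x hx
    rwa [hte]
  · obtain ⟨t, ht, hte, _, h2⟩ := comp a ha
    rw [hte, h2 rfl]
  · intro x hx hfix
    obtain ⟨t, ht, hte, h1, _⟩ := comp x hx
    exact h1 (hte.symm.trans hfix)

/-- Along the solutions of `q₁ y = h₁ x` the sign of `h₂ x - q₂ y` changes between `x = δ` and `x =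
α`. Continuity of `x ↦ y` is not needed: the two sets of `x` on which the sign is `≥ 0` and `≤ 0`
are projections of compact sets, hence closed, and they cover a connected interval. -/
theorem exists_solution (hδ : δ ≤ α) (hA₁ : StrictAntiOn h₁ (Icc δ α))
    (hA₁c : ContinuousOn h₁ (Icc δ α)) (hA₂c : ContinuousOn h₂ (Icc δ α))
    (hB₁ : StrictMonoOn q₁ (Ici β)) (hB₁c : ContinuousOn q₁ (Ici β))
    (hB₂c : ContinuousOn q₂ (Ici β))
    (cover : ∀ x ∈ Icc δ α, ∃ y ∈ Ici β, q₁ y = h₁ x)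
    (left : ∀ y ∈ Ici β, q₁ y = h₁ δ → q₂ y ≤ h₂ δ)
    (right : ∀ y ∈ Ici β, q₁ y = h₁ α → h₂ α ≤ q₂ y) :
    ∃ a ∈ Icc δ α, ∃ b ∈ Ici β, h₁ a = q₁ b ∧ h₂ a = q₂ b := by
  obtain ⟨y₀, hy₀, hq₀⟩ := cover δ (left_mem_Icc.2 hδ)
  -- As `h₁` decreases and `q₁` increases, the partner `y₀` of the left endpoint bounds all
  -- partners, so the graph lies in this box.
  set K : Set (ℝ × ℝ) := Icc δ α ×ˢ Icc β y₀
  have hK : IsCompact K := isCompact_Icc.prod isCompact_Icc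
  have f1 : ContinuousOn (fun z : ℝ × ℝ => h₁ z.1) K :=
    hA₁c.comp continuousOn_fst fun z hz => hz.1
  have f2 : ContinuousOn (fun z : ℝ × ℝ => h₂ z.1) K :=
    hA₂c.comp continuousOn_fst fun z hz => hz.1
  have g1 : ContinuousOn (fun z : ℝ × ℝ => q₁ z.2) K :=
    hB₁c.comp continuousOn_snd fun z hz => hz.2.1
  have g2 : ContinuousOn (fun z : ℝ × ℝ => q₂ z.2) K :=
    hB₂c.comp continuousOn_snd fun z hz => hz.2.1
  have hE : IsClosed {z ∈ {z ∈ K | h₁ z.1 ≤ q₁ z.2} | q₁ z.2 ≤ h₁ z.1} :=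
    (hK.isClosed.isClosed_le f1 g1).isClosed_le (g1.mono (sep_subset _ _))
      (f1.mono (sep_subset _ _))
  set E : Set (ℝ × ℝ) := {z ∈ {z ∈ K | h₁ z.1 ≤ q₁ z.2} | q₁ z.2 ≤ h₁ z.1}
  have hEK : E ⊆ K := fun z hz => hz.1.1
  have hT₁ : IsCompact (Prod.fst '' {z ∈ E | q₂ z.2 ≤ h₂ z.1}) :=
    (hK.of_isClosed_subset (hE.isClosed_le (g2.mono hEK) (f2.mono hEK))
      ((sep_subset _ _).trans hEK)).image continuous_fst
  have hT₂ : IsCompact (Prod.fst '' {z ∈ E | h₂ z.1 ≤ q₂ z.2}) :=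
    (hK.of_isClosed_subset (hE.isClosed_le (f2.mono hEK) (g2.mono hEK))
      ((sep_subset _ _).trans hEK)).image continuous_fst
  have mem : ∀ x ∈ Icc δ α, ∃ y, (x, y) ∈ E := fun x hx => by
    obtain ⟨y, hy, hyx⟩ := cover x hx
    refine ⟨y, ⟨⟨⟨hx, hy, ?_⟩, hyx.ge⟩, hyx.le⟩⟩
    rw [← hB₁.le_iff_le hy hy₀, hyx, hq₀]
    exact hA₁.antitoneOn (left_mem_Icc.2 hδ) hx hx.1
  have hconn := isPreconnected_closed_iff.1 (isPreconnected_Icc (a := δ) (b := α)) _ _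
    hT₁.isClosed hT₂.isClosed (fun x hx => ?_) ?_ ?_
  · obtain ⟨x, hx, ⟨z, ⟨hz, hz2⟩, rfl⟩, ⟨w, ⟨hw, hw2⟩, hwz⟩⟩ := hconn
    have e1 : q₁ z.2 = h₁ z.1 := le_antisymm hz.2 hz.1.2
    have e2 : q₁ w.2 = h₁ w.1 := le_antisymm hw.2 hw.1.2
    have e3 : w.2 = z.2 := hB₁.injOn (hEK hw).2.1 (hEK hz).2.1 (by rw [e1, e2, hwz])
    rw [hwz, e3] at hw2
    exact ⟨z.1, hx, z.2, (hEK hz).2.1, e1.symm, le_antisymm hw2 hz2⟩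
  · obtain ⟨y, hy⟩ := mem x hx
    rcases le_total (q₂ y) (h₂ x) with h | h
    · exact Or.inl ⟨(x, y), ⟨hy, h⟩, rfl⟩
    · exact Or.inr ⟨(x, y), ⟨hy, h⟩, rfl⟩
  · obtain ⟨y, hy⟩ := mem δ (left_mem_Icc.2 hδ)
    exact ⟨δ, left_mem_Icc.2 hδ, (δ, y),
      ⟨hy, left y (hEK hy).2.1 (le_antisymm hy.2 hy.1.2)⟩, rfl⟩
  · obtain ⟨y, hy⟩ := mem α (right_mem_Icc.2 hδ)
    exact ⟨α, right_mem_Icc.2 hδ, (α, y),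
      ⟨hy, right y (hEK hy).2.1 (le_antisymm hy.2 hy.1.2)⟩, rfl⟩

end Ordering

/-! ### The functionals `K` and `L` of a single-peaked function -/

/-- `K_f` in terms of the flux `p = ψ' / S'`. -/
def kFun (m ψ p : ℝ → ℝ) (s : ℝ) (f : ℝ → ℝ) (x : ℝ) : ℝ :=
  s * (∫ y in Ioc 0 x, f y * ψ y * m y) - p x * f x

/-- `L_f` in terms of the flux `q = -φ' / S'`. -/
def lFun (m φ q : ℝ → ℝ) (s : ℝ) (f : ℝ → ℝ) (x : ℝ) : ℝ :=
  s * (∫ y in Ioi x, f y * φ y * m y) - q x * f x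

section Functionals

variable {S m ψr pr ψs ps φr qr φs qs θ : ℝ → ℝ} {r s l x₀ : ℝ}

theorem IncreasingPair.continuousOn (h : IncreasingPair S m s ψs ps) : ContinuousOn ψs (Ioi 0) :=
  fun x hx => (h.hasDerivAt x hx).continuousAt.continuousWithinAt

theorem DecreasingPair.continuousOn (h : DecreasingPair S m s φs qs) : ContinuousOn φs (Ioi 0) :=
  fun x hx => (h.hasDerivAt x hx).continuousAt.continuousWithinAt

theorem IncreasingPair.integrableOn_Ioc (hD : IsDensityPair S m) (hs : 0 < s)
    (h : IncreasingPair S m s ψs ps) (x : ℝ) :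
    IntegrableOn (fun y => s * m y * ψs y) (Ioc 0 x) :=
  integrableOn_Ioc_zero_of_deriv_nonneg (fun y hy => h.flux_hasDerivAt y hy.1)
    (fun y hy => (mul_pos (mul_pos hs (hD.speed_pos y hy.1)) (h.pos y hy.1)).le)
    fun y hy => (h.flux_pos y hy.1).le

theorem IncreasingPair.integral_Ioc (hD : IsDensityPair S m) (hs : 0 < s)
    (h : IncreasingPair S m s ψs ps) {x : ℝ} (hx : 0 < x) :
    ∫ y in Ioc 0 x, s * m y * ψs y = ps x :=
  integral_Ioc_zero_of_hasDerivAt hx (fun y hy => h.flux_hasDerivAt y hy.1) h.flux_tendsto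
    (h.integrableOn_Ioc hD hs x)

theorem DecreasingPair.integrableOn_Ioi (hD : IsDensityPair S m) (hs : 0 < s)
    (h : DecreasingPair S m s φs qs) {x : ℝ} (hx : 0 < x) :
    IntegrableOn (fun y => s * m y * φs y) (Ioi x) := by
  have := integrableOn_Ioi_of_deriv_nonpos (fun y hy => h.flux_hasDerivAt y (hx.trans_le hy))
    (fun y hy => neg_nonpos.2
      (mul_pos (mul_pos hs (hD.speed_pos y (hx.trans_le hy))) (h.pos y (hx.trans_le hy))).le)
    fun y hy => (h.flux_pos y (hx.trans_le hy)).le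
  simpa using this.neg

theorem DecreasingPair.integral_Ioi (hD : IsDensityPair S m) (hs : 0 < s)
    (h : DecreasingPair S m s φs qs) {x : ℝ} (hx : 0 < x) :
    ∫ y in Ioi x, s * m y * φs y = qs x := by
  have := integral_Ioi_of_hasDerivAt (fun y hy => h.flux_hasDerivAt y (hx.trans_le hy))
    h.flux_tendsto (h.integrableOn_Ioi hD hs hx).neg
  rw [integral_neg] at this
  linarith

/-- Integrability at a rate implies integrability at every larger rate. -/
theorem integrableOn_Ioc_of_lt (hD : IsDensityPair S m) (hrs : r < s)
    (h : IncreasingPair S m r ψr pr) (h' : IncreasingPair S m s ψs ps) {f : ℝ → ℝ}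
    (hf : ContinuousOn f (Ioi 0))
    (hi : ∀ x, 0 < x → IntegrableOn (fun y => f y * ψr y * m y) (Ioc 0 x)) {x : ℝ} (hx : 0 < x) :
    IntegrableOn (fun y => f y * ψs y * m y) (Ioc 0 x) := by
  -- `ψ_s / ψ_r` is increasing, so on `(0, x]` it is at most its value at `x`.
  refine Integrable.mono' (((hi x hx).norm).const_mul (ψs x / ψr x)) ?_ ?_
  · exact (((hf.mul h'.continuousOn).mul hD.speed_continuous).mono
      fun y hy => hy.1).aestronglyMeasurable measurableSet_Ioc
  · refine (ae_restrict_iff' measurableSet_Ioc).2 (Eventually.of_forall fun y hy => ?_)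
    have h1 := h.ratio_monotoneOn hD hrs h' hy.1 hx hy.2
    simp only at h1
    rw [div_le_iff₀ (h.pos y hy.1)] at h1
    rw [Real.norm_eq_abs, Real.norm_eq_abs, abs_mul, abs_mul, abs_mul, abs_mul,
      abs_of_pos (h.pos y hy.1), abs_of_pos (h'.pos y hy.1), abs_of_pos (hD.speed_pos y hy.1)]
    have h2 := mul_le_mul_of_nonneg_left h1
      (mul_nonneg (abs_nonneg (f y)) (hD.speed_pos y hy.1).le)
    linarith

theorem integrableOn_Ioi_of_lt (hD : IsDensityPair S m) (hrs : r < s)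
    (h : DecreasingPair S m r φr qr) (h' : DecreasingPair S m s φs qs) {f : ℝ → ℝ}
    (hf : ContinuousOn f (Ioi 0))
    (hi : ∀ x, 0 < x → IntegrableOn (fun y => f y * φr y * m y) (Ioi x)) {x : ℝ} (hx : 0 < x) :
    IntegrableOn (fun y => f y * φs y * m y) (Ioi x) := by
  refine Integrable.mono' (((hi x hx).norm).const_mul (φs x / φr x)) ?_ ?_
  · exact (((hf.mul h'.continuousOn).mul hD.speed_continuous).mono
      fun y hy => hx.trans hy).aestronglyMeasurable measurableSet_Ioi
  · refine (ae_restrict_iff' measurableSet_Ioi).2 (Eventually.of_forall fun y hy => ?_)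
    have hy0 : 0 < y := hx.trans hy
    have h1 := h.ratio_antitoneOn hD hrs h' hx hy0 (le_of_lt hy)
    simp only at h1
    rw [div_le_iff₀ (h.pos y hy0)] at h1
    rw [Real.norm_eq_abs, Real.norm_eq_abs, abs_mul, abs_mul, abs_mul, abs_mul,
      abs_of_pos (h.pos y hy0), abs_of_pos (h'.pos y hy0), abs_of_pos (hD.speed_pos y hy0)]
    have h2 := mul_le_mul_of_nonneg_left h1
      (mul_nonneg (abs_nonneg (f y)) (hD.speed_pos y hy0).le)
    linarith

/-- The flux equation `p' = s m ψ` cancels the integrand, leaving only `-p θ'`. All sign and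
monotonicity statements about `K` rest on this. -/
theorem kFun_hasDerivAt (hD : IsDensityPair S m) (h : IncreasingPair S m s ψs ps)
    (hd : DifferentiableOn ℝ θ (Ioi 0))
    (hi : ∀ x, 0 < x → IntegrableOn (fun y => θ y * ψs y * m y) (Ioc 0 x)) {x : ℝ} (hx : 0 < x) :
    HasDerivAt (kFun m ψs ps s θ) (-(ps x * deriv θ x)) x := by
  have h1 := hasDerivAt_integral_Ioc (F := fun y => θ y * ψs y * m y)
    ((hd.continuousOn.mul h.continuousOn).mul hD.speed_continuous) hi hx
  exact ((h1.const_mul s).sub ((h.flux_hasDerivAt x hx).mul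
    ((hd x hx).differentiableAt (Ioi_mem_nhds hx)).hasDerivAt)).congr_deriv (by ring)

theorem lFun_hasDerivAt (hD : IsDensityPair S m) (h : DecreasingPair S m s φs qs)
    (hd : DifferentiableOn ℝ θ (Ioi 0))
    (hi : ∀ x, 0 < x → IntegrableOn (fun y => θ y * φs y * m y) (Ioi x)) {x : ℝ} (hx : 0 < x) :
    HasDerivAt (lFun m φs qs s θ) (-(qs x * deriv θ x)) x := by
  have h1 := hasDerivAt_integral_Ioi (F := fun y => θ y * φs y * m y)
    ((hd.continuousOn.mul h.continuousOn).mul hD.speed_continuous) hi hx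
  exact ((h1.const_mul s).sub ((h.flux_hasDerivAt x hx).mul
    ((hd x hx).differentiableAt (Ioi_mem_nhds hx)).hasDerivAt)).congr_deriv (by ring)

theorem kFun_tendsto (h : IncreasingPair S m s ψs ps)
    (hi : ∀ x, 0 < x → IntegrableOn (fun y => θ y * ψs y * m y) (Ioc 0 x))
    (hl : Tendsto θ (𝓝[>] 0) (𝓝 l)) : Tendsto (kFun m ψs ps s θ) (𝓝[>] 0) (𝓝 0) := by
  have := ((tendsto_integral_Ioc (hi 1 one_pos)).const_mul s).sub (h.flux_tendsto.mul hl)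
  rw [mul_zero, zero_mul, sub_zero] at this
  exact this

theorem IsPeak.strictAntiOn (hθ : IsPeak θ x₀) (h0 : 0 < x₀) : StrictAntiOn θ (Ici x₀) :=
  strictAntiOn_of_hasDerivAt_neg (convex_Ici x₀)
    (fun x hx => (((hθ.differentiable x (h0.trans_le hx)).differentiableAt
      (Ioi_mem_nhds (h0.trans_le hx))).hasDerivAt)) fun x hx => by
      rw [interior_Ici] at hx
      exact hθ.deriv_neg x (h0.trans hx) hx

theorem IsPeak.strictMonoOn (hθ : IsPeak θ x₀) : StrictMonoOn θ (Ioc 0 x₀) :=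
  strictMonoOn_of_hasDerivAt_pos (convex_Ioc 0 x₀)
    (fun x hx => (((hθ.differentiable x hx.1).differentiableAt
      (Ioi_mem_nhds hx.1)).hasDerivAt)) fun x hx => by
      rw [interior_Ioc] at hx
      exact hθ.deriv_pos x hx.1 hx.2

/-- No growth bound on `q θ` is assumed. Beyond the peak `θ ≤ θ(x)` on `(x, ∞)`, and `s ∫_x^∞ φ m =
q(x)`, so `L ≤ 0`; once `θ ≤ 0`, also `L ≥ s ∫_x^∞ θ φ m`, which tends to `0`. -/
theorem lFun_tendsto (hD : IsDensityPair S m) (hs : 0 < s) (h : DecreasingPair S m s φs qs)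
    (hi : ∀ x, 0 < x → IntegrableOn (fun y => θ y * φs y * m y) (Ioi x))
    (hθ : IsPeak θ x₀) (h0 : 0 < x₀) (hlim : Tendsto θ atTop atBot) :
    Tendsto (lFun m φs qs s θ) atTop (𝓝 0) := by
  have h1 : Tendsto (fun x => s * ∫ y in Ioi x, θ y * φs y * m y) atTop (𝓝 0) := by
    simpa using (tendsto_integral_Ioi_zero (f := fun y => θ y * φs y * m y) (μ := volume)
      tendsto_id).const_mul s
  refine tendsto_of_tendsto_of_tendsto_of_le_of_le' h1 tendsto_const_nhds ?_ ?_
  · filter_upwards [hlim.eventually (eventually_le_atBot 0), eventually_gt_atTop 0] with x hx hx0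
    rw [lFun]
    nlinarith [h.flux_pos x hx0]
  · filter_upwards [eventually_ge_atTop x₀] with x hx
    have hx0 : 0 < x := h0.trans_le hx
    have h2 : ∫ y in Ioi x, θ y * φs y * m y ≤ ∫ y in Ioi x, θ x / s * (s * m y * φs y) := by
      refine setIntegral_mono_on (hi x hx0) ((h.integrableOn_Ioi hD hs hx0).const_mul _)
        measurableSet_Ioi fun y hy => ?_
      have h3 : θ y ≤ θ x := (hθ.strictAntiOn h0).antitoneOn hx (hx.trans (le_of_lt hy))
        (le_of_lt hy)
      have h4 := mul_le_mul_of_nonneg_right h3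
        (mul_pos (h.pos y (hx0.trans hy)) (hD.speed_pos y (hx0.trans hy))).le
      calc θ y * φs y * m y = θ y * (φs y * m y) := by ring
        _ ≤ θ x * (φs y * m y) := h4
        _ = _ := by field_simp
    rw [integral_const_mul, h.integral_Ioi hD hs hx0] at h2
    have h5 := mul_le_mul_of_nonneg_left h2 hs.le
    rw [lFun]
    have h6 : s * (θ x / s * qs x) = θ x * qs x := by field_simp
    linarith

theorem kFun_strictAntiOn (hD : IsDensityPair S m) (h : IncreasingPair S m s ψs ps)
    (hi : ∀ x, 0 < x → IntegrableOn (fun y => θ y * ψs y * m y) (Ioc 0 x))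
    (hθ : IsPeak θ x₀) : StrictAntiOn (kFun m ψs ps s θ) (Ioc 0 x₀) :=
  strictAntiOn_of_hasDerivAt_neg (convex_Ioc 0 x₀)
    (fun x hx => kFun_hasDerivAt hD h hθ.differentiable hi hx.1) fun x hx => by
      rw [interior_Ioc] at hx
      exact neg_neg_of_pos (mul_pos (h.flux_pos x hx.1) (hθ.deriv_pos x hx.1 hx.2))

theorem kFun_strictMonoOn (hD : IsDensityPair S m) (h : IncreasingPair S m s ψs ps)
    (hi : ∀ x, 0 < x → IntegrableOn (fun y => θ y * ψs y * m y) (Ioc 0 x))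
    (hθ : IsPeak θ x₀) (h0 : 0 < x₀) : StrictMonoOn (kFun m ψs ps s θ) (Ici x₀) :=
  strictMonoOn_of_hasDerivAt_pos (convex_Ici x₀)
    (fun x hx => kFun_hasDerivAt hD h hθ.differentiable hi (h0.trans_le hx)) fun x hx => by
      rw [interior_Ici] at hx
      exact neg_pos.2 (mul_neg_of_pos_of_neg (h.flux_pos x (h0.trans hx))
        (hθ.deriv_neg x (h0.trans hx) hx))

theorem lFun_strictAntiOn (hD : IsDensityPair S m) (h : DecreasingPair S m s φs qs)
    (hi : ∀ x, 0 < x → IntegrableOn (fun y => θ y * φs y * m y) (Ioi x))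
    (hθ : IsPeak θ x₀) : StrictAntiOn (lFun m φs qs s θ) (Ioc 0 x₀) :=
  strictAntiOn_of_hasDerivAt_neg (convex_Ioc 0 x₀)
    (fun x hx => lFun_hasDerivAt hD h hθ.differentiable hi hx.1) fun x hx => by
      rw [interior_Ioc] at hx
      exact neg_neg_of_pos (mul_pos (h.flux_pos x hx.1) (hθ.deriv_pos x hx.1 hx.2))

theorem lFun_strictMonoOn (hD : IsDensityPair S m) (h : DecreasingPair S m s φs qs)
    (hi : ∀ x, 0 < x → IntegrableOn (fun y => θ y * φs y * m y) (Ioi x))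
    (hθ : IsPeak θ x₀) (h0 : 0 < x₀) : StrictMonoOn (lFun m φs qs s θ) (Ici x₀) :=
  strictMonoOn_of_hasDerivAt_pos (convex_Ici x₀)
    (fun x hx => lFun_hasDerivAt hD h hθ.differentiable hi (h0.trans_le hx)) fun x hx => by
      rw [interior_Ici] at hx
      exact neg_pos.2 (mul_neg_of_pos_of_neg (h.flux_pos x (h0.trans hx))
        (hθ.deriv_neg x (h0.trans hx) hx))

theorem kFun_neg (hD : IsDensityPair S m) (h : IncreasingPair S m s ψs ps)
    (hi : ∀ x, 0 < x → IntegrableOn (fun y => θ y * ψs y * m y) (Ioc 0 x))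
    (hl : Tendsto θ (𝓝[>] 0) (𝓝 l)) (hθ : IsPeak θ x₀) {x : ℝ} (hx : x ∈ Ioc 0 x₀) :
    kFun m ψs ps s θ x < 0 := by
  have := pos_of_strictMonoOn_of_tendsto (f := fun x => -kFun m ψs ps s θ x) hx.1
    (((kFun_strictAntiOn hD h hi hθ).mono (Ioc_subset_Ioc_right hx.2)).neg)
    (by simpa using (kFun_tendsto h hi hl).neg)
  linarith

theorem lFun_neg (hD : IsDensityPair S m) (hs : 0 < s) (h : DecreasingPair S m s φs qs)
    (hi : ∀ x, 0 < x → IntegrableOn (fun y => θ y * φs y * m y) (Ioi x))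
    (hθ : IsPeak θ x₀) (h0 : 0 < x₀) (hlim : Tendsto θ atTop atBot) {x : ℝ} (hx : x₀ ≤ x) :
    lFun m φs qs s θ x < 0 := by
  have := pos_of_strictAntiOn_of_tendsto (f := fun x => -lFun m φs qs s θ x)
    (((lFun_strictMonoOn hD h hi hθ h0).mono (Ici_subset_Ici.2 hx)).neg)
    (by simpa using (lFun_tendsto hD hs h hi hθ h0 hlim).neg)
  linarith

/-- `K_θ` is eventually positive when `θ` tends to `-∞`. -/
theorem eventually_kFun_pos (hD : IsDensityPair S m) (hs : 0 < s) (h : IncreasingPair S m s ψs ps)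
    (hi : ∀ x, 0 < x → IntegrableOn (fun y => θ y * ψs y * m y) (Ioc 0 x))
    (hl : Tendsto θ (𝓝[>] 0) (𝓝 l)) (hθ : IsPeak θ x₀) (h0 : 0 < x₀)
    (hlim : Tendsto θ atTop atBot) : ∀ᶠ x in atTop, 0 < kFun m ψs ps s θ x := by
  -- Beyond the peak with `θ(X) ≤ θ(0+)`, the value `θ(X)` is the minimum of `θ` on `(0, X]`, so `s
  -- ∫_0^X θ ψ m ≥ θ(X) p(X)`, that is `K(X) ≥ 0`; after that `K` increases strictly.
  obtain ⟨X, hX⟩ := ((hlim.eventually (eventually_le_atBot l)).and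
    (eventually_ge_atTop x₀)).exists
  have hX0 : 0 < X := h0.trans_le hX.2
  have hle : ∀ y ∈ Ioc 0 X, θ X ≤ θ y := by
    intro y hy
    rcases le_total y x₀ with hyx | hyx
    · refine hX.1.trans (le_of_tendsto hl ?_)
      filter_upwards [Ioo_mem_nhdsGT hy.1] with z hz
      exact hθ.strictMonoOn.monotoneOn ⟨hz.1, hz.2.le.trans hyx⟩ ⟨hy.1, hyx⟩ hz.2.le
    · exact (hθ.strictAntiOn h0).antitoneOn hyx hX.2 hy.2
  have h1 : 0 ≤ kFun m ψs ps s θ X := by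
    have h2 : ∫ y in Ioc 0 X, θ X / s * (s * m y * ψs y) ≤ ∫ y in Ioc 0 X, θ y * ψs y * m y := by
      refine setIntegral_mono_on ((h.integrableOn_Ioc hD hs X).const_mul _) (hi X hX0)
        measurableSet_Ioc fun y hy => ?_
      have h4 := mul_le_mul_of_nonneg_right (hle y hy)
        (mul_pos (h.pos y hy.1) (hD.speed_pos y hy.1)).le
      calc θ X / s * (s * m y * ψs y) = θ X * (ψs y * m y) := by field_simp
        _ ≤ θ y * (ψs y * m y) := h4
        _ = _ := by ring
    rw [integral_const_mul, h.integral_Ioc hD hs hX0] at h2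
    have h5 := mul_le_mul_of_nonneg_left h2 hs.le
    rw [kFun]
    have h6 : s * (θ X / s * ps X) = θ X * ps X := by field_simp
    linarith
  filter_upwards [eventually_gt_atTop X] with x hx
  exact h1.trans_lt (kFun_strictMonoOn hD h hi hθ h0 hX.2 (hX.2.trans hx.le) hx)

/-! ### Comparison of two payoffs -/

theorem kFun_lt_kFun (hD : IsDensityPair S m) (h : IncreasingPair S m s ψs ps)
    {θ₁ θ₂ : ℝ → ℝ} (hd₁ : DifferentiableOn ℝ θ₁ (Ioi 0)) (hd₂ : DifferentiableOn ℝ θ₂ (Ioi 0))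
    (hi₁ : ∀ x, 0 < x → IntegrableOn (fun y => θ₁ y * ψs y * m y) (Ioc 0 x))
    (hi₂ : ∀ x, 0 < x → IntegrableOn (fun y => θ₂ y * ψs y * m y) (Ioc 0 x))
    {l₁ l₂ : ℝ} (hl₁ : Tendsto θ₁ (𝓝[>] 0) (𝓝 l₁)) (hl₂ : Tendsto θ₂ (𝓝[>] 0) (𝓝 l₂))
    (hlt : ∀ x, 0 < x → deriv θ₁ x < deriv θ₂ x) {x : ℝ} (hx : 0 < x) :
    kFun m ψs ps s θ₂ x < kFun m ψs ps s θ₁ x := by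
  rw [← sub_pos]
  refine pos_of_strictMonoOn_of_tendsto
    (f := fun x => kFun m ψs ps s θ₁ x - kFun m ψs ps s θ₂ x) hx
    (strictMonoOn_of_hasDerivAt_pos (convex_Ioc 0 x)
      (fun y hy => (kFun_hasDerivAt hD h hd₁ hi₁ hy.1).sub (kFun_hasDerivAt hD h hd₂ hi₂ hy.1))
      fun y hy => ?_) ?_
  · have hy := (interior_subset hy).1
    nlinarith [h.flux_pos y hy, hlt y hy]
  · simpa using (kFun_tendsto h hi₁ hl₁).sub (kFun_tendsto h hi₂ hl₂)

theorem lFun_lt_lFun (hD : IsDensityPair S m) (h : DecreasingPair S m s φs qs)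
    {θ₁ θ₂ : ℝ → ℝ} (hd₁ : DifferentiableOn ℝ θ₁ (Ioi 0)) (hd₂ : DifferentiableOn ℝ θ₂ (Ioi 0))
    (hi₁ : ∀ x, 0 < x → IntegrableOn (fun y => θ₁ y * φs y * m y) (Ioi x))
    (hi₂ : ∀ x, 0 < x → IntegrableOn (fun y => θ₂ y * φs y * m y) (Ioi x))
    (hl₁ : Tendsto (lFun m φs qs s θ₁) atTop (𝓝 0))
    (hl₂ : Tendsto (lFun m φs qs s θ₂) atTop (𝓝 0))
    (hlt : ∀ x, 0 < x → deriv θ₁ x < deriv θ₂ x) {x : ℝ} (hx : 0 < x) :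
    lFun m φs qs s θ₁ x < lFun m φs qs s θ₂ x := by
  rw [← sub_pos]
  refine pos_of_strictAntiOn_of_tendsto
    (f := fun x => lFun m φs qs s θ₂ x - lFun m φs qs s θ₁ x)
    (strictAntiOn_of_hasDerivAt_neg (convex_Ici x)
      (fun y hy => (lFun_hasDerivAt hD h hd₂ hi₂ (hx.trans_le hy)).sub
        (lFun_hasDerivAt hD h hd₁ hi₁ (hx.trans_le hy)))
      fun y hy => ?_) ?_
  · have hy : 0 < y := hx.trans_le (interior_subset hy)
    nlinarith [h.flux_pos y hy, hlt y hy]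
  · simpa using hl₂.sub hl₁

/-! ### Comparison of two rates -/

/-- With the constant `k = p_s(x)/p_r(x)`, the difference `K^s - k K^r` starts at `0` and has
derivative `(k p_r - p_s) θ' ≥ 0` on `(0, x]`, because `p_s/p_r` is increasing. It controls the
negative quantity `K^s` by a fixed value of `K^r` as `s` grows. -/
theorem kFun_ratio_le (hD : IsDensityPair S m) (hrs : r < s)
    (h : IncreasingPair S m r ψr pr) (h' : IncreasingPair S m s ψs ps)
    (hi : ∀ x, 0 < x → IntegrableOn (fun y => θ y * ψr y * m y) (Ioc 0 x))
    (hl : Tendsto θ (𝓝[>] 0) (𝓝 l)) (hθ : IsPeak θ x₀) {x : ℝ} (hx : x ∈ Ioc 0 x₀) :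
    ps x / pr x * kFun m ψr pr r θ x ≤ kFun m ψs ps s θ x := by
  have hi' : ∀ x, 0 < x → IntegrableOn (fun y => θ y * ψs y * m y) (Ioc 0 x) := fun x hx =>
    integrableOn_Ioc_of_lt hD hrs h h' hθ.differentiable.continuousOn hi hx
  rw [← sub_nonneg]
  refine nonneg_of_monotoneOn_of_tendsto
    (f := fun y => kFun m ψs ps s θ y - ps x / pr x * kFun m ψr pr r θ y) hx.1
    (monotoneOn_of_hasDerivAt_nonneg (f' := fun y => (ps x / pr x * pr y - ps y) * deriv θ y)
      (convex_Ioc 0 x) (fun y hy => ((kFun_hasDerivAt hD h' hθ.differentiable hi' hy.1).sub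
      ((kFun_hasDerivAt hD h hθ.differentiable hi hy.1).const_mul (ps x / pr x))).congr_deriv
        (by ring)) fun y hy => ?_) ?_
  · rw [interior_Ioc] at hy
    have h1 := h.flux_ratio_monotoneOn hD hrs h' hy.1 hx.1 hy.2.le
    simp only at h1
    rw [div_le_iff₀ (h.flux_pos y hy.1)] at h1
    exact mul_nonneg (sub_nonneg.2 h1) (hθ.deriv_pos y hy.1 (hy.2.trans_le hx.2)).le
  · simpa using (kFun_tendsto h' hi' hl).sub ((kFun_tendsto h hi hl).const_mul (ps x / pr x))

theorem lFun_ratio_le (hD : IsDensityPair S m) (hr : 0 < r) (hrs : r < s)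
    (h : DecreasingPair S m r φr qr) (h' : DecreasingPair S m s φs qs)
    (hi : ∀ x, 0 < x → IntegrableOn (fun y => θ y * φr y * m y) (Ioi x))
    (hθ : IsPeak θ x₀) (h0 : 0 < x₀) (hlim : Tendsto θ atTop atBot) {x : ℝ} (hx : x₀ ≤ x) :
    qs x / qr x * lFun m φr qr r θ x ≤ lFun m φs qs s θ x := by
  have hi' : ∀ x, 0 < x → IntegrableOn (fun y => θ y * φs y * m y) (Ioi x) := fun x hx =>
    integrableOn_Ioi_of_lt hD hrs h h' hθ.differentiable.continuousOn hi hx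
  have hx0 := h0.trans_le hx
  rw [← sub_nonneg]
  refine nonneg_of_antitoneOn_of_tendsto
    (f := fun y => lFun m φs qs s θ y - qs x / qr x * lFun m φr qr r θ y)
    (antitoneOn_of_hasDerivAt_nonpos (f' := fun y => (qs x / qr x * qr y - qs y) * deriv θ y)
      (convex_Ici x) (fun y hy => ((lFun_hasDerivAt hD h' hθ.differentiable hi'
        (hx0.trans_le hy)).sub ((lFun_hasDerivAt hD h hθ.differentiable hi
        (hx0.trans_le hy)).const_mul (qs x / qr x))).congr_deriv
        (by ring)) fun y hy => ?_) ?_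
  · rw [interior_Ici] at hy
    have hy0 : 0 < y := hx0.trans hy
    have h1 := h.flux_ratio_antitoneOn hD hrs h' hx0 hy0 (le_of_lt hy)
    simp only at h1
    rw [div_le_iff₀ (h.flux_pos y hy0)] at h1
    exact mul_nonpos_of_nonneg_of_nonpos (sub_nonneg.2 h1)
      (hθ.deriv_neg y hy0 (hx.trans_lt hy)).le
  · simpa using (lFun_tendsto hD (hr.trans hrs) h' hi' hθ h0 hlim).sub
      ((lFun_tendsto hD hr h hi hθ h0 hlim).const_mul (qs x / qr x))

/-- From `K' = -p θ'`: below the peak `θ' ≥ 0`, and the flux is largest at the right endpoint. The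
three analogues below freeze the flux at the endpoint that suits the signs. -/
theorem kFun_increment_le (hD : IsDensityPair S m) (hs : 0 < s) (h : IncreasingPair S m s ψs ps)
    (hi : ∀ x, 0 < x → IntegrableOn (fun y => θ y * ψs y * m y) (Ioc 0 x))
    (hθ : IsPeak θ x₀) {x y : ℝ} (hy : 0 < y) (hyx : y ≤ x) (hx : x ≤ x₀) :
    ps x * (θ y - θ x) ≤ kFun m ψs ps s θ x - kFun m ψs ps s θ y := by
  have := monotoneOn_of_hasDerivAt_nonneg (f := fun z => kFun m ψs ps s θ z + ps x * θ z)
    (f' := fun z => (ps x - ps z) * deriv θ z) (convex_Icc y x)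
    (fun z hz => ((kFun_hasDerivAt hD h hθ.differentiable hi (hy.trans_le hz.1)).add
      ((((hθ.differentiable z (hy.trans_le hz.1)).differentiableAt
        (Ioi_mem_nhds (hy.trans_le hz.1))).hasDerivAt).const_mul (ps x))).congr_deriv (by ring))
    (fun z hz => ?_) (left_mem_Icc.2 hyx) (right_mem_Icc.2 hyx) hyx
  · simp only at this
    linarith
  · rw [interior_Icc] at hz
    have hz0 := hy.trans hz.1
    exact mul_nonneg (sub_nonneg.2 ((h.flux_strictMonoOn hD hs).monotoneOn hz0
      (hz0.trans hz.2) hz.2.le)) (hθ.deriv_pos z hz0 (hz.2.trans_le hx)).le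

theorem kFun_increment_ge (hD : IsDensityPair S m) (hs : 0 < s) (h : IncreasingPair S m s ψs ps)
    (hi : ∀ x, 0 < x → IntegrableOn (fun y => θ y * ψs y * m y) (Ioc 0 x))
    (hθ : IsPeak θ x₀) (h0 : 0 < x₀) {x y : ℝ} (hy : x₀ ≤ y) (hyx : y ≤ x) :
    ps y * (θ y - θ x) ≤ kFun m ψs ps s θ x - kFun m ψs ps s θ y := by
  have hy0 := h0.trans_le hy
  have := monotoneOn_of_hasDerivAt_nonneg (f := fun z => kFun m ψs ps s θ z + ps y * θ z)
    (f' := fun z => (ps y - ps z) * deriv θ z) (convex_Icc y x)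
    (fun z hz => ((kFun_hasDerivAt hD h hθ.differentiable hi (hy0.trans_le hz.1)).add
      ((((hθ.differentiable z (hy0.trans_le hz.1)).differentiableAt
        (Ioi_mem_nhds (hy0.trans_le hz.1))).hasDerivAt).const_mul (ps y))).congr_deriv (by ring))
    (fun z hz => ?_) (left_mem_Icc.2 hyx) (right_mem_Icc.2 hyx) hyx
  · simp only at this
    linarith
  · rw [interior_Icc] at hz
    have hz0 := hy0.trans hz.1
    exact mul_nonneg_of_nonpos_of_nonpos (sub_nonpos.2 ((h.flux_strictMonoOn hD hs).monotoneOn hy0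
      hz0 hz.1.le)) (hθ.deriv_neg z hz0 (hy.trans_lt hz.1)).le

theorem lFun_increment_le (hD : IsDensityPair S m) (hs : 0 < s) (h : DecreasingPair S m s φs qs)
    (hi : ∀ x, 0 < x → IntegrableOn (fun y => θ y * φs y * m y) (Ioi x))
    (hθ : IsPeak θ x₀) (h0 : 0 < x₀) {x y : ℝ} (hx : x₀ ≤ x) (hxy : x ≤ y) :
    qs x * (θ y - θ x) ≤ lFun m φs qs s θ x - lFun m φs qs s θ y := by
  have hx0 := h0.trans_le hx
  have := antitoneOn_of_hasDerivAt_nonpos (f := fun z => lFun m φs qs s θ z + qs x * θ z)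
    (f' := fun z => (qs x - qs z) * deriv θ z) (convex_Icc x y)
    (fun z hz => ((lFun_hasDerivAt hD h hθ.differentiable hi (hx0.trans_le hz.1)).add
      ((((hθ.differentiable z (hx0.trans_le hz.1)).differentiableAt
        (Ioi_mem_nhds (hx0.trans_le hz.1))).hasDerivAt).const_mul (qs x))).congr_deriv (by ring))
    (fun z hz => ?_) (left_mem_Icc.2 hxy) (right_mem_Icc.2 hxy) hxy
  · simp only at this
    linarith
  · rw [interior_Icc] at hz
    have hz0 := hx0.trans hz.1
    exact mul_nonpos_of_nonneg_of_nonpos (sub_nonneg.2 ((h.flux_strictAntiOn hD hs).antitoneOn hx0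
      hz0 hz.1.le)) (hθ.deriv_neg z hz0 (hx.trans_lt hz.1)).le

theorem lFun_increment_ge (hD : IsDensityPair S m) (hs : 0 < s) (h : DecreasingPair S m s φs qs)
    (hi : ∀ x, 0 < x → IntegrableOn (fun y => θ y * φs y * m y) (Ioi x))
    (hθ : IsPeak θ x₀) {x y : ℝ} (hx : 0 < x) (hxy : x ≤ y) (hy : y ≤ x₀) :
    qs y * (θ y - θ x) ≤ lFun m φs qs s θ x - lFun m φs qs s θ y := by
  have := antitoneOn_of_hasDerivAt_nonpos (f := fun z => lFun m φs qs s θ z + qs y * θ z)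
    (f' := fun z => (qs y - qs z) * deriv θ z) (convex_Icc x y)
    (fun z hz => ((lFun_hasDerivAt hD h hθ.differentiable hi (hx.trans_le hz.1)).add
      ((((hθ.differentiable z (hx.trans_le hz.1)).differentiableAt
        (Ioi_mem_nhds (hx.trans_le hz.1))).hasDerivAt).const_mul (qs y))).congr_deriv (by ring))
    (fun z hz => ?_) (left_mem_Icc.2 hxy) (right_mem_Icc.2 hxy) hxy
  · simp only at this
    linarith
  · rw [interior_Icc] at hz
    have hz0 := hx.trans hz.1
    exact mul_nonpos_of_nonpos_of_nonneg (sub_nonpos.2 ((h.flux_strictAntiOn hD hs).antitoneOn hz0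
      (hz0.trans hz.2) hz.2.le)) (hθ.deriv_pos z hz0 (hz.2.trans_le hy)).le

end Functionals

/-! ### Large rates -/

section LargeRates

variable {S m θ : ℝ → ℝ} {ψ p φ q : ℝ → ℝ → ℝ} {r l x₀ : ℝ}

/-- For `y < x`, `0 > K^s(x)/p_s(x) ≥ -(θ(x) - θ(y)) + K^s(y)/p_s(x)`. The first term is small for
`y` near `x` by continuity. By `kFun_ratio_le` the second is at least `p_s(y)/p_s(x)` times a
constant independent of `s`, which tends to `0`. -/
theorem tendsto_kFun_div (hD : IsDensityPair S m) (hr : 0 < r)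
    (h : ∀ s, 0 < s → IncreasingPair S m s (ψ s) (p s))
    (hi : ∀ x, 0 < x → IntegrableOn (fun y => θ y * ψ r y * m y) (Ioc 0 x))
    (hl : Tendsto θ (𝓝[>] 0) (𝓝 l)) (hθ : IsPeak θ x₀) {x : ℝ} (hx : x ∈ Ioc 0 x₀) :
    Tendsto (fun s => kFun m (ψ s) (p s) s θ x / p s x) atTop (𝓝 0) := by
  have hcont : ContinuousAt θ x :=
    hθ.differentiable.continuousOn.continuousAt (Ioi_mem_nhds hx.1)
  rw [Metric.tendsto_nhds]
  intro ε hε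
  have h1 : ∀ᶠ y in 𝓝[<] x, θ x - ε / 2 < θ y :=
    (hcont.eventually (lt_mem_nhds (by linarith))).filter_mono nhdsWithin_le_nhds
  obtain ⟨y, hy1, hy⟩ := (h1.and (Ioo_mem_nhdsLT hx.1)).exists
  have h2 : Tendsto (fun s => p s y / p s x * (kFun m (ψ r) (p r) r θ y / p r y)) atTop (𝓝 0) := by
    simpa using (tendsto_flux_ratio_increasing hD h hy.1 hy.2).mul_const
      (kFun m (ψ r) (p r) r θ y / p r y)
  filter_upwards [h2.eventually (lt_mem_nhds (show -(ε / 2) < 0 by linarith)),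
    eventually_gt_atTop r] with s hs hrs
  have hs0 := hr.trans hrs
  have hi' : ∀ x, 0 < x → IntegrableOn (fun y => θ y * ψ s y * m y) (Ioc 0 x) := fun x hx =>
    integrableOn_Ioc_of_lt hD hrs (h r hr) (h s hs0) hθ.differentiable.continuousOn hi hx
  have hpx := (h s hs0).flux_pos x hx.1
  have hpy := (h r hr).flux_pos y hy.1
  have i1 := kFun_neg hD (h s hs0) hi' hl hθ hx
  have i2 := kFun_increment_le hD hs0 (h s hs0) hi' hθ hy.1 hy.2.le hx.2
  have i3 := kFun_ratio_le hD hrs (h r hr) (h s hs0) hi hl hθ ⟨hy.1, hy.2.le.trans hx.2⟩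
  rw [Real.dist_eq, sub_zero, abs_div, abs_of_neg i1, abs_of_pos hpx, div_lt_iff₀ hpx]
  have i4 : p s y / p s x * (kFun m (ψ r) (p r) r θ y / p r y) =
      (p s y / p r y * kFun m (ψ r) (p r) r θ y) / p s x := by
    field_simp
  rw [i4, lt_div_iff₀ hpx] at hs
  nlinarith

theorem tendsto_lFun_div (hD : IsDensityPair S m) (hr : 0 < r)
    (h : ∀ s, 0 < s → DecreasingPair S m s (φ s) (q s))
    (hi : ∀ x, 0 < x → IntegrableOn (fun y => θ y * φ r y * m y) (Ioi x))
    (hθ : IsPeak θ x₀) (h0 : 0 < x₀) (hlim : Tendsto θ atTop atBot) {x : ℝ} (hx : x₀ ≤ x) :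
    Tendsto (fun s => lFun m (φ s) (q s) s θ x / q s x) atTop (𝓝 0) := by
  have hx0 := h0.trans_le hx
  have hcont : ContinuousAt θ x :=
    hθ.differentiable.continuousOn.continuousAt (Ioi_mem_nhds hx0)
  rw [Metric.tendsto_nhds]
  intro ε hε
  have h1 : ∀ᶠ y in 𝓝[>] x, θ x - ε / 2 < θ y :=
    (hcont.eventually (lt_mem_nhds (by linarith))).filter_mono nhdsWithin_le_nhds
  obtain ⟨y, hy1, hy⟩ := (h1.and self_mem_nhdsWithin).exists
  have hy : x < y := hy
  have hy0 := hx0.trans hy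
  have h2 : Tendsto (fun s => q s y / q s x * (lFun m (φ r) (q r) r θ y / q r y)) atTop (𝓝 0) := by
    simpa using (tendsto_flux_ratio_decreasing hD h hx0 hy).mul_const
      (lFun m (φ r) (q r) r θ y / q r y)
  filter_upwards [h2.eventually (lt_mem_nhds (show -(ε / 2) < 0 by linarith)),
    eventually_gt_atTop r] with s hs hrs
  have hs0 := hr.trans hrs
  have hi' : ∀ x, 0 < x → IntegrableOn (fun y => θ y * φ s y * m y) (Ioi x) := fun x hx =>
    integrableOn_Ioi_of_lt hD hrs (h r hr) (h s hs0) hθ.differentiable.continuousOn hi hx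
  have hpx := (h s hs0).flux_pos x hx0
  have hpy := (h r hr).flux_pos y hy0
  have i1 := lFun_neg hD hs0 (h s hs0) hi' hθ h0 hlim hx
  have i2 := lFun_increment_le hD hs0 (h s hs0) hi' hθ h0 hx hy.le
  have i3 := lFun_ratio_le hD hr hrs (h r hr) (h s hs0) hi hθ h0 hlim (hx.trans hy.le)
  rw [Real.dist_eq, sub_zero, abs_div, abs_of_neg i1, abs_of_pos hpx, div_lt_iff₀ hpx]
  have i4 : q s y / q s x * (lFun m (φ r) (q r) r θ y / q r y) =
      (q s y / q r y * lFun m (φ r) (q r) r θ y) / q s x := by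
    field_simp
  rw [i4, lt_div_iff₀ hpx] at hs
  nlinarith

/-- Between a point `y` past the peak and `x`, `K^s` gains at least `p_s(y)(θ(y) - θ(x)) > 0`,
whereas its negative value at the peak is of order `p_s(x₀)`, negligible against `p_s(y)`. So the
sign change of `K^s` is eventually to the left of any given point past the peak. -/
theorem eventually_kFun_pos_rate (hD : IsDensityPair S m) (hr : 0 < r)
    (h : ∀ s, 0 < s → IncreasingPair S m s (ψ s) (p s))
    (hi : ∀ x, 0 < x → IntegrableOn (fun y => θ y * ψ r y * m y) (Ioc 0 x))
    (hl : Tendsto θ (𝓝[>] 0) (𝓝 l)) (hθ : IsPeak θ x₀) (h0 : 0 < x₀) {x : ℝ} (hx : x₀ < x) :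
    ∀ᶠ s in atTop, 0 < kFun m (ψ s) (p s) s θ x := by
  obtain ⟨y, hy, hyx⟩ := exists_between hx
  have hy0 := h0.trans hy
  have hθlt := hθ.strictAntiOn h0 (mem_Ici.2 hy.le) (mem_Ici.2 hx.le) hyx
  have h2 : Tendsto (fun s => p s x₀ / p s y * (kFun m (ψ r) (p r) r θ x₀ / p r x₀))
      atTop (𝓝 0) := by
    simpa using (tendsto_flux_ratio_increasing hD h h0 hy).mul_const
      (kFun m (ψ r) (p r) r θ x₀ / p r x₀)
  filter_upwards [h2.eventually (lt_mem_nhds (show -(θ y - θ x) < 0 by linarith)),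
    eventually_gt_atTop r] with s hs hrs
  have hs0 := hr.trans hrs
  have hi' : ∀ x, 0 < x → IntegrableOn (fun y => θ y * ψ s y * m y) (Ioc 0 x) := fun x hx =>
    integrableOn_Ioc_of_lt hD hrs (h r hr) (h s hs0) hθ.differentiable.continuousOn hi hx
  have hpy := (h s hs0).flux_pos y hy0
  have hpx := (h r hr).flux_pos x₀ h0
  have i1 := kFun_strictMonoOn hD (h s hs0) hi' hθ h0 self_mem_Ici (mem_Ici.2 hy.le) hy
  have i2 := kFun_increment_ge hD hs0 (h s hs0) hi' hθ h0 hy.le hyx.le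
  have i3 := kFun_ratio_le hD hrs (h r hr) (h s hs0) hi hl hθ ⟨h0, le_rfl⟩
  have i4 : p s x₀ / p s y * (kFun m (ψ r) (p r) r θ x₀ / p r x₀) =
      (p s x₀ / p r x₀ * kFun m (ψ r) (p r) r θ x₀) / p s y := by
    field_simp
  rw [i4, lt_div_iff₀ hpy] at hs
  nlinarith

theorem eventually_lFun_pos_rate (hD : IsDensityPair S m) (hr : 0 < r)
    (h : ∀ s, 0 < s → DecreasingPair S m s (φ s) (q s))
    (hi : ∀ x, 0 < x → IntegrableOn (fun y => θ y * φ r y * m y) (Ioi x))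
    (hθ : IsPeak θ x₀) (hlim : Tendsto θ atTop atBot) {x : ℝ} (hx0 : 0 < x) (hx : x < x₀) :
    ∀ᶠ s in atTop, 0 < lFun m (φ s) (q s) s θ x := by
  obtain ⟨y, hxy, hy⟩ := exists_between hx
  have hy0 := hx0.trans hxy
  have h0 := hx0.trans hx
  have hθlt := hθ.strictMonoOn ⟨hx0, hx.le⟩ ⟨hy0, hy.le⟩ hxy
  have h2 : Tendsto (fun s => q s x₀ / q s y * (lFun m (φ r) (q r) r θ x₀ / q r x₀))
      atTop (𝓝 0) := by
    simpa using (tendsto_flux_ratio_decreasing hD h hy0 hy).mul_const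
      (lFun m (φ r) (q r) r θ x₀ / q r x₀)
  filter_upwards [h2.eventually (lt_mem_nhds (show -(θ y - θ x) < 0 by linarith)),
    eventually_gt_atTop r] with s hs hrs
  have hs0 := hr.trans hrs
  have hi' : ∀ x, 0 < x → IntegrableOn (fun y => θ y * φ s y * m y) (Ioi x) := fun x hx =>
    integrableOn_Ioi_of_lt hD hrs (h r hr) (h s hs0) hθ.differentiable.continuousOn hi hx
  have hpy := (h s hs0).flux_pos y hy0
  have hpx := (h r hr).flux_pos x₀ h0
  have i1 := lFun_strictAntiOn hD (h s hs0) hi' hθ ⟨hy0, hy.le⟩ ⟨h0, le_rfl⟩ hy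
  have i2 := lFun_increment_ge hD hs0 (h s hs0) hi' hθ hx0 hxy.le hy.le
  have i3 := lFun_ratio_le hD hr hrs (h r hr) (h s hs0) hi hθ h0 hlim le_rfl
  have i4 : q s x₀ / q s y * (lFun m (φ r) (q r) r θ x₀ / q r x₀) =
      (q s x₀ / q r x₀ * lFun m (φ r) (q r) r θ x₀) / q s y := by
    field_simp
  rw [i4, lt_div_iff₀ hpy] at hs
  nlinarith

end LargeRates

/-! ### The resolvent -/

/-- The fundamental solutions at the rate `r`, their fluxes and their Wronskian `B`. -/
structure FundamentalSystem (S m : ℝ → ℝ) (r : ℝ) (ψ p φ q : ℝ → ℝ) (B : ℝ) : Prop where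
  densities : IsDensityPair S m
  rate_pos : 0 < r
  inc : IncreasingPair S m r ψ p
  dec : DecreasingPair S m r φ q
  wronskian_pos : 0 < B
  wronskian_eq : ∀ x, 0 < x → φ x * p x + q x * ψ x = B

/-- `f` is continuous and its resolvent converges absolutely. -/
structure IsSource (m ψ φ f : ℝ → ℝ) : Prop where
  continuousOn : ContinuousOn f (Ioi 0)
  lower : ∀ x, 0 < x → IntegrableOn (fun y => f y * ψ y * m y) (Ioc 0 x)
  upper : ∀ x, 0 < x → IntegrableOn (fun y => f y * φ y * m y) (Ioi x)

/-- `∫_0^x f ψ m dy`. -/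
def lowerInt (m ψ f : ℝ → ℝ) (x : ℝ) : ℝ := ∫ y in Ioc 0 x, f y * ψ y * m y

/-- `∫_x^∞ f φ m dy`. -/
def upperInt (m φ f : ℝ → ℝ) (x : ℝ) : ℝ := ∫ y in Ioi x, f y * φ y * m y

/-- The resolvent of `f`. -/
def green (m ψ φ : ℝ → ℝ) (B : ℝ) (f : ℝ → ℝ) (x : ℝ) : ℝ :=
  B⁻¹ * (φ x * lowerInt m ψ f x + ψ x * upperInt m φ f x)

/-- The flux of the resolvent of `f`. -/
def greenFlux (m ψ p φ q : ℝ → ℝ) (B : ℝ) (f : ℝ → ℝ) (x : ℝ) : ℝ :=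
  B⁻¹ * (p x * upperInt m φ f x - q x * lowerInt m ψ f x)

theorem tendsto_lowerInt {m ψ f : ℝ → ℝ}
    (hi : ∀ x, 0 < x → IntegrableOn (fun y => f y * ψ y * m y) (Ioc 0 x)) :
    Tendsto (lowerInt m ψ f) (𝓝[>] 0) (𝓝 0) := tendsto_integral_Ioc (hi 1 one_pos)

theorem tendsto_upperInt {m φ f : ℝ → ℝ} : Tendsto (upperInt m φ f) atTop (𝓝 0) :=
  tendsto_integral_Ioi_zero tendsto_id

section Resolvent

variable {S m ψr pr φr qr ψs ps φs qs f : ℝ → ℝ} {r s B : ℝ}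

theorem IsSource.abs (hD : IsDensityPair S m) (h : IncreasingPair S m r ψr pr)
    (d : DecreasingPair S m r φr qr) (hf : IsSource m ψr φr f) :
    IsSource m ψr φr (fun y => |f y|) := by
  refine ⟨hf.continuousOn.abs, fun x hx => ?_, fun x hx => ?_⟩
  · refine IntegrableOn.congr_fun (hf.lower x hx).norm (fun y hy => ?_) measurableSet_Ioc
    simp only [Real.norm_eq_abs, abs_mul, abs_of_pos (h.pos y hy.1),
      abs_of_pos (hD.speed_pos y hy.1)]
  · refine IntegrableOn.congr_fun (hf.upper x hx).norm (fun y hy => ?_) measurableSet_Ioi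
    have hy0 : 0 < y := hx.trans hy
    simp only [Real.norm_eq_abs, abs_mul, abs_of_pos (d.pos y hy0),
      abs_of_pos (hD.speed_pos y hy0)]

theorem IsSource.lowerInt_hasDerivAt (hF : FundamentalSystem S m r ψr pr φr qr B)
    (hf : IsSource m ψr φr f) {x : ℝ} (hx : 0 < x) :
    HasDerivAt (lowerInt m ψr f) (f x * ψr x * m x) x :=
  hasDerivAt_integral_Ioc ((hf.continuousOn.mul hF.inc.continuousOn).mul
    hF.densities.speed_continuous) hf.lower hx

theorem IsSource.upperInt_hasDerivAt (hF : FundamentalSystem S m r ψr pr φr qr B)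
    (hf : IsSource m ψr φr f) {x : ℝ} (hx : 0 < x) :
    HasDerivAt (upperInt m φr f) (-(f x * φr x * m x)) x :=
  hasDerivAt_integral_Ioi ((hf.continuousOn.mul hF.dec.continuousOn).mul
    hF.densities.speed_continuous) hf.upper hx

theorem abs_lowerInt_le (hF : FundamentalSystem S m r ψr pr φr qr B) (x : ℝ) :
    |lowerInt m ψr f x| ≤ lowerInt m ψr (fun y => |f y|) x := by
  refine (norm_integral_le_integral_norm (fun y => f y * ψr y * m y)).trans (le_of_eq ?_)
  refine setIntegral_congr_fun measurableSet_Ioc fun y hy => ?_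
  simp only [Real.norm_eq_abs, abs_mul, abs_of_pos (hF.inc.pos y hy.1),
    abs_of_pos (hF.densities.speed_pos y hy.1)]

theorem abs_upperInt_le (hF : FundamentalSystem S m r ψr pr φr qr B) {x : ℝ} (hx : 0 < x) :
    |upperInt m φr f x| ≤ upperInt m φr (fun y => |f y|) x := by
  refine (norm_integral_le_integral_norm (fun y => f y * φr y * m y)).trans (le_of_eq ?_)
  refine setIntegral_congr_fun measurableSet_Ioi fun y hy => ?_
  have hy0 : 0 < y := hx.trans hy
  simp only [Real.norm_eq_abs, abs_mul, abs_of_pos (hF.dec.pos y hy0),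
    abs_of_pos (hF.densities.speed_pos y hy0)]

theorem abs_green_le (hF : FundamentalSystem S m r ψr pr φr qr B) {x : ℝ} (hx : 0 < x) :
    |green m ψr φr B f x| ≤ green m ψr φr B (fun y => |f y|) x := by
  rw [green, green, abs_mul, abs_of_pos (inv_pos.2 hF.wronskian_pos)]
  refine mul_le_mul_of_nonneg_left ((abs_add_le _ _).trans ?_) (inv_pos.2 hF.wronskian_pos).le
  rw [abs_mul, abs_mul, abs_of_pos (hF.inc.pos x hx), abs_of_pos (hF.dec.pos x hx)]
  exact add_le_add (mul_le_mul_of_nonneg_left (abs_lowerInt_le hF x) (hF.dec.pos x hx).le)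
    (mul_le_mul_of_nonneg_left (abs_upperInt_le hF hx) (hF.inc.pos x hx).le)

theorem green_hasDerivAt (hF : FundamentalSystem S m r ψr pr φr qr B)
    (hf : IsSource m ψr φr f) {x : ℝ} (hx : 0 < x) :
    HasDerivAt (green m ψr φr B f) (S x * greenFlux m ψr pr φr qr B f x) x :=
  ((((hF.dec.hasDerivAt x hx).mul (hf.lowerInt_hasDerivAt hF hx)).add
    ((hF.inc.hasDerivAt x hx).mul (hf.upperInt_hasDerivAt hF hx))).const_mul B⁻¹).congr_deriv
    (by rw [greenFlux]; ring)

theorem greenFlux_hasDerivAt (hF : FundamentalSystem S m r ψr pr φr qr B)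
    (hf : IsSource m ψr φr f) {x : ℝ} (hx : 0 < x) :
    HasDerivAt (greenFlux m ψr pr φr qr B f) (m x * (r * green m ψr φr B f x - f x)) x := by
  refine ((((hF.inc.flux_hasDerivAt x hx).mul (hf.upperInt_hasDerivAt hF hx)).sub
    ((hF.dec.flux_hasDerivAt x hx).mul (hf.lowerInt_hasDerivAt hF hx))).const_mul
      B⁻¹).congr_deriv ?_
  have hB : B⁻¹ * (φr x * pr x + qr x * ψr x) = 1 := by
    rw [hF.wronskian_eq x hx, inv_mul_cancel₀ hF.wronskian_pos.ne']
  rw [green]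
  linear_combination -(f x * m x) * hB

/-- Green's formula at equal rates: the integral of the resolvent has the factor `r - r = 0` and
drops out. -/
theorem greenFlux_inc (hF : FundamentalSystem S m r ψr pr φr qr B) {x : ℝ} (hx : 0 < x) :
    pr x * green m ψr φr B f x - greenFlux m ψr pr φr qr B f x * ψr x = lowerInt m ψr f x := by
  have hB : B⁻¹ * (φr x * pr x + qr x * ψr x) = 1 := by
    rw [hF.wronskian_eq x hx, inv_mul_cancel₀ hF.wronskian_pos.ne']
  rw [green, greenFlux]
  linear_combination lowerInt m ψr f x * hB

theorem greenFlux_dec (hF : FundamentalSystem S m r ψr pr φr qr B) {x : ℝ} (hx : 0 < x) :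
    qr x * green m ψr φr B f x + greenFlux m ψr pr φr qr B f x * φr x = upperInt m φr f x := by
  have hB : B⁻¹ * (φr x * pr x + qr x * ψr x) = 1 := by
    rw [hF.wronskian_eq x hx, inv_mul_cancel₀ hF.wronskian_pos.ne']
  rw [green, greenFlux]
  linear_combination upperInt m φr f x * hB

/-- Split the upper integral at a fixed `X`. On `(x, X]` monotonicity gives `ψ(x) φ(y)/φ(x) ≤ ψ(y)`,
so that part is at most `∫_0^X f ψ m`, small for small `X`; the rest is a constant times `ψ(x)/φ(x)
→ 0`. -/
theorem tendsto_ratio_mul_upperInt (hF : FundamentalSystem S m r ψr pr φr qr B)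
    (hf : IsSource m ψr φr f) (h0 : ∀ x, 0 < x → 0 ≤ f x) :
    Tendsto (fun x => ψr x / φr x * upperInt m φr f x) (𝓝[>] 0) (𝓝 0) := by
  have hD := hF.densities
  have hlow := tendsto_integral_Ioc (hf.lower 1 one_pos)
  rw [Metric.tendsto_nhds]
  intro ε hε
  obtain ⟨X, hX, hX0⟩ := ((hlow.eventually (gt_mem_nhds (half_pos hε))).and
    self_mem_nhdsWithin).exists
  have hX0 : 0 < X := hX0
  have hlim : Tendsto (fun x => ψr x / φr x * upperInt m φr f X) (𝓝[>] 0) (𝓝 0) := by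
    simpa using (tendsto_increasing_div_decreasing hD hF.inc hF.dec).mul_const
      (upperInt m φr f X)
  filter_upwards [hlim.eventually (gt_mem_nhds (half_pos hε)), Ioo_mem_nhdsGT hX0] with x hx hxX
  have hnn : ∀ y, 0 < y → 0 ≤ f y * φr y * m y := fun y hy =>
    mul_nonneg (mul_nonneg (h0 y hy) (hF.dec.pos y hy).le) (hD.speed_pos y hy).le
  have hnn' : ∀ y, 0 < y → 0 ≤ f y * ψr y * m y := fun y hy =>
    mul_nonneg (mul_nonneg (h0 y hy) (hF.inc.pos y hy).le) (hD.speed_pos y hy).le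
  have hu : 0 ≤ upperInt m φr f x :=
    setIntegral_nonneg measurableSet_Ioi fun y hy => hnn y (hxX.1.trans hy)
  have hrat := div_pos (hF.inc.pos x hxX.1) (hF.dec.pos x hxX.1)
  have hsplit : upperInt m φr f x = (∫ y in Ioc x X, f y * φr y * m y) + upperInt m φr f X := by
    rw [upperInt, upperInt, ← Ioc_union_Ioi_eq_Ioi hxX.2.le]
    exact setIntegral_union (Ioc_disjoint_Ioi le_rfl) measurableSet_Ioi
      ((hf.upper x hxX.1).mono_set Ioc_subset_Ioi_self) (hf.upper X hX0)
  have hle : ψr x / φr x * (∫ y in Ioc x X, f y * φr y * m y) ≤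
      ∫ y in Ioc 0 X, f y * ψr y * m y := by
    rw [← integral_const_mul]
    refine (setIntegral_mono_on (((hf.upper x hxX.1).mono_set Ioc_subset_Ioi_self).const_mul _)
      ((hf.lower X hX0).mono_set (Ioc_subset_Ioc_left hxX.1.le)) measurableSet_Ioc
      fun y hy => ?_).trans (setIntegral_mono_set (hf.lower X hX0)
        ((ae_restrict_iff' measurableSet_Ioc).2 (Eventually.of_forall fun y hy => hnn' y hy.1))
        (Ioc_subset_Ioc_left hxX.1.le).eventuallyLE)
    have hy0 := hxX.1.trans hy.1
    have e1 : ψr x ≤ ψr y := (hF.inc.strictMonoOn hD).monotoneOn hxX.1 hy0 hy.1.le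
    have e2 : φr y ≤ φr x := (hF.dec.strictAntiOn hD).antitoneOn hxX.1 hy0 hy.1.le
    have e3 : ψr x / φr x * φr y ≤ ψr y := by
      rw [div_mul_eq_mul_div, div_le_iff₀ (hF.dec.pos x hxX.1)]
      exact mul_le_mul e1 e2 (hF.dec.pos y hy0).le (hF.inc.pos y hy0).le
    have e4 := mul_le_mul_of_nonneg_left e3 (mul_nonneg (h0 y hy0) (hD.speed_pos y hy0).le)
    linarith
  rw [Real.dist_eq, sub_zero, abs_of_nonneg (mul_nonneg hrat.le hu), hsplit, mul_add]
  linarith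

theorem tendsto_ratio_mul_lowerInt (hF : FundamentalSystem S m r ψr pr φr qr B)
    (hf : IsSource m ψr φr f) (h0 : ∀ x, 0 < x → 0 ≤ f x) :
    Tendsto (fun x => φr x / ψr x * lowerInt m ψr f x) atTop (𝓝 0) := by
  have hD := hF.densities
  have hup := tendsto_integral_Ioi_zero (f := fun y => f y * φr y * m y) (μ := volume)
    (b := fun x : ℝ => x) tendsto_id
  rw [Metric.tendsto_nhds]
  intro ε hε
  obtain ⟨X, hX, hX0⟩ := ((hup.eventually (gt_mem_nhds (half_pos hε))).and
    (eventually_gt_atTop 0)).exists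
  have hlim : Tendsto (fun x => φr x / ψr x * lowerInt m ψr f X) atTop (𝓝 0) := by
    simpa using (tendsto_decreasing_div_increasing hD hF.inc hF.dec).mul_const
      (lowerInt m ψr f X)
  filter_upwards [hlim.eventually (gt_mem_nhds (half_pos hε)), eventually_gt_atTop X] with x hx hxX
  have hx0 := hX0.trans hxX
  have hnn : ∀ y, 0 < y → 0 ≤ f y * φr y * m y := fun y hy =>
    mul_nonneg (mul_nonneg (h0 y hy) (hF.dec.pos y hy).le) (hD.speed_pos y hy).le
  have hnn' : ∀ y, 0 < y → 0 ≤ f y * ψr y * m y := fun y hy =>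
    mul_nonneg (mul_nonneg (h0 y hy) (hF.inc.pos y hy).le) (hD.speed_pos y hy).le
  have hu : 0 ≤ lowerInt m ψr f x :=
    setIntegral_nonneg measurableSet_Ioc fun y hy => hnn' y hy.1
  have hrat := div_pos (hF.dec.pos x hx0) (hF.inc.pos x hx0)
  have hsplit : lowerInt m ψr f x = lowerInt m ψr f X + ∫ y in Ioc X x, f y * ψr y * m y := by
    rw [lowerInt, lowerInt, ← Ioc_union_Ioc_eq_Ioc hX0.le hxX.le]
    exact setIntegral_union (Ioc_disjoint_Ioc_of_le le_rfl) measurableSet_Ioc (hf.lower X hX0)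
      ((hf.lower x hx0).mono_set (Ioc_subset_Ioc_left hX0.le))
  have hle : φr x / ψr x * (∫ y in Ioc X x, f y * ψr y * m y) ≤
      ∫ y in Ioi X, f y * φr y * m y := by
    rw [← integral_const_mul]
    refine (setIntegral_mono_on
      (((hf.lower x hx0).mono_set (Ioc_subset_Ioc_left hX0.le)).const_mul _)
      ((hf.upper X hX0).mono_set Ioc_subset_Ioi_self) measurableSet_Ioc
      fun y hy => ?_).trans (setIntegral_mono_set (hf.upper X hX0)
        ((ae_restrict_iff' measurableSet_Ioi).2
          (Eventually.of_forall fun y hy => hnn y (hX0.trans hy)))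
        Ioc_subset_Ioi_self.eventuallyLE)
    have hy0 := hX0.trans hy.1
    have e1 : ψr y ≤ ψr x := (hF.inc.strictMonoOn hD).monotoneOn hy0 hx0 hy.2
    have e2 : φr x ≤ φr y := (hF.dec.strictAntiOn hD).antitoneOn hy0 hx0 hy.2
    have e3 : φr x / ψr x * ψr y ≤ φr y := by
      rw [div_mul_eq_mul_div, div_le_iff₀ (hF.inc.pos x hx0)]
      exact mul_le_mul e2 e1 (hF.inc.pos y hy0).le (hF.dec.pos y hy0).le
    have e4 := mul_le_mul_of_nonneg_left e3 (mul_nonneg (h0 y hy0) (hD.speed_pos y hy0).le)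
    linarith
  rw [Real.dist_eq, sub_zero, abs_of_nonneg (mul_nonneg hrat.le hu), hsplit, mul_add]
  linarith

/-- The boundary term of Green's formula vanishes at `0`. -/
theorem tendsto_boundary_zero (hF : FundamentalSystem S m r ψr pr φr qr B) (hrs : r < s)
    (h' : IncreasingPair S m s ψs ps) (hf : IsSource m ψr φr f) :
    Tendsto (fun x => ps x * green m ψr φr B f x - greenFlux m ψr pr φr qr B f x * ψs x)
      (𝓝[>] 0) (𝓝 0) := by
  have hD := hF.densities
  have hW := tendsto_mixed_zero hD hF.rate_pos hrs hF.inc h' hF.dec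
  have hlow := tendsto_lowerInt hf.lower
  have hfa := hf.abs hD hF.inc hF.dec
  have hup := tendsto_ratio_mul_upperInt hF hfa fun x _ => abs_nonneg _
  -- Up to `B⁻¹` the boundary term is the lower integral times the mixed Wronskian plus this
  -- product. The determinant is at most `ψ_r/φ_r` times the mixed Wronskian, which reduces the
  -- claim to `tendsto_ratio_mul_upperInt`.
  have h2 : Tendsto (fun x => upperInt m φr f x * (ψr x * ps x - ψs x * pr x)) (𝓝[>] 0) (𝓝 0) := by
    have hp : Tendsto (fun x => (φr x * ps x + qr x * ψs x) *
        (ψr x / φr x * upperInt m φr (fun y => |f y|) x)) (𝓝[>] 0) (𝓝 0) := by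
      simpa using hW.mul hup
    refine squeeze_zero_norm' ?_ hp
    filter_upwards [self_mem_nhdsWithin] with x hx
    have hx : 0 < x := hx
    have i1 := hF.inc.pos x hx
    have i2 := hF.inc.flux_pos x hx
    have i3 := hF.dec.pos x hx
    have i4 := hF.dec.flux_pos x hx
    have i5 := h'.pos x hx
    have i6 := h'.flux_pos x hx
    have i7 := hF.inc.det_pos hD hrs h' hx
    have i8 := abs_upperInt_le (f := f) hF hx
    rw [Real.norm_eq_abs, abs_mul, abs_of_pos i7]
    have e : (φr x * ps x + qr x * ψs x) * (ψr x / φr x * upperInt m φr (fun y => |f y|) x) =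
        upperInt m φr (fun y => |f y|) x * (ψr x * ps x + qr x * ψs x * ψr x / φr x) := by
      field_simp
    rw [e]
    refine mul_le_mul i8 ?_ i7.le ((abs_nonneg _).trans i8)
    have : 0 < qr x * ψs x * ψr x / φr x := by positivity
    nlinarith [mul_pos i5 i2]
  have h1 : Tendsto (fun x => lowerInt m ψr f x * (φr x * ps x + qr x * ψs x)) (𝓝[>] 0) (𝓝 0) := by
    simpa using hlow.mul hW
  have h3 := (h1.add h2).const_mul B⁻¹
  rw [add_zero, mul_zero] at h3
  refine h3.congr fun x => ?_
  rw [green, greenFlux]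
  ring

/-- The boundary term of Green's formula vanishes at `∞`. -/
theorem tendsto_boundary_atTop (hF : FundamentalSystem S m r ψr pr φr qr B) (hrs : r < s)
    (d' : DecreasingPair S m s φs qs) (hf : IsSource m ψr φr f) :
    Tendsto (fun x => qs x * green m ψr φr B f x + greenFlux m ψr pr φr qr B f x * φs x)
      atTop (𝓝 0) := by
  have hD := hF.densities
  have hW := tendsto_mixed_atTop hD hF.rate_pos hrs hF.dec d' hF.inc
  have hup := tendsto_upperInt (m := m) (φ := φr) (f := f)
  have hfa := hf.abs hD hF.inc hF.dec
  have hlow := tendsto_ratio_mul_lowerInt hF hfa fun x _ => abs_nonneg _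
  have h2 : Tendsto (fun x => lowerInt m ψr f x * (φr x * qs x - φs x * qr x)) atTop (𝓝 0) := by
    have hp : Tendsto (fun x => (ψr x * qs x + pr x * φs x) *
        (φr x / ψr x * lowerInt m ψr (fun y => |f y|) x)) atTop (𝓝 0) := by
      simpa using hW.mul hlow
    refine squeeze_zero_norm' ?_ hp
    filter_upwards [eventually_gt_atTop 0] with x hx
    have i1 := hF.inc.pos x hx
    have i2 := hF.inc.flux_pos x hx
    have i3 := hF.dec.pos x hx
    have i4 := hF.dec.flux_pos x hx
    have i5 := d'.pos x hx
    have i6 := d'.flux_pos x hx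
    have i7 := hF.dec.det_pos hD hrs d' hx
    have i8 := abs_lowerInt_le (f := f) hF x
    rw [Real.norm_eq_abs, abs_mul, abs_of_pos i7]
    have e : (ψr x * qs x + pr x * φs x) * (φr x / ψr x * lowerInt m ψr (fun y => |f y|) x) =
        lowerInt m ψr (fun y => |f y|) x * (φr x * qs x + pr x * φs x * φr x / ψr x) := by
      field_simp
    rw [e]
    refine mul_le_mul i8 ?_ i7.le ((abs_nonneg _).trans i8)
    have : 0 < pr x * φs x * φr x / ψr x := by positivity
    nlinarith [mul_pos i5 i4]
  have h1 : Tendsto (fun x => upperInt m φr f x * (ψr x * qs x + pr x * φs x)) atTop (𝓝 0) := by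
    simpa using hup.mul hW
  have h3 := (h1.add h2).const_mul B⁻¹
  rw [add_zero, mul_zero] at h3
  refine h3.congr fun x => ?_
  rw [green, greenFlux]
  ring

theorem boundary_hasDerivAt_zero (hF : FundamentalSystem S m r ψr pr φr qr B)
    (h' : IncreasingPair S m s ψs ps) (hf : IsSource m ψr φr f) {x : ℝ} (hx : 0 < x) :
    HasDerivAt (fun x => ps x * green m ψr φr B f x - greenFlux m ψr pr φr qr B f x * ψs x)
      ((s - r) * (green m ψr φr B f x * ψs x * m x) + f x * ψs x * m x) x :=
  (((h'.flux_hasDerivAt x hx).mul (green_hasDerivAt hF hf hx)).sub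
    ((greenFlux_hasDerivAt hF hf hx).mul (h'.hasDerivAt x hx))).congr_deriv (by ring)

theorem boundary_hasDerivAt_atTop (hF : FundamentalSystem S m r ψr pr φr qr B)
    (d' : DecreasingPair S m s φs qs) (hf : IsSource m ψr φr f) {x : ℝ} (hx : 0 < x) :
    HasDerivAt (fun x => qs x * green m ψr φr B f x + greenFlux m ψr pr φr qr B f x * φs x)
      (-((s - r) * (green m ψr φr B f x * φs x * m x) + f x * φs x * m x)) x :=
  (((d'.flux_hasDerivAt x hx).mul (green_hasDerivAt hF hf hx)).add
    ((greenFlux_hasDerivAt hF hf hx).mul (d'.hasDerivAt x hx))).congr_deriv (by ring)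

theorem green_continuousOn (hF : FundamentalSystem S m r ψr pr φr qr B)
    (hf : IsSource m ψr φr f) : ContinuousOn (green m ψr φr B f) (Ioi 0) := fun _ hx =>
  (green_hasDerivAt hF hf hx).continuousAt.continuousWithinAt

/-- For the resolvent of `|f|` the boundary term of Green's formula has the nonnegative derivative
`(s - r) (R_r|f|) ψ_s m + |f| ψ_s m`, and it is itself nonnegative since it starts at `0`. A
nonnegative function has an integrable nonnegative derivative, and `|R_r f| ≤ R_r|f|`. -/
theorem green_integrableOn_Ioc (hF : FundamentalSystem S m r ψr pr φr qr B) (hrs : r < s)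
    (h' : IncreasingPair S m s ψs ps) (hf : IsSource m ψr φr f) (x : ℝ) :
    IntegrableOn (fun y => green m ψr φr B f y * ψs y * m y) (Ioc 0 x) := by
  have hD := hF.densities
  have hfa := hf.abs hD hF.inc hF.dec
  have hsr := sub_pos.2 hrs
  have hG : ∀ y, 0 < y → 0 ≤ green m ψr φr B (fun y => |f y|) y := fun y hy =>
    (abs_nonneg _).trans (abs_green_le (f := f) hF hy)
  have hnn : ∀ y, 0 < y → 0 ≤ (s - r) * (green m ψr φr B (fun y => |f y|) y * ψs y * m y) +
      |f y| * ψs y * m y := fun y hy => by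
    have i1 := h'.pos y hy
    have i2 := hD.speed_pos y hy
    have i3 := hG y hy
    positivity
  have hb := fun y (hy : 0 < y) => boundary_hasDerivAt_zero hF h' hfa hy
  have hint := integrableOn_Ioc_zero_of_deriv_nonneg (x := x) (fun y hy => hb y hy.1)
    (fun y hy => hnn y hy.1) fun y hy => nonneg_of_monotoneOn_of_tendsto (f := fun x =>
      ps x * green m ψr φr B (fun y => |f y|) x -
        greenFlux m ψr pr φr qr B (fun y => |f y|) x * ψs x) hy.1
      (monotoneOn_of_hasDerivAt_nonneg (convex_Ioc 0 y) (fun z hz => hb z hz.1)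
        fun z hz => hnn z (interior_subset hz).1) (tendsto_boundary_zero hF hrs h' hfa)
  refine Integrable.mono' (hint.const_mul (s - r)⁻¹) ?_ ?_
  · exact ((((green_continuousOn hF hf).mul h'.continuousOn).mul hD.speed_continuous).mono
      fun y hy => hy.1).aestronglyMeasurable measurableSet_Ioc
  · refine (ae_restrict_iff' measurableSet_Ioc).2 (Eventually.of_forall fun y hy => ?_)
    have i1 := h'.pos y hy.1
    have i2 := hD.speed_pos y hy.1
    have i3 := abs_green_le (f := f) hF hy.1
    rw [Real.norm_eq_abs, abs_mul, abs_mul, abs_of_pos i1, abs_of_pos i2,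
      mul_add, inv_mul_cancel_left₀ hsr.ne']
    have i4 : 0 ≤ (s - r)⁻¹ * (|f y| * ψs y * m y) := by positivity
    have i5 : |green m ψr φr B f y| * ψs y * m y ≤
        green m ψr φr B (fun y => |f y|) y * ψs y * m y := by gcongr
    linarith

theorem green_integrableOn_Ioi (hF : FundamentalSystem S m r ψr pr φr qr B) (hrs : r < s)
    (d' : DecreasingPair S m s φs qs) (hf : IsSource m ψr φr f) {x : ℝ} (hx : 0 < x) :
    IntegrableOn (fun y => green m ψr φr B f y * φs y * m y) (Ioi x) := by
  have hD := hF.densities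
  have hfa := hf.abs hD hF.inc hF.dec
  have hsr := sub_pos.2 hrs
  have hG : ∀ y, 0 < y → 0 ≤ green m ψr φr B (fun y => |f y|) y := fun y hy =>
    (abs_nonneg _).trans (abs_green_le (f := f) hF hy)
  have hnn : ∀ y, 0 < y → 0 ≤ (s - r) * (green m ψr φr B (fun y => |f y|) y * φs y * m y) +
      |f y| * φs y * m y := fun y hy => by
    have i1 := d'.pos y hy
    have i2 := hD.speed_pos y hy
    have i3 := hG y hy
    positivity
  have hb := fun y (hy : 0 < y) => boundary_hasDerivAt_atTop hF d' hfa hy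
  have hint := (integrableOn_Ioi_of_deriv_nonpos (x := x) (fun y hy => hb y (hx.trans_le hy))
    (fun y hy => neg_nonpos.2 (hnn y (hx.trans_le hy))) fun y hy => by
      have hy0 : 0 < y := hx.trans_le hy
      exact nonneg_of_antitoneOn_of_tendsto (f := fun x =>
        qs x * green m ψr φr B (fun y => |f y|) x +
          greenFlux m ψr pr φr qr B (fun y => |f y|) x * φs x)
        (antitoneOn_of_hasDerivAt_nonpos (convex_Ici y) (fun z hz => hb z (hy0.trans_le hz))
          fun z hz => neg_nonpos.2 (hnn z (hy0.trans_le (interior_subset hz))))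
        (tendsto_boundary_atTop hF hrs d' hfa)).neg
  refine Integrable.mono' (hint.const_mul (s - r)⁻¹) ?_ ?_
  · exact ((((green_continuousOn hF hf).mul d'.continuousOn).mul hD.speed_continuous).mono
      fun y hy => hx.trans hy).aestronglyMeasurable measurableSet_Ioi
  · refine (ae_restrict_iff' measurableSet_Ioi).2 (Eventually.of_forall fun y hy => ?_)
    have hy0 : 0 < y := hx.trans hy
    have i1 := d'.pos y hy0
    have i2 := hD.speed_pos y hy0
    have i3 := abs_green_le (f := f) hF hy0
    rw [Real.norm_eq_abs, abs_mul, abs_mul, abs_of_pos i1, abs_of_pos i2]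
    simp only [Pi.neg_apply, neg_neg]
    rw [mul_add, inv_mul_cancel_left₀ hsr.ne']
    have i4 : 0 ≤ (s - r)⁻¹ * (|f y| * φs y * m y) := by positivity
    have i5 : |green m ψr φr B f y| * φs y * m y ≤
        green m ψr φr B (fun y => |f y|) y * φs y * m y := by gcongr
    linarith

/-- Green's formula for `∫_0^x (R_r f) ψ_s m dy`. -/
theorem lowerInt_green (hF : FundamentalSystem S m r ψr pr φr qr B) (hrs : r < s)
    (h' : IncreasingPair S m s ψs ps) (hf : IsSource m ψr φr f) {x : ℝ} (hx : 0 < x) :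
    (s - r) * lowerInt m ψs (green m ψr φr B f) x =
      ps x * green m ψr φr B f x - greenFlux m ψr pr φr qr B f x * ψs x - lowerInt m ψs f x := by
  have hi := fun y (hy : 0 < y) => integrableOn_Ioc_of_lt hF.densities hrs hF.inc h'
    hf.continuousOn hf.lower hy
  rw [lowerInt, ← integral_const_mul]
  refine integral_Ioc_zero_of_hasDerivAt (f := fun x => ps x * green m ψr φr B f x -
    greenFlux m ψr pr φr qr B f x * ψs x - lowerInt m ψs f x) hx (fun y hy => ?_) ?_
    ((green_integrableOn_Ioc hF hrs h' hf x).const_mul _)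
  · have h1 : HasDerivAt (lowerInt m ψs f) (f y * ψs y * m y) y := hasDerivAt_integral_Ioc
      ((hf.continuousOn.mul h'.continuousOn).mul hF.densities.speed_continuous) hi hy.1
    exact ((boundary_hasDerivAt_zero hF h' hf hy.1).sub h1).congr_deriv (by ring)
  · simpa using (tendsto_boundary_zero hF hrs h' hf).sub (tendsto_lowerInt hi)

/-- Green's formula for `∫_x^∞ (R_r f) φ_s m dy`. -/
theorem upperInt_green (hF : FundamentalSystem S m r ψr pr φr qr B) (hrs : r < s)
    (d' : DecreasingPair S m s φs qs) (hf : IsSource m ψr φr f) {x : ℝ} (hx : 0 < x) :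
    (s - r) * upperInt m φs (green m ψr φr B f) x =
      qs x * green m ψr φr B f x + greenFlux m ψr pr φr qr B f x * φs x - upperInt m φs f x := by
  have hi := fun y (hy : 0 < y) => integrableOn_Ioi_of_lt hF.densities hrs hF.dec d'
    hf.continuousOn hf.upper hy
  have := integral_Ioi_of_hasDerivAt (x := x) (f := fun x => qs x * green m ψr φr B f x +
    greenFlux m ψr pr φr qr B f x * φs x - upperInt m φs f x)
    (f' := fun y => -((s - r) * (green m ψr φr B f y * φs y * m y))) (fun y hy => ?_) ?_
    ((green_integrableOn_Ioi hF hrs d' hf hx).const_mul _).neg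
  · rw [integral_neg, integral_const_mul] at this
    rw [upperInt]
    linarith
  · have hy0 : 0 < y := hx.trans_le hy
    have h1 : HasDerivAt (upperInt m φs f) (-(f y * φs y * m y)) y := hasDerivAt_integral_Ioi
      ((hf.continuousOn.mul d'.continuousOn).mul hF.densities.speed_continuous) hi hy0
    exact ((boundary_hasDerivAt_atTop hF d' hf hy0).sub h1).congr_deriv (by ring)
  · simpa using (tendsto_boundary_atTop hF hrs d' hf).sub
      tendsto_upperInt

/-! ### Products of fundamental solutions at two rates -/

theorem lowerInt_inc (hD : IsDensityPair S m) (hrs : r < s) (h : IncreasingPair S m r ψr pr)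
    (h' : IncreasingPair S m s ψs ps) {x : ℝ} (hx : 0 < x) :
    (s - r) * lowerInt m ψs ψr x = ψr x * ps x - ψs x * pr x := by
  have hd : ∀ y ∈ Ioc 0 x, HasDerivAt (fun x => ψr x * ps x - ψs x * pr x)
      ((s - r) * (ψr y * ψs y * m y)) y := fun y hy =>
    (h.hasDerivAt_det h' hy.1).congr_deriv (by ring)
  rw [lowerInt, ← integral_const_mul]
  refine integral_Ioc_zero_of_hasDerivAt (f := fun x => ψr x * ps x - ψs x * pr x) hx hd ?_
    (integrableOn_Ioc_zero_of_deriv_nonneg hd (fun y hy => ?_)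
      fun y hy => (h.det_pos hD hrs h' hy.1).le)
  · simpa using (h.tendsto.mul h'.flux_tendsto).sub (h'.tendsto.mul h.flux_tendsto)
  · exact mul_nonneg (sub_pos.2 hrs).le
      (mul_pos (mul_pos (h.pos y hy.1) (h'.pos y hy.1)) (hD.speed_pos y hy.1)).le

theorem lowerInt_dec (hF : FundamentalSystem S m r ψr pr φr qr B) (hrs : r < s)
    (h' : IncreasingPair S m s ψs ps) {x : ℝ} (hx : 0 < x) :
    (s - r) * lowerInt m ψs φr x = φr x * ps x + qr x * ψs x := by
  have hd : ∀ y ∈ Ioc 0 x, HasDerivAt (fun x => φr x * ps x + qr x * ψs x)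
      ((s - r) * (φr y * ψs y * m y)) y := fun y hy =>
    (((hF.dec.hasDerivAt y hy.1).mul (h'.flux_hasDerivAt y hy.1)).add
      ((hF.dec.flux_hasDerivAt y hy.1).mul (h'.hasDerivAt y hy.1))).congr_deriv (by ring)
  rw [lowerInt, ← integral_const_mul]
  refine integral_Ioc_zero_of_hasDerivAt (f := fun x => φr x * ps x + qr x * ψs x) hx hd
    (tendsto_mixed_zero hF.densities hF.rate_pos hrs hF.inc h' hF.dec)
    (integrableOn_Ioc_zero_of_deriv_nonneg hd (fun y hy => ?_) fun y hy => ?_)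
  · exact mul_nonneg (sub_pos.2 hrs).le (mul_pos (mul_pos (hF.dec.pos y hy.1) (h'.pos y hy.1))
      (hF.densities.speed_pos y hy.1)).le
  · exact (add_pos (mul_pos (hF.dec.pos y hy.1) (h'.flux_pos y hy.1))
      (mul_pos (hF.dec.flux_pos y hy.1) (h'.pos y hy.1))).le

theorem upperInt_dec (hD : IsDensityPair S m) (hrs : r < s) (h : DecreasingPair S m r φr qr)
    (h' : DecreasingPair S m s φs qs) {x : ℝ} (hx : 0 < x) :
    (s - r) * upperInt m φs φr x = φr x * qs x - φs x * qr x := by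
  have hd : ∀ y ∈ Ici x, HasDerivAt (fun x => φr x * qs x - φs x * qr x)
      (-((s - r) * (φr y * φs y * m y))) y := fun y hy =>
    (((h.hasDerivAt y (hx.trans_le hy)).mul (h'.flux_hasDerivAt y (hx.trans_le hy))).sub
      ((h'.hasDerivAt y (hx.trans_le hy)).mul
        (h.flux_hasDerivAt y (hx.trans_le hy)))).congr_deriv (by ring)
  have := integral_Ioi_of_hasDerivAt hd ?_ (integrableOn_Ioi_of_deriv_nonpos hd (fun y hy => ?_)
      fun y hy => (h.det_pos hD hrs h' (hx.trans_le hy)).le)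
  · rw [integral_neg, integral_const_mul] at this
    rw [upperInt]
    linarith
  · simpa using (h.tendsto.mul h'.flux_tendsto).sub (h'.tendsto.mul h.flux_tendsto)
  · have hy : 0 < y := hx.trans_le hy
    exact neg_nonpos.2 (mul_nonneg (sub_pos.2 hrs).le
      (mul_pos (mul_pos (h.pos y hy) (h'.pos y hy)) (hD.speed_pos y hy)).le)

theorem upperInt_inc (hF : FundamentalSystem S m r ψr pr φr qr B) (hrs : r < s)
    (d' : DecreasingPair S m s φs qs) {x : ℝ} (hx : 0 < x) :
    (s - r) * upperInt m φs ψr x = ψr x * qs x + pr x * φs x := by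
  have hd : ∀ y ∈ Ici x, HasDerivAt (fun x => ψr x * qs x + pr x * φs x)
      (-((s - r) * (ψr y * φs y * m y))) y := fun y hy =>
    (((hF.inc.hasDerivAt y (hx.trans_le hy)).mul (d'.flux_hasDerivAt y (hx.trans_le hy))).add
      ((hF.inc.flux_hasDerivAt y (hx.trans_le hy)).mul
        (d'.hasDerivAt y (hx.trans_le hy)))).congr_deriv (by ring)
  have := integral_Ioi_of_hasDerivAt hd
    (tendsto_mixed_atTop hF.densities hF.rate_pos hrs hF.dec d' hF.inc)
    (integrableOn_Ioi_of_deriv_nonpos hd (fun y hy => ?_) fun y hy => ?_)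
  · rw [integral_neg, integral_const_mul] at this
    rw [upperInt]
    linarith
  · have hy : 0 < y := hx.trans_le hy
    exact neg_nonpos.2 (mul_nonneg (sub_pos.2 hrs).le
      (mul_pos (mul_pos (hF.inc.pos y hy) (d'.pos y hy)) (hF.densities.speed_pos y hy)).le)
  · have hy : 0 < y := hx.trans_le hy
    exact (add_pos (mul_pos (hF.inc.pos y hy) (d'.flux_pos y hy))
      (mul_pos (hF.inc.flux_pos y hy) (d'.pos y hy))).le

end Resolvent

/-! ### The payoffs `g` and the functionals `H` and `Q` -/

/-- The flux `f' / S'`. -/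
def flux (μ σ f : ℝ → ℝ) (x : ℝ) : ℝ := deriv f x / scaleDensity μ σ x

/-- The flux `-f' / S'` of a decreasing function. -/
def coflux (μ σ f : ℝ → ℝ) (x : ℝ) : ℝ := -(deriv f x / scaleDensity μ σ x)

theorem Kfun_eq (μ σ ψ f : ℝ → ℝ) (s x : ℝ) :
    Kfun μ σ ψ s f x = s * lowerInt (speedDensity μ σ) ψ f x - flux μ σ ψ x * f x := rfl

theorem Lfun_eq (μ σ φ f : ℝ → ℝ) (s x : ℝ) :
    Lfun μ σ φ s f x = s * upperInt (speedDensity μ σ) φ f x - coflux μ σ φ x * f x := by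
  rw [Lfun, upperInt, coflux]
  ring

section Formulas

variable {μ σ ψr φr ψs φs θ g : ℝ → ℝ} {r s B : ℝ}

local notation "𝔖" => scaleDensity μ σ
local notation "𝔪" => speedDensity μ σ

theorem lowerInt_neg_congr {m₁ ψ g₁ f : ℝ → ℝ} (hg : ∀ x, 0 < x → g₁ x = -f x) (x : ℝ) :
    lowerInt m₁ ψ g₁ x = -lowerInt m₁ ψ f x := by
  rw [lowerInt, lowerInt, ← integral_neg]
  refine setIntegral_congr_fun measurableSet_Ioc fun y hy => ?_
  simp only [hg y hy.1]
  ring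

theorem upperInt_neg_congr {m₁ φ g₁ f : ℝ → ℝ} (hg : ∀ x, 0 < x → g₁ x = -f x) {x : ℝ}
    (hx : 0 < x) : upperInt m₁ φ g₁ x = -upperInt m₁ φ f x := by
  rw [upperInt, upperInt, ← integral_neg]
  refine setIntegral_congr_fun measurableSet_Ioi fun y hy => ?_
  simp only [hg y (hx.trans hy)]
  ring

theorem deriv_eq_of_eq_neg_green
    (hF : FundamentalSystem 𝔖 𝔪 r ψr (flux μ σ ψr) φr (coflux μ σ φr) B)
    (hθ : IsSource 𝔪 ψr φr θ) (hg : ∀ x, 0 < x → g x = -green 𝔪 ψr φr B θ x) {x : ℝ}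
    (hx : 0 < x) :
    deriv g x = -(𝔖 x * greenFlux 𝔪 ψr (flux μ σ ψr) φr (coflux μ σ φr) B θ x) := by
  refine ((green_hasDerivAt hF hθ hx).neg.congr_of_eventuallyEq ?_).deriv
  filter_upwards [Ioi_mem_nhds hx] with y hy using hg y hy

/-- Rewriting `H` through `K` and `L` at the two rates removes both the resolvent and its
derivative, and exhibits the Poisson equation as the singular one with a correction. -/
theorem Hfun_inc (hF : FundamentalSystem 𝔖 𝔪 r ψr (flux μ σ ψr) φr (coflux μ σ φr) B)
    (hrs : r < s) (h' : IncreasingPair 𝔖 𝔪 s ψs (flux μ σ ψs)) (hθ : IsSource 𝔪 ψr φr θ)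
    (hg : ∀ x, 0 < x → g x = -green 𝔪 ψr φr B θ x) {x : ℝ} (hx : 0 < x) :
    (s - r) * Hfun μ σ ψs s ψr g x = -Kfun μ σ ψr r θ x +
      flux μ σ ψr x / flux μ σ ψs x * Kfun μ σ ψs s θ x := by
  have hS := (hF.densities.scale_pos x hx).ne'
  have hp := (h'.flux_pos x hx).ne'
  rw [Hfun, (hF.inc.hasDerivAt x hx).deriv, (h'.hasDerivAt x hx).deriv,
    deriv_eq_of_eq_neg_green hF hθ hg hx]
  simp only [Kfun_eq]
  rw [lowerInt_neg_congr hg, hg x hx]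
  -- Green's formula for the three pairs `(R_r θ, ψ_s)`, `(ψ_r, ψ_s)` and `(R_r θ, ψ_r)`; the claim
  -- is a linear combination of them.
  have e1 := lowerInt_green hF hrs h' hθ hx
  have e2 := lowerInt_inc hF.densities hrs hF.inc h' hx
  have e3 := greenFlux_inc (f := θ) hF hx
  set p := flux μ σ ψr x
  set P := flux μ σ ψs x
  set G := green 𝔪 ψr φr B θ x
  set Γ := greenFlux 𝔪 ψr (flux μ σ ψr) φr (coflux μ σ φr) B θ x
  have e4 : (𝔖 x * p * (s * -lowerInt 𝔪 ψs (green 𝔪 ψr φr B θ) x - P * -G) -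
      -(𝔖 x * Γ) * (s * lowerInt 𝔪 ψs ψr x - P * ψr x)) / (𝔖 x * P) =
      (p * (s * -lowerInt 𝔪 ψs (green 𝔪 ψr φr B θ) x - P * -G) +
        Γ * (s * lowerInt 𝔪 ψs ψr x - P * ψr x)) / P := by
    field_simp
    ring
  have e5 : (-(r * lowerInt 𝔪 ψr θ x - p * θ x) + p / P * (s * lowerInt 𝔪 ψs θ x - P * θ x)) * P =
      -(r * lowerInt 𝔪 ψr θ x - p * θ x) * P + p * (s * lowerInt 𝔪 ψs θ x - P * θ x) := by
    field_simp
  rw [e4, mul_div_assoc', div_eq_iff hp, e5]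
  linear_combination (-s * p) * e1 + (s * Γ) * e2 - (r * P) * e3

theorem Hfun_dec (hF : FundamentalSystem 𝔖 𝔪 r ψr (flux μ σ ψr) φr (coflux μ σ φr) B)
    (hrs : r < s) (h' : IncreasingPair 𝔖 𝔪 s ψs (flux μ σ ψs)) (hθ : IsSource 𝔪 ψr φr θ)
    (hg : ∀ x, 0 < x → g x = -green 𝔪 ψr φr B θ x) {x : ℝ} (hx : 0 < x) :
    (s - r) * Hfun μ σ ψs s φr g x = Lfun μ σ φr r θ x -
      coflux μ σ φr x / flux μ σ ψs x * Kfun μ σ ψs s θ x := by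
  have hS := (hF.densities.scale_pos x hx).ne'
  have hp := (h'.flux_pos x hx).ne'
  rw [Hfun, (hF.dec.hasDerivAt x hx).deriv, (h'.hasDerivAt x hx).deriv,
    deriv_eq_of_eq_neg_green hF hθ hg hx]
  simp only [Kfun_eq, Lfun_eq]
  rw [lowerInt_neg_congr hg, hg x hx]
  have e1 := lowerInt_green hF hrs h' hθ hx
  have e2 := lowerInt_dec hF hrs h' hx
  have e3 := greenFlux_dec (f := θ) hF hx
  set q := coflux μ σ φr x
  set P := flux μ σ ψs x
  set G := green 𝔪 ψr φr B θ x
  set Γ := greenFlux 𝔪 ψr (flux μ σ ψr) φr (coflux μ σ φr) B θ x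
  have e4 : (-(𝔖 x * q) * (s * -lowerInt 𝔪 ψs (green 𝔪 ψr φr B θ) x - P * -G) -
      -(𝔖 x * Γ) * (s * lowerInt 𝔪 ψs φr x - P * φr x)) / (𝔖 x * P) =
      (-q * (s * -lowerInt 𝔪 ψs (green 𝔪 ψr φr B θ) x - P * -G) +
        Γ * (s * lowerInt 𝔪 ψs φr x - P * φr x)) / P := by
    field_simp
    ring
  have e5 : (r * upperInt 𝔪 φr θ x - q * θ x - q / P * (s * lowerInt 𝔪 ψs θ x - P * θ x)) * P =
      (r * upperInt 𝔪 φr θ x - q * θ x) * P - q * (s * lowerInt 𝔪 ψs θ x - P * θ x) := by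
    field_simp
  rw [e4, mul_div_assoc', div_eq_iff hp, e5]
  linear_combination (s * q) * e1 + (s * Γ) * e2 + (r * P) * e3

theorem Qfun_inc (hF : FundamentalSystem 𝔖 𝔪 r ψr (flux μ σ ψr) φr (coflux μ σ φr) B)
    (hrs : r < s) (d' : DecreasingPair 𝔖 𝔪 s φs (coflux μ σ φs)) (hθ : IsSource 𝔪 ψr φr θ)
    (hg : ∀ x, 0 < x → g x = -green 𝔪 ψr φr B θ x) {x : ℝ} (hx : 0 < x) :
    (s - r) * Qfun μ σ φs s g ψr x = -Kfun μ σ ψr r θ x +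
      flux μ σ ψr x / coflux μ σ φs x * Lfun μ σ φs s θ x := by
  have hS := (hF.densities.scale_pos x hx).ne'
  have hp := (d'.flux_pos x hx).ne'
  rw [Qfun, (hF.inc.hasDerivAt x hx).deriv, (d'.hasDerivAt x hx).deriv,
    deriv_eq_of_eq_neg_green hF hθ hg hx]
  simp only [Kfun_eq, Lfun_eq]
  rw [upperInt_neg_congr hg hx, hg x hx]
  have e1 := upperInt_green hF hrs d' hθ hx
  have e2 := upperInt_inc hF hrs d' hx
  have e3 := greenFlux_inc (f := θ) hF hx
  set p := flux μ σ ψr x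
  set P := coflux μ σ φs x
  set G := green 𝔪 ψr φr B θ x
  set Γ := greenFlux 𝔪 ψr (flux μ σ ψr) φr (coflux μ σ φr) B θ x
  have e4 : (-(𝔖 x * Γ) * (s * upperInt 𝔪 φs ψr x - P * ψr x) -
      𝔖 x * p * (s * -upperInt 𝔪 φs (green 𝔪 ψr φr B θ) x - P * -G)) / -(𝔖 x * P) =
      (p * (s * -upperInt 𝔪 φs (green 𝔪 ψr φr B θ) x - P * -G) +
        Γ * (s * upperInt 𝔪 φs ψr x - P * ψr x)) / P := by
    field_simp
    ring
  have e5 : (-(r * lowerInt 𝔪 ψr θ x - p * θ x) + p / P * (s * upperInt 𝔪 φs θ x - P * θ x)) * P =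
      -(r * lowerInt 𝔪 ψr θ x - p * θ x) * P + p * (s * upperInt 𝔪 φs θ x - P * θ x) := by
    field_simp
  rw [e4, mul_div_assoc', div_eq_iff hp, e5]
  linear_combination (-s * p) * e1 + (s * Γ) * e2 - (r * P) * e3

theorem Qfun_dec (hF : FundamentalSystem 𝔖 𝔪 r ψr (flux μ σ ψr) φr (coflux μ σ φr) B)
    (hrs : r < s) (d' : DecreasingPair 𝔖 𝔪 s φs (coflux μ σ φs)) (hθ : IsSource 𝔪 ψr φr θ)
    (hg : ∀ x, 0 < x → g x = -green 𝔪 ψr φr B θ x) {x : ℝ} (hx : 0 < x) :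
    (s - r) * Qfun μ σ φs s g φr x = Lfun μ σ φr r θ x -
      coflux μ σ φr x / coflux μ σ φs x * Lfun μ σ φs s θ x := by
  have hS := (hF.densities.scale_pos x hx).ne'
  have hp := (d'.flux_pos x hx).ne'
  rw [Qfun, (hF.dec.hasDerivAt x hx).deriv, (d'.hasDerivAt x hx).deriv,
    deriv_eq_of_eq_neg_green hF hθ hg hx]
  simp only [Lfun_eq]
  rw [upperInt_neg_congr hg hx, hg x hx]
  have e1 := upperInt_green hF hrs d' hθ hx
  have e2 := upperInt_dec hF.densities hrs hF.dec d' hx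
  have e3 := greenFlux_dec (f := θ) hF hx
  set q := coflux μ σ φr x
  set P := coflux μ σ φs x
  set G := green 𝔪 ψr φr B θ x
  set Γ := greenFlux 𝔪 ψr (flux μ σ ψr) φr (coflux μ σ φr) B θ x
  have e4 : (-(𝔖 x * Γ) * (s * upperInt 𝔪 φs φr x - P * φr x) -
      -(𝔖 x * q) * (s * -upperInt 𝔪 φs (green 𝔪 ψr φr B θ) x - P * -G)) / -(𝔖 x * P) =
      (-q * (s * -upperInt 𝔪 φs (green 𝔪 ψr φr B θ) x - P * -G) +
        Γ * (s * upperInt 𝔪 φs φr x - P * φr x)) / P := by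
    field_simp
    ring
  have e5 : (r * upperInt 𝔪 φr θ x - q * θ x - q / P * (s * upperInt 𝔪 φs θ x - P * θ x)) * P =
      (r * upperInt 𝔪 φr θ x - q * θ x) * P - q * (s * upperInt 𝔪 φs θ x - P * θ x) := by
    field_simp
  rw [e4, mul_div_assoc', div_eq_iff hp, e5]
  linear_combination (s * q) * e1 + (s * Γ) * e2 + (r * P) * e3

/-! ### The resolvent of the drift of the discounted state -/

/-- Green's formula for the identity, since `(𝒜 - r) id = μ - r x`. The point is that the boundary
term at `0` vanishes: its limit is `ℓ = lim ψ/S'`, and `ℓ > 0` is excluded by a Gronwall argument.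
-/
theorem lowerInt_drift (hX : IsNaturalDiffusion μ σ)
    (hF : FundamentalSystem 𝔖 𝔪 r ψr (flux μ σ ψr) φr (coflux μ σ φr) B)
    (hη : IsSource 𝔪 ψr φr (fun y => μ y - r * y)) {x : ℝ} (hx : 0 < x) :
    lowerInt 𝔪 ψr (fun y => μ y - r * y) x = ψr x / 𝔖 x - x * flux μ σ ψr x := by
  have hD := hF.densities
  have hd : ∀ y, 0 < y → HasDerivAt (fun y => ψr y / 𝔖 y - y * flux μ σ ψr y)
      ((μ y - r * y) * ψr y * 𝔪 y) y := fun y hy => by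
    have hS := (hD.scale_pos y hy).ne'
    have hσ := (hX.vol_pos y hy).ne'
    refine (((hF.inc.hasDerivAt y hy).div (hasDerivAt_scaleDensity hX hy) hS).sub
      ((hasDerivAt_id y).mul (hF.inc.flux_hasDerivAt y hy))).congr_deriv ?_
    simp only [id, speedDensity]
    field_simp
    ring
  set N : ℝ → ℝ := fun y => ψr y / 𝔖 y - y * flux μ σ ψr y
  have hN : ∀ y, 0 < y → N y = (N 1 - lowerInt 𝔪 ψr (fun y => μ y - r * y) 1) +
      lowerInt 𝔪 ψr (fun y => μ y - r * y) y := fun y hy => by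
    have := eq_of_hasDerivAt_zero (f := fun y => N y - lowerInt 𝔪 ψr (fun y => μ y - r * y) y)
      (fun z hz => ((hd z hz).sub (hη.lowerInt_hasDerivAt hF hz)).congr_deriv (sub_self _))
      hy one_pos
    linarith
  set ℓ := N 1 - lowerInt 𝔪 ψr (fun y => μ y - r * y) 1
  have hid : Tendsto (fun y : ℝ => y) (𝓝[>] 0) (𝓝 0) := tendsto_id.mono_left nhdsWithin_le_nhds
  have hlim : Tendsto (fun y => ψr y / 𝔖 y) (𝓝[>] 0) (𝓝 ℓ) := by
    have h1 := ((tendsto_lowerInt hη.lower).const_add ℓ).add (hid.mul hF.inc.flux_tendsto)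
    rw [add_zero, zero_mul, add_zero] at h1
    refine h1.congr' ?_
    filter_upwards [self_mem_nhdsWithin] with y hy
    rw [← hN y hy]
    simp only [N]
    ring
  have hℓ0 : 0 ≤ ℓ := ge_of_tendsto hlim (by
    filter_upwards [self_mem_nhdsWithin] with y hy
    exact (div_pos (hF.inc.pos y hy) (hD.scale_pos y hy)).le)
  have hℓ : ℓ = 0 := by
    by_contra hne
    have hpos : 0 < ℓ := lt_of_le_of_ne hℓ0 (Ne.symm hne)
    obtain ⟨δ, hδ, hδs⟩ := mem_nhdsGT_iff_exists_Ioo_subset.1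
      (hlim.eventually (lt_mem_nhds (half_lt_self hpos)))
    have hδ : 0 < δ := hδ
    set z := min (δ / 2) 1
    have hz : 0 < z := lt_min (half_pos hδ) one_pos
    -- If `ℓ > 0`, then near `0` one has `S' ≤ (2/ℓ) ψ`, so `ψ' = S' p ≤ C ψ` and `ψ e^{-C y}` is
    -- decreasing. It tends to `0` at `0`, so it cannot be positive.
    set C := 2 / ℓ * flux μ σ ψr 1
    have hmono : MonotoneOn (fun y => -(ψr y * Real.exp (-(C * y)))) (Ioc 0 z) := by
      refine monotoneOn_of_hasDerivAt_nonneg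
        (f' := fun y => (C * ψr y - 𝔖 y * flux μ σ ψr y) * Real.exp (-(C * y))) (convex_Ioc 0 z)
        (fun y hy => ?_) fun y hy => ?_
      · have he : HasDerivAt (fun y => Real.exp (-(C * y))) (Real.exp (-(C * y)) * -(C * 1)) y :=
          ((hasDerivAt_id y).const_mul C).neg.exp
        exact ((hF.inc.hasDerivAt y hy.1).mul he).neg.congr_deriv (by ring)
      · have hy := interior_subset hy
        have hyS := hD.scale_pos y hy.1
        have i1 : ℓ / 2 < ψr y / 𝔖 y := hδs ⟨hy.1, by
          linarith [hy.2.trans (min_le_left _ _)]⟩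
        rw [lt_div_iff₀ hyS] at i1
        have i2 : flux μ σ ψr y ≤ flux μ σ ψr 1 :=
          (hF.inc.flux_strictMonoOn hD hF.rate_pos).monotoneOn hy.1 (mem_Ioi.2 one_pos)
            (hy.2.trans (min_le_right _ _))
        have i3 : 𝔖 y ≤ 2 / ℓ * ψr y := by
          rw [div_mul_eq_mul_div, le_div_iff₀ hpos]
          linarith
        have i4 := mul_le_mul i3 i2 (hF.inc.flux_pos y hy.1).le
          (mul_pos (div_pos two_pos hpos) (hF.inc.pos y hy.1)).le
        refine mul_nonneg (sub_nonneg.2 (i4.trans (le_of_eq ?_))) (Real.exp_pos _).le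
        simp only [C]
        ring
    have h0 : Tendsto (fun y => -(ψr y * Real.exp (-(C * y)))) (𝓝[>] 0) (𝓝 0) := by
      have he : Tendsto (fun y => Real.exp (-(C * y))) (𝓝[>] 0) (𝓝 (Real.exp (-(C * 0)))) :=
        (((hid.const_mul C).neg).rexp)
      simpa using (hF.inc.tendsto.mul he).neg
    have := nonneg_of_monotoneOn_of_tendsto hz hmono h0
    have := mul_pos (hF.inc.pos z hz) (Real.exp_pos (-(C * z)))
    linarith
  have := hN x hx
  rw [hℓ, zero_add] at this
  exact this.symm

theorem upperInt_drift (hX : IsNaturalDiffusion μ σ)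
    (hF : FundamentalSystem 𝔖 𝔪 r ψr (flux μ σ ψr) φr (coflux μ σ φr) B)
    (hη : IsSource 𝔪 ψr φr (fun y => μ y - r * y)) (hid : IsSource 𝔪 ψr φr (fun y => y))
    {x : ℝ} (hx : 0 < x) :
    upperInt 𝔪 φr (fun y => μ y - r * y) x = -(φr x / 𝔖 x + x * coflux μ σ φr x) := by
  have hD := hF.densities
  have hd : ∀ y, 0 < y → HasDerivAt (fun y => φr y / 𝔖 y + y * coflux μ σ φr y)
      ((μ y - r * y) * φr y * 𝔪 y) y := fun y hy => by
    have hS := (hD.scale_pos y hy).ne'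
    have hσ := (hX.vol_pos y hy).ne'
    refine (((hF.dec.hasDerivAt y hy).div (hasDerivAt_scaleDensity hX hy) hS).add
      ((hasDerivAt_id y).mul (hF.dec.flux_hasDerivAt y hy))).congr_deriv ?_
    simp only [id, speedDensity]
    field_simp
    ring
  set N : ℝ → ℝ := fun y => φr y / 𝔖 y + y * coflux μ σ φr y
  have hN : ∀ y, 0 < y → N y = (N 1 + upperInt 𝔪 φr (fun y => μ y - r * y) 1) -
      upperInt 𝔪 φr (fun y => μ y - r * y) y := fun y hy => by
    have := eq_of_hasDerivAt_zero (f := fun y => N y + upperInt 𝔪 φr (fun y => μ y - r * y) y)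
      (fun z hz => ((hd z hz).add (hη.upperInt_hasDerivAt hF hz)).congr_deriv (add_neg_cancel _))
      hy one_pos
    linarith
  set ℓ := N 1 + upperInt 𝔪 φr (fun y => μ y - r * y) 1
  -- Since `q(y) = r ∫_y^∞ φ m`, one has `y q(y) ≤ r ∫_y^∞ z φ(z) m dz`, a tail of a convergent
  -- integral. This is where the identity in `𝓛₁^r` is needed.
  have hxq : Tendsto (fun y => y * coflux μ σ φr y) atTop (𝓝 0) := by
    have h1 : Tendsto (fun y => r * upperInt 𝔪 φr (fun y => y) y) atTop (𝓝 0) := by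
      simpa using (tendsto_upperInt (m := 𝔪) (φ := φr) (f := fun y => y)).const_mul r
    refine squeeze_zero' ?_ ?_ h1
    · filter_upwards [eventually_gt_atTop 0] with y hy
      exact (mul_pos hy (hF.dec.flux_pos y hy)).le
    · filter_upwards [eventually_gt_atTop 0] with y hy
      rw [← hF.dec.integral_Ioi hD hF.rate_pos hy, upperInt, ← integral_const_mul,
        ← integral_const_mul]
      refine setIntegral_mono_on ((hF.dec.integrableOn_Ioi hD hF.rate_pos hy).const_mul _)
        ((hid.upper y hy).const_mul _) measurableSet_Ioi fun z hz => ?_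
      have hz : y < z := hz
      have i1 := hF.rate_pos
      have i2 := hD.speed_pos z (hy.trans hz)
      have i3 := hF.dec.pos z (hy.trans hz)
      calc y * (r * 𝔪 z * φr z) ≤ z * (r * 𝔪 z * φr z) := by gcongr
        _ = _ := by ring
  have hlim : Tendsto (fun y => φr y / 𝔖 y) atTop (𝓝 ℓ) := by
    have h1 := ((tendsto_upperInt (m := 𝔪) (φ := φr)
      (f := fun y => μ y - r * y)).const_sub ℓ).sub hxq
    rw [sub_zero, sub_zero] at h1
    refine h1.congr' ?_
    filter_upwards [eventually_gt_atTop 0] with y hy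
    rw [← hN y hy]
    simp only [N]
    ring
  have hℓ0 : 0 ≤ ℓ := ge_of_tendsto hlim (by
    filter_upwards [eventually_gt_atTop 0] with y hy
    exact (div_pos (hF.dec.pos y hy) (hD.scale_pos y hy)).le)
  have hℓ : ℓ = 0 := by
    by_contra hne
    have hpos : 0 < ℓ := lt_of_le_of_ne hℓ0 (Ne.symm hne)
    obtain ⟨X, hX'⟩ := eventually_atTop.1
      ((hlim.eventually (lt_mem_nhds (half_lt_self hpos))).and (eventually_gt_atTop 0))
    have hX0 : 0 < X := (hX' X le_rfl).2
    -- `T` is a primitive of `(2/ℓ) q` that vanishes at `∞`. If `ℓ > 0`, then `φ' = -S' q ≥ -(2/ℓ) q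
    -- φ` for large `y`, so `φ e^T` is increasing; yet it is positive and tends to `0`.
    set T : ℝ → ℝ := fun y => 2 / ℓ *
      (y * coflux μ σ φr y - r * upperInt 𝔪 φr (fun y => y) y)
    have hT : ∀ y, 0 < y → HasDerivAt T (2 / ℓ * coflux μ σ φr y) y := fun y hy =>
      ((((hasDerivAt_id y).mul (hF.dec.flux_hasDerivAt y hy)).sub
        ((hid.upperInt_hasDerivAt hF hy).const_mul r)).const_mul (2 / ℓ)).congr_deriv (by
          simp only [id]; ring)
    have hanti : AntitoneOn (fun y => -(φr y * Real.exp (T y))) (Ici X) := by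
      refine antitoneOn_of_hasDerivAt_nonpos
        (f' := fun y => (𝔖 y - 2 / ℓ * φr y) * (coflux μ σ φr y * Real.exp (T y)))
        (convex_Ici X) (fun y hy => ?_) fun y hy => ?_
      · have hy0 : 0 < y := hX0.trans_le hy
        exact ((hF.dec.hasDerivAt y hy0).mul (hT y hy0).exp).neg.congr_deriv (by ring)
      · have hy := interior_subset hy
        have hy0 : 0 < y := hX0.trans_le hy
        have i1 := (hX' y hy).1
        rw [lt_div_iff₀ (hD.scale_pos y hy0)] at i1
        have i3 : 𝔖 y ≤ 2 / ℓ * φr y := by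
          rw [div_mul_eq_mul_div, le_div_iff₀ hpos]
          linarith
        exact mul_nonpos_of_nonpos_of_nonneg (sub_nonpos.2 i3)
          (mul_pos (hF.dec.flux_pos y hy0) (Real.exp_pos _)).le
    have h0 : Tendsto (fun y => -(φr y * Real.exp (T y))) atTop (𝓝 0) := by
      have hT0 : Tendsto T atTop (𝓝 (2 / ℓ * (0 - r * 0))) :=
        (hxq.sub (tendsto_upperInt.const_mul r)).const_mul (2 / ℓ)
      simpa using (hF.dec.tendsto.mul hT0.rexp).neg
    have := nonneg_of_antitoneOn_of_tendsto hanti h0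
    have := mul_pos (hF.dec.pos X hX0) (Real.exp_pos (T X))
    linarith
  have := hN x hx
  rw [hℓ, zero_sub] at this
  rw [← neg_eq_iff_eq_neg]
  exact this.symm

/-- `γ x - R_r π = -R_r θ`. -/
theorem gain_eq_neg_green {π : ℝ → ℝ} {γ : ℝ} (hX : IsNaturalDiffusion μ σ)
    (hF : FundamentalSystem 𝔖 𝔪 r ψr (flux μ σ ψr) φr (coflux μ σ φr) B)
    (hη : IsSource 𝔪 ψr φr (fun y => μ y - r * y)) (hid : IsSource 𝔪 ψr φr (fun y => y))
    (hπ : IsSource 𝔪 ψr φr π) {x : ℝ} (hx : 0 < x) :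
    gain μ σ π ψr φr γ x = -green 𝔪 ψr φr B (theta μ π r γ) x := by
  have hw : wronskian μ σ ψr φr x = B := by
    rw [← hF.wronskian_eq x hx, wronskian, flux, coflux]
    ring
  have h1 : lowerInt 𝔪 ψr (theta μ π r γ) x = lowerInt 𝔪 ψr π x +
      γ * lowerInt 𝔪 ψr (fun y => μ y - r * y) x := by
    rw [lowerInt, lowerInt, lowerInt, ← integral_const_mul,
      ← integral_add (hπ.lower x hx) ((hη.lower x hx).const_mul γ)]
    refine integral_congr_ae (Eventually.of_forall fun y => ?_)
    simp only [theta]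
    ring
  have h2 : upperInt 𝔪 φr (theta μ π r γ) x = upperInt 𝔪 φr π x +
      γ * upperInt 𝔪 φr (fun y => μ y - r * y) x := by
    rw [upperInt, upperInt, upperInt, ← integral_const_mul,
      ← integral_add (hπ.upper x hx) ((hη.upper x hx).const_mul γ)]
    refine integral_congr_ae (Eventually.of_forall fun y => ?_)
    simp only [theta]
    ring
  have h3 : ∫ y in Ioc 0 x, ψr y * π y * 𝔪 y = lowerInt 𝔪 ψr π x :=
    integral_congr_ae (Eventually.of_forall fun y => by simp only; ring)
  have h4 : ∫ y in Ioi x, φr y * π y * 𝔪 y = upperInt 𝔪 φr π x :=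
    integral_congr_ae (Eventually.of_forall fun y => by simp only; ring)
  -- In `R_r(μ - r·)` the two terms with `1/S'` cancel, and the remaining ones combine to `-x` times
  -- the Wronskian over `B`.
  have hB : B⁻¹ * (φr x * flux μ σ ψr x + coflux μ σ φr x * ψr x) = 1 := by
    rw [hF.wronskian_eq x hx, inv_mul_cancel₀ hF.wronskian_pos.ne']
  rw [gain, resolvent, hw, h3, h4, green, h1, h2, lowerInt_drift hX hF hη hx,
    upperInt_drift hX hF hη hid hx]
  linear_combination -(γ * x) * hB

end Formulas

/-! ### The singular control problem -/

/-- The two net convenience yields, with the properties that the threshold equations depend on. -/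
structure PayoffPair (m ψ φ θd θu : ℝ → ℝ) (xd xu : ℝ) : Prop where
  source_d : IsSource m ψ φ θd
  source_u : IsSource m ψ φ θu
  peak_d : IsPeak θd xd
  peak_u : IsPeak θu xu
  peak_u_pos : 0 < xu
  peak_lt : xu < xd
  limit_zero_d : ∃ l, Tendsto θd (𝓝[>] 0) (𝓝 l)
  limit_zero_u : ∃ l, Tendsto θu (𝓝[>] 0) (𝓝 l)
  limit_infinity_d : Tendsto θd atTop atBot
  limit_infinity_u : Tendsto θu atTop atBot
  deriv_lt : ∀ x, 0 < x → deriv θu x < deriv θd x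

theorem PayoffPair.peak_d_pos {m ψ φ θd θu : ℝ → ℝ} {xd xu : ℝ}
    (hP : PayoffPair m ψ φ θd θu xd xu) : 0 < xd := hP.peak_u_pos.trans hP.peak_lt

section Singular

variable {S m ψ p φ q θd θu : ℝ → ℝ} {r B xd xu : ℝ}

theorem kFun_d_lt_kFun_u (hF : FundamentalSystem S m r ψ p φ q B)
    (hP : PayoffPair m ψ φ θd θu xd xu) {x : ℝ} (hx : 0 < x) :
    kFun m ψ p r θd x < kFun m ψ p r θu x := by
  obtain ⟨ld, hld⟩ := hP.limit_zero_d
  obtain ⟨lu, hlu⟩ := hP.limit_zero_u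
  exact kFun_lt_kFun hF.densities hF.inc hP.peak_u.differentiable hP.peak_d.differentiable
    hP.source_u.lower hP.source_d.lower hlu hld hP.deriv_lt hx

theorem lFun_u_lt_lFun_d (hF : FundamentalSystem S m r ψ p φ q B)
    (hP : PayoffPair m ψ φ θd θu xd xu) {x : ℝ} (hx : 0 < x) :
    lFun m φ q r θu x < lFun m φ q r θd x :=
  lFun_lt_lFun hF.densities hF.dec hP.peak_u.differentiable hP.peak_d.differentiable
    hP.source_u.upper hP.source_d.upper
    (lFun_tendsto hF.densities hF.rate_pos hF.dec hP.source_u.upper hP.peak_u hP.peak_u_pos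
      hP.limit_infinity_u)
    (lFun_tendsto hF.densities hF.rate_pos hF.dec hP.source_d.upper hP.peak_d hP.peak_d_pos
      hP.limit_infinity_d) hP.deriv_lt hx

theorem kFun_d_lt_of_le (hF : FundamentalSystem S m r ψ p φ q B)
    (hP : PayoffPair m ψ φ θd θu xd xu) {x : ℝ} (hx : x ∈ Ioc 0 xu) :
    kFun m ψ p r θd xd < kFun m ψ p r θu x :=
  calc kFun m ψ p r θd xd < kFun m ψ p r θd xu :=
        kFun_strictAntiOn hF.densities hF.inc hP.source_d.lower hP.peak_d
          ⟨hP.peak_u_pos, hP.peak_lt.le⟩ ⟨hP.peak_d_pos, le_rfl⟩ hP.peak_lt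
    _ < kFun m ψ p r θu xu := kFun_d_lt_kFun_u hF hP hP.peak_u_pos
    _ ≤ kFun m ψ p r θu x :=
        (kFun_strictAntiOn hF.densities hF.inc hP.source_u.lower hP.peak_u).antitoneOn hx
          ⟨hP.peak_u_pos, le_rfl⟩ hx.2

theorem kFun_continuousOn (hF : FundamentalSystem S m r ψ p φ q B) {θ : ℝ → ℝ}
    (hd : DifferentiableOn ℝ θ (Ioi 0)) (hθ : IsSource m ψ φ θ) :
    ContinuousOn (kFun m ψ p r θ) (Ioi 0) := fun _ hx =>
  (kFun_hasDerivAt hF.densities hF.inc hd hθ.lower hx).continuousAt.continuousWithinAt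

theorem lFun_continuousOn (hF : FundamentalSystem S m r ψ p φ q B) {θ : ℝ → ℝ}
    (hd : DifferentiableOn ℝ θ (Ioi 0)) (hθ : IsSource m ψ φ θ) :
    ContinuousOn (lFun m φ q r θ) (Ioi 0) := fun _ hx =>
  (lFun_hasDerivAt hF.densities hF.dec hd hθ.upper hx).continuousAt.continuousWithinAt

/-- `K_{θ_d}` runs continuously from `K_{θ_d}(x_d*)`, which is below `K_{θ_u}(x)`, to eventually
positive values, while `K_{θ_u}(x) < 0`. -/
theorem singular_cover (hF : FundamentalSystem S m r ψ p φ q B)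
    (hP : PayoffPair m ψ φ θd θu xd xu) {x : ℝ} (hx : x ∈ Ioc 0 xu) :
    ∃ y ∈ Ici xd, kFun m ψ p r θd y = kFun m ψ p r θu x := by
  obtain ⟨ld, hld⟩ := hP.limit_zero_d
  obtain ⟨lu, hlu⟩ := hP.limit_zero_u
  obtain ⟨X, hX, hXd⟩ := ((eventually_kFun_pos hF.densities hF.rate_pos hF.inc hP.source_d.lower
    hld hP.peak_d hP.peak_d_pos hP.limit_infinity_d).and (eventually_ge_atTop xd)).exists
  obtain ⟨y, hy, hye⟩ := intermediate_value_Icc hXd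
    ((kFun_continuousOn hF hP.peak_d.differentiable hP.source_d).mono
      fun z hz => hP.peak_d_pos.trans_le hz.1)
    (show kFun m ψ p r θu x ∈ Icc _ _ from ⟨(kFun_d_lt_of_le hF hP hx).le,
      ((kFun_neg hF.densities hF.inc hP.source_u.lower hlu hP.peak_u hx).trans hX).le⟩)
  exact ⟨y, hy.1, hye⟩

theorem flux_ratio_mul_lt (hF : FundamentalSystem S m r ψ p φ q B) {x x₀ : ℝ} (hx : 0 < x)
    (hlt : x < x₀) : q x₀ / p x₀ * p x < q x := by
  have := strictAntiOn_flux_ratio hF.densities hF.rate_pos hF.inc hF.dec hx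
    (mem_Ioi.2 (hx.trans hlt)) hlt
  exact (lt_div_iff₀ (hF.inc.flux_pos x hx)).1 this

theorem flux_ratio_mul_gt (hF : FundamentalSystem S m r ψ p φ q B) {x x₀ : ℝ} (hx₀ : 0 < x₀)
    (hlt : x₀ < x) : q x < q x₀ / p x₀ * p x := by
  have := strictAntiOn_flux_ratio hF.densities hF.rate_pos hF.inc hF.dec hx₀
    (mem_Ioi.2 (hx₀.trans hlt)) hlt
  exact (div_lt_iff₀ (hF.inc.flux_pos x (hx₀.trans hlt))).1 this

/-- The derivative is `-(q - c p) θ_u'` with `c = q(x₀)/p(x₀)`; to the left of `x₀` the decreasing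
ratio `q/p` exceeds `c`, and below the peak `θ_u' > 0`. -/
theorem singular_slope_u (hF : FundamentalSystem S m r ψ p φ q B)
    (hP : PayoffPair m ψ φ θd θu xd xu) {x₀ : ℝ} (hx₀ : xu < x₀) :
    StrictAntiOn (fun x => lFun m φ q r θu x - q x₀ / p x₀ * kFun m ψ p r θu x) (Ioc 0 xu) :=
  strictAntiOn_of_hasDerivAt_neg (f' := fun x => -((q x - q x₀ / p x₀ * p x) * deriv θu x))
    (convex_Ioc 0 xu) (fun x hx =>
      ((lFun_hasDerivAt hF.densities hF.dec hP.peak_u.differentiable hP.source_u.upper hx.1).sub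
        ((kFun_hasDerivAt hF.densities hF.inc hP.peak_u.differentiable hP.source_u.lower
          hx.1).const_mul _)).congr_deriv (by ring)) fun x hx => by
      rw [interior_Ioc] at hx
      exact neg_neg_of_pos (mul_pos (sub_pos.2 (flux_ratio_mul_lt hF hx.1 (hx.2.trans hx₀)))
        (hP.peak_u.deriv_pos x hx.1 hx.2))

theorem singular_slope_d (hF : FundamentalSystem S m r ψ p φ q B)
    (hP : PayoffPair m ψ φ θd θu xd xu) {x₀ : ℝ} (h₀ : 0 < x₀) (hx₀ : x₀ < xd) :
    StrictAntiOn (fun x => lFun m φ q r θd x - q x₀ / p x₀ * kFun m ψ p r θd x) (Ici xd) :=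
  strictAntiOn_of_hasDerivAt_neg (f' := fun x => -((q x - q x₀ / p x₀ * p x) * deriv θd x))
    (convex_Ici xd) (fun x hx =>
      ((lFun_hasDerivAt hF.densities hF.dec hP.peak_d.differentiable hP.source_d.upper
        (hP.peak_d_pos.trans_le hx)).sub
        ((kFun_hasDerivAt hF.densities hF.inc hP.peak_d.differentiable hP.source_d.lower
          (hP.peak_d_pos.trans_le hx)).const_mul _)).congr_deriv (by ring)) fun x hx => by
      rw [interior_Ici] at hx
      exact neg_neg_of_pos (mul_pos_of_neg_of_neg
        (sub_neg.2 (flux_ratio_mul_gt hF h₀ (hx₀.trans hx)))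
        (hP.peak_d.deriv_neg x (hP.peak_d_pos.trans hx) hx))

theorem singular_solution (hF : FundamentalSystem S m r ψ p φ q B)
    (hP : PayoffPair m ψ φ θd θu xd xu) {a b : ℝ} (ha : a ∈ Ioc 0 xu) (hb : b ∈ Ici xd)
    (e₁ : kFun m ψ p r θu a = kFun m ψ p r θd b) (e₂ : lFun m φ q r θu a = lFun m φ q r θd b) :
    IsUniqueSolution (kFun m ψ p r θu) (lFun m φ q r θu) (kFun m ψ p r θd) (lFun m φ q r θd)
        (Ioc 0 xu) (Ici xd) a b ∧
      CompInvWellDefined (kFun m ψ p r θu) (lFun m φ q r θu) (kFun m ψ p r θd) (lFun m φ q r θd)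
        (Ioc 0 xu) (Ici xd) (Ioc 0 a) ∧
      IsSelfMapWithUniqueFixedPoint (compInv (kFun m ψ p r θu) (lFun m φ q r θu)
        (kFun m ψ p r θd) (lFun m φ q r θd) (Ioc 0 xu) (Ici xd)) (Ioc 0 a) a := by
  obtain ⟨x₀, h₁, h₂⟩ := exists_between hP.peak_lt
  have hD := hF.densities
  have hKu := kFun_strictAntiOn hD hF.inc hP.source_u.lower hP.peak_u
  have hKd := kFun_strictMonoOn hD hF.inc hP.source_d.lower hP.peak_d hP.peak_d_pos
  have hLu := lFun_strictAntiOn hD hF.dec hP.source_u.upper hP.peak_u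
  have hLd := lFun_strictMonoOn hD hF.dec hP.source_d.upper hP.peak_d hP.peak_d_pos
  refine uniqueSolution_and_fixedPoint (k₁ := 1) (k₂ := 1) ha.2 hKu hLu
    ((lFun_continuousOn hF hP.peak_u.differentiable hP.source_u).mono fun z hz => hz.1)
    hKd hLd (singular_slope_u hF hP h₁) (singular_slope_d hF hP (hP.peak_u_pos.trans h₁) h₂)
    (fun x hx => singular_cover hF hP ⟨hx.1, hx.2.trans ha.2⟩) (fun x hx y hy hyx => ?_)
    ⟨ha.1, le_rfl⟩ hb e₁ e₂ one_ne_zero one_ne_zero (fun x _ => (one_mul _).symm)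
    (fun x _ => (one_mul _).symm) (fun x _ => (one_mul _).symm) (fun x _ => (one_mul _).symm)
  -- The lower bound needed for the self-map: for `x ≤ a` the partner satisfies `y ≥ b`, so
  -- `L_{θ_d}(y) ≥ L_{θ_d}(b) = L_{θ_u}(a)`. This is why the domain is `(0, a]` and not `(0, x_u*]`.
  rw [e₂]
  refine hLd.monotoneOn hb hy ((hKd.le_iff_le hb hy).1 ?_)
  rw [hyx, ← e₁]
  exact hKu.antitoneOn ⟨hx.1, hx.2.trans ha.2⟩ ha hx.2

/-- At the peak itself `L_{θ_u}(x_u*) < L_{θ_u}(b) < L_{θ_d}(b)`. Strictness leaves room for test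
points between `a` and `x_u*`. -/
theorem singular_lt_peak (hF : FundamentalSystem S m r ψ p φ q B)
    (hP : PayoffPair m ψ φ θd θu xd xu) {a b : ℝ} (ha : a ∈ Ioc 0 xu) (hb : b ∈ Ici xd)
    (e₂ : lFun m φ q r θu a = lFun m φ q r θd b) : a < xu := by
  refine lt_of_le_of_ne ha.2 ?_
  rintro rfl
  have hlt : a < b := hP.peak_lt.trans_le hb
  have h1 := lFun_strictMonoOn hF.densities hF.dec hP.source_u.upper hP.peak_u hP.peak_u_pos
    self_mem_Ici hlt.le hlt
  have h2 := lFun_u_lt_lFun_d hF hP (ha.1.trans hlt)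
  linarith

/-- The partner `z` of `x` gives equality in the first relation and, by the slopes, strict
inequality in the second. Moving slightly to the right of `z` makes the first strict and keeps the
second by continuity. -/
theorem singular_test_left (hF : FundamentalSystem S m r ψ p φ q B)
    (hP : PayoffPair m ψ φ θd θu xd xu) {a b : ℝ} (ha : a ∈ Ioc 0 xu) (hb : b ∈ Ici xd)
    (e₁ : kFun m ψ p r θu a = kFun m ψ p r θd b) (e₂ : lFun m φ q r θu a = lFun m φ q r θd b)
    {x : ℝ} (hx : 0 < x) (hxa : x < a) :
    ∃ y ∈ Ici xd, kFun m ψ p r θu x < kFun m ψ p r θd y ∧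
      lFun m φ q r θd y < lFun m φ q r θu x := by
  obtain ⟨x₀, h₁, h₂⟩ := exists_between hP.peak_lt
  have hD := hF.densities
  have hKu := kFun_strictAntiOn hD hF.inc hP.source_u.lower hP.peak_u
  have hKd := kFun_strictMonoOn hD hF.inc hP.source_d.lower hP.peak_d hP.peak_d_pos
  have hxu : x ∈ Ioc 0 xu := ⟨hx, hxa.le.trans ha.2⟩
  obtain ⟨z, hz, hzx⟩ := singular_cover hF hP hxu
  have i1 := hKu hxu ha hxa
  rw [← hzx, e₁, hKd.lt_iff_lt hb hz] at i1
  have i2 := singular_slope_u hF hP h₁ hxu ha hxa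
  have i3 := singular_slope_d hF hP (hP.peak_u_pos.trans h₁) h₂ hb hz i1
  simp only at i2 i3
  rw [hzx, ← e₂, ← e₁] at i3
  have i4 : lFun m φ q r θd z < lFun m φ q r θu x := by linarith
  have hz0 : 0 < z := hP.peak_d_pos.trans_le hz
  have hev : ∀ᶠ y in 𝓝[>] z, lFun m φ q r θd y < lFun m φ q r θu x :=
    (((lFun_continuousOn hF hP.peak_d.differentiable hP.source_d).continuousAt
      (Ioi_mem_nhds hz0)).eventually (gt_mem_nhds i4)).filter_mono nhdsWithin_le_nhds
  obtain ⟨y, hy, hyz⟩ := (hev.and self_mem_nhdsWithin).exists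
  have hyd : y ∈ Ici xd := le_trans (mem_Ici.1 hz) (le_of_lt hyz)
  exact ⟨y, hyd, hzx ▸ hKd hz hyd hyz, hy⟩

theorem singular_test_right (hF : FundamentalSystem S m r ψ p φ q B)
    (hP : PayoffPair m ψ φ θd θu xd xu) {a b : ℝ} (ha : a ∈ Ioc 0 xu) (hb : b ∈ Ici xd)
    (e₁ : kFun m ψ p r θu a = kFun m ψ p r θd b) (e₂ : lFun m φ q r θu a = lFun m φ q r θd b)
    {x : ℝ} (hxa : a < x) (hxu' : x ≤ xu) :
    ∃ y ∈ Ici xd, kFun m ψ p r θd y < kFun m ψ p r θu x ∧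
      lFun m φ q r θu x < lFun m φ q r θd y := by
  obtain ⟨x₀, h₁, h₂⟩ := exists_between hP.peak_lt
  have hD := hF.densities
  have hKu := kFun_strictAntiOn hD hF.inc hP.source_u.lower hP.peak_u
  have hKd := kFun_strictMonoOn hD hF.inc hP.source_d.lower hP.peak_d hP.peak_d_pos
  have hxu : x ∈ Ioc 0 xu := ⟨ha.1.trans hxa, hxu'⟩
  obtain ⟨z, hz, hzx⟩ := singular_cover hF hP hxu
  have i1 := hKu ha hxu hxa
  rw [← hzx, e₁, hKd.lt_iff_lt hz hb] at i1
  have i2 := singular_slope_u hF hP h₁ ha hxu hxa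
  have i3 := singular_slope_d hF hP (hP.peak_u_pos.trans h₁) h₂ hz hb i1
  simp only at i2 i3
  rw [hzx, ← e₂, ← e₁] at i3
  have i4 : lFun m φ q r θu x < lFun m φ q r θd z := by linarith
  have hz0 : 0 < z := hP.peak_d_pos.trans_le hz
  -- Here the partner must be moved to the left, which needs it to be strictly beyond `x_d*`.
  have hzd : xd < z := by
    refine (hKd.lt_iff_lt self_mem_Ici hz).1 ?_
    rw [hzx]
    exact kFun_d_lt_of_le hF hP hxu
  have hev : ∀ᶠ y in 𝓝[<] z, lFun m φ q r θu x < lFun m φ q r θd y :=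
    (((lFun_continuousOn hF hP.peak_d.differentiable hP.source_d).continuousAt
      (Ioi_mem_nhds hz0)).eventually (lt_mem_nhds i4)).filter_mono nhdsWithin_le_nhds
  obtain ⟨y, hy, hyz⟩ := (hev.and (Ioo_mem_nhdsLT hzd)).exists
  exact ⟨y, hyz.1.le, hzx ▸ hKd hyz.1.le hz hyz.2, hy⟩

end Singular

/-! ### The Poisson control problem -/

/-- Fundamental solutions at the rates `r < s`. -/
structure RatePair (S m : ℝ → ℝ) (r : ℝ) (ψr pr φr qr : ℝ → ℝ) (B s : ℝ)
    (ψs ps φs qs : ℝ → ℝ) : Prop where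
  base : FundamentalSystem S m r ψr pr φr qr B
  lt : r < s
  inc : IncreasingPair S m s ψs ps
  dec : DecreasingPair S m s φs qs

/-- `x̃` and `x̂` are the states at which `K` and `L` change sign, and `x₀` separates them. -/
structure SignChanges (m ψs ps φs qs : ℝ → ℝ) (s : ℝ) (θd θu : ℝ → ℝ) (xd xu x₀ xt xh : ℝ) :
    Prop where
  lt_til : xu < xt
  til_lt : xt < x₀
  lt_hat : x₀ < xh
  hat_lt : xh < xd
  til_zero : kFun m ψs ps s θu xt = 0
  til_neg : ∀ x, 0 < x → x < xt → kFun m ψs ps s θu x < 0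
  hat_zero : lFun m φs qs s θd xh = 0
  hat_neg : ∀ x, xh < x → lFun m φs qs s θd x < 0

section Poisson

variable {S m ψr pr φr qr ψs ps φs qs θd θu : ℝ → ℝ} {r B s xd xu x₀ xt xh : ℝ}

theorem RatePair.lower (hR : RatePair S m r ψr pr φr qr B s ψs ps φs qs) {θ : ℝ → ℝ}
    (hθ : IsSource m ψr φr θ) : ∀ x, 0 < x → IntegrableOn (fun y => θ y * ψs y * m y) (Ioc 0 x) :=
  fun _ hx => integrableOn_Ioc_of_lt hR.base.densities hR.lt hR.base.inc hR.inc hθ.continuousOn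
    hθ.lower hx

theorem RatePair.upper (hR : RatePair S m r ψr pr φr qr B s ψs ps φs qs) {θ : ℝ → ℝ}
    (hθ : IsSource m ψr φr θ) : ∀ x, 0 < x → IntegrableOn (fun y => θ y * φs y * m y) (Ioi x) :=
  fun _ hx => integrableOn_Ioi_of_lt hR.base.densities hR.lt hR.base.dec hR.dec hθ.continuousOn
    hθ.upper hx

/-- The terms `-p_r θ'` and `(p_r/p_s) p_s θ'` cancel, so only `-(p_r/p_s)' K^s` remains and the
sign is that of `K^s`. The next three derivatives behave in the same way. -/
theorem RatePair.h1_hasDerivAt (hR : RatePair S m r ψr pr φr qr B s ψs ps φs qs)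
    {θ : ℝ → ℝ} (hd : DifferentiableOn ℝ θ (Ioi 0)) (hθ : IsSource m ψr φr θ) {x : ℝ}
    (hx : 0 < x) :
    HasDerivAt (fun x => kFun m ψr pr r θ x - pr x / ps x * kFun m ψs ps s θ x)
      (m x * (s * ψs x * pr x - r * ψr x * ps x) / ps x ^ 2 * kFun m ψs ps s θ x) x := by
  have hp := (hR.inc.flux_pos x hx).ne'
  refine ((kFun_hasDerivAt hR.base.densities hR.base.inc hd hθ.lower hx).sub
    (((hR.base.inc.flux_hasDerivAt x hx).div (hR.inc.flux_hasDerivAt x hx) hp).mul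
      (kFun_hasDerivAt hR.base.densities hR.inc hd (hR.lower hθ) hx))).congr_deriv ?_
  simp only [Pi.div_apply]
  field_simp
  ring

theorem RatePair.h2_hasDerivAt (hR : RatePair S m r ψr pr φr qr B s ψs ps φs qs)
    {θ : ℝ → ℝ} (hd : DifferentiableOn ℝ θ (Ioi 0)) (hθ : IsSource m ψr φr θ) {x : ℝ}
    (hx : 0 < x) :
    HasDerivAt (fun x => lFun m φr qr r θ x - qr x / ps x * kFun m ψs ps s θ x)
      (m x * (r * φr x * ps x + s * ψs x * qr x) / ps x ^ 2 * kFun m ψs ps s θ x) x := by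
  have hp := (hR.inc.flux_pos x hx).ne'
  refine ((lFun_hasDerivAt hR.base.densities hR.base.dec hd hθ.upper hx).sub
    (((hR.base.dec.flux_hasDerivAt x hx).div (hR.inc.flux_hasDerivAt x hx) hp).mul
      (kFun_hasDerivAt hR.base.densities hR.inc hd (hR.lower hθ) hx))).congr_deriv ?_
  simp only [Pi.div_apply]
  field_simp
  ring

theorem RatePair.q1_hasDerivAt (hR : RatePair S m r ψr pr φr qr B s ψs ps φs qs)
    {θ : ℝ → ℝ} (hd : DifferentiableOn ℝ θ (Ioi 0)) (hθ : IsSource m ψr φr θ) {x : ℝ}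
    (hx : 0 < x) :
    HasDerivAt (fun x => kFun m ψr pr r θ x - pr x / qs x * lFun m φs qs s θ x)
      (-(m x * (r * ψr x * qs x + s * φs x * pr x) / qs x ^ 2 * lFun m φs qs s θ x)) x := by
  have hp := (hR.dec.flux_pos x hx).ne'
  refine ((kFun_hasDerivAt hR.base.densities hR.base.inc hd hθ.lower hx).sub
    (((hR.base.inc.flux_hasDerivAt x hx).div (hR.dec.flux_hasDerivAt x hx) hp).mul
      (lFun_hasDerivAt hR.base.densities hR.dec hd (hR.upper hθ) hx))).congr_deriv ?_
  simp only [Pi.div_apply]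
  field_simp
  ring

theorem RatePair.q2_hasDerivAt (hR : RatePair S m r ψr pr φr qr B s ψs ps φs qs)
    {θ : ℝ → ℝ} (hd : DifferentiableOn ℝ θ (Ioi 0)) (hθ : IsSource m ψr φr θ) {x : ℝ}
    (hx : 0 < x) :
    HasDerivAt (fun x => lFun m φr qr r θ x - qr x / qs x * lFun m φs qs s θ x)
      (-(m x * (s * φs x * qr x - r * φr x * qs x) / qs x ^ 2 * lFun m φs qs s θ x)) x := by
  have hp := (hR.dec.flux_pos x hx).ne'
  refine ((lFun_hasDerivAt hR.base.densities hR.base.dec hd hθ.upper hx).sub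
    (((hR.base.dec.flux_hasDerivAt x hx).div (hR.dec.flux_hasDerivAt x hx) hp).mul
      (lFun_hasDerivAt hR.base.densities hR.dec hd (hR.upper hθ) hx))).congr_deriv ?_
  simp only [Pi.div_apply]
  field_simp
  ring

/-- The monotonicity of the four functions in the threshold equations. -/
structure OrderedThresholds (h₁ h₂ q₁ q₂ : ℝ → ℝ) (α β c : ℝ) : Prop where
  h1_cont : ContinuousOn h₁ (Ioc 0 α)
  h2_cont : ContinuousOn h₂ (Ioc 0 α)
  q1_cont : ContinuousOn q₁ (Ici β)
  q2_cont : ContinuousOn q₂ (Ici β)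
  h1_anti : StrictAntiOn h₁ (Ioc 0 α)
  h2_anti : StrictAntiOn h₂ (Ioc 0 α)
  q1_mono : StrictMonoOn q₁ (Ici β)
  q2_mono : StrictMonoOn q₂ (Ici β)
  h_slope : StrictAntiOn (fun x => h₂ x - c * h₁ x) (Ioc 0 α)
  q_slope : StrictAntiOn (fun x => q₂ x - c * q₁ x) (Ici β)

theorem orderedThresholds (hR : RatePair S m r ψr pr φr qr B s ψs ps φs qs)
    (hP : PayoffPair m ψr φr θd θu xd xu)
    (hC : SignChanges m ψs ps φs qs s θd θu xd xu x₀ xt xh) :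
    OrderedThresholds (fun x => kFun m ψr pr r θu x - pr x / ps x * kFun m ψs ps s θu x)
      (fun x => lFun m φr qr r θu x - qr x / ps x * kFun m ψs ps s θu x)
      (fun x => kFun m ψr pr r θd x - pr x / qs x * lFun m φs qs s θd x)
      (fun x => lFun m φr qr r θd x - qr x / qs x * lFun m φs qs s θd x)
      xt xh (qr x₀ / pr x₀) := by
  have hD := hR.base.densities
  have hr := hR.base.rate_pos
  have hs := hr.trans hR.lt
  have hx₀ : 0 < x₀ := hP.peak_u_pos.trans (hC.lt_til.trans hC.til_lt)
  have hxh : 0 < xh := hx₀.trans hC.lt_hat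
  have d1 := fun x (hx : x ∈ Ioc 0 xt) =>
    hR.h1_hasDerivAt hP.peak_u.differentiable hP.source_u hx.1
  have d2 := fun x (hx : x ∈ Ioc 0 xt) =>
    hR.h2_hasDerivAt hP.peak_u.differentiable hP.source_u hx.1
  have d3 := fun x (hx : x ∈ Ici xh) =>
    hR.q1_hasDerivAt hP.peak_d.differentiable hP.source_d (hxh.trans_le hx)
  have d4 := fun x (hx : x ∈ Ici xh) =>
    hR.q2_hasDerivAt hP.peak_d.differentiable hP.source_d (hxh.trans_le hx)
  refine ⟨fun x hx => (d1 x hx).continuousAt.continuousWithinAt,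
    fun x hx => (d2 x hx).continuousAt.continuousWithinAt,
    fun x hx => (d3 x hx).continuousAt.continuousWithinAt,
    fun x hx => (d4 x hx).continuousAt.continuousWithinAt,
    strictAntiOn_of_hasDerivAt_neg (convex_Ioc 0 xt) d1 fun x hx => ?_,
    strictAntiOn_of_hasDerivAt_neg (convex_Ioc 0 xt) d2 fun x hx => ?_,
    strictMonoOn_of_hasDerivAt_pos (convex_Ici xh) d3 fun x hx => ?_,
    strictMonoOn_of_hasDerivAt_pos (convex_Ici xh) d4 fun x hx => ?_,
    strictAntiOn_of_hasDerivAt_neg (convex_Ioc 0 xt)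
      (fun x hx => (d2 x hx).sub ((d1 x hx).const_mul _)) fun x hx => ?_,
    strictAntiOn_of_hasDerivAt_neg (convex_Ici xh)
      (fun x hx => (d4 x hx).sub ((d3 x hx).const_mul _)) fun x hx => ?_⟩
  · rw [interior_Ioc] at hx
    have i1 := hR.base.inc.flux_det_pos hD hR.lt hR.inc hx.1
    have i2 := hD.speed_pos x hx.1
    have i3 := hR.inc.flux_pos x hx.1
    exact mul_neg_of_pos_of_neg (by positivity) (hC.til_neg x hx.1 hx.2)
  · rw [interior_Ioc] at hx
    have i1 := hR.base.dec.pos x hx.1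
    have i2 := hD.speed_pos x hx.1
    have i3 := hR.inc.flux_pos x hx.1
    have i4 := hR.inc.pos x hx.1
    have i5 := hR.base.dec.flux_pos x hx.1
    exact mul_neg_of_pos_of_neg (by positivity) (hC.til_neg x hx.1 hx.2)
  · rw [interior_Ici] at hx
    have hx0 : 0 < x := hxh.trans hx
    have i1 := hR.base.inc.pos x hx0
    have i2 := hD.speed_pos x hx0
    have i3 := hR.dec.flux_pos x hx0
    have i4 := hR.dec.pos x hx0
    have i5 := hR.base.inc.flux_pos x hx0
    exact neg_pos.2 (mul_neg_of_pos_of_neg (by positivity) (hC.hat_neg x hx))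
  · rw [interior_Ici] at hx
    have hx0 : 0 < x := hxh.trans hx
    have i1 := hR.base.dec.flux_det_pos hD hR.lt hR.dec hx0
    have i2 := hD.speed_pos x hx0
    have i3 := hR.dec.flux_pos x hx0
    exact neg_pos.2 (mul_neg_of_pos_of_neg (by positivity) (hC.hat_neg x hx))
  · rw [interior_Ioc] at hx
    have i1 := hR.base.inc.flux_det_pos hD hR.lt hR.inc hx.1
    have i2 := hD.speed_pos x hx.1
    have i3 := hR.inc.flux_pos x hx.1
    have i4 := hR.base.inc.flux_pos x hx.1
    have i5 := flux_ratio_mul_lt hR.base hx.1 (hx.2.trans hC.til_lt)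
    set c := qr x₀ / pr x₀
    set D := s * ψs x * pr x - r * ψr x * ps x with hDdef
    set N := r * φr x * ps x + s * ψs x * qr x with hNdef
    -- The slope of the corrected curve is `N/D`. The Wronskian shows that it exceeds the singular
    -- slope `q_r/p_r`, which exceeds `c` to the left of `x₀`.
    have e1 : N * pr x - qr x * D = r * ps x * B := by
      rw [hDdef, hNdef, ← hR.base.wronskian_eq x hx.1]
      ring
    have i6 : 0 < r * ps x * B := mul_pos (mul_pos hr i3) hR.base.wronskian_pos
    have i7 : c * pr x * D < qr x * D := mul_lt_mul_of_pos_right i5 i1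
    have i8 : c * D < N := by
      refine lt_of_mul_lt_mul_right (a := pr x) ?_ i4.le
      nlinarith
    have e2 : m x * N / ps x ^ 2 * kFun m ψs ps s θu x -
        c * (m x * D / ps x ^ 2 * kFun m ψs ps s θu x) =
        m x * (N - c * D) / ps x ^ 2 * kFun m ψs ps s θu x := by ring
    rw [e2]
    have i9 := sub_pos.2 i8
    exact mul_neg_of_pos_of_neg (by positivity) (hC.til_neg x hx.1 hx.2)
  · rw [interior_Ici] at hx
    have hx0 : 0 < x := hxh.trans hx
    have i2 := hD.speed_pos x hx0
    have i3 := hR.dec.flux_pos x hx0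
    have i4 := hR.base.inc.flux_pos x hx0
    have i5 := flux_ratio_mul_gt hR.base hx₀ (hC.lt_hat.trans hx)
    set c := qr x₀ / pr x₀
    have i1 : 0 < r * ψr x * qs x + s * φs x * pr x := by
      have j1 := hR.base.inc.pos x hx0
      have j2 := hR.dec.pos x hx0
      positivity
    set D := r * ψr x * qs x + s * φs x * pr x with hDdef
    set E := s * φs x * qr x - r * φr x * qs x with hEdef
    -- Here the slope is `E/D`. It lies below `q_r/p_r`, which lies below `c` to the right of `x₀`.
    have e1 : qr x * D - E * pr x = r * qs x * B := by
      rw [hDdef, hEdef, ← hR.base.wronskian_eq x hx0]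
      ring
    have i6 : 0 < r * qs x * B := mul_pos (mul_pos hr i3) hR.base.wronskian_pos
    have i7 : qr x * D < c * pr x * D := mul_lt_mul_of_pos_right i5 i1
    have i8 : E < c * D := by
      refine lt_of_mul_lt_mul_right (a := pr x) ?_ i4.le
      nlinarith
    have e2 : -(m x * E / qs x ^ 2 * lFun m φs qs s θd x) -
        c * -(m x * D / qs x ^ 2 * lFun m φs qs s θd x) =
        m x * (c * D - E) / qs x ^ 2 * lFun m φs qs s θd x := by ring
    rw [e2]
    have i9 := sub_pos.2 i8
    exact mul_neg_of_pos_of_neg (by positivity) (hC.hat_neg x hx)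

/-- The right-hand side is at most `0` by `kFun_ratio_le` and monotonicity, and the left-hand side
is eventually positive. At `x̃` and `x̂` the corrections vanish, and there `K_{θ_d}(x̂) <
K_{θ_d}(x̃) < K_{θ_u}(x̃)`, as `x̃ < x̂ < x_d*`. -/
theorem poisson_cover (hR : RatePair S m r ψr pr φr qr B s ψs ps φs qs)
    (hP : PayoffPair m ψr φr θd θu xd xu)
    (hC : SignChanges m ψs ps φs qs s θd θu xd xu x₀ xt xh) {x : ℝ} (hx : x ∈ Ioc 0 xt) :
    ∃ y ∈ Ici xh, kFun m ψr pr r θd y - pr y / qs y * lFun m φs qs s θd y =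
      kFun m ψr pr r θu x - pr x / ps x * kFun m ψs ps s θu x := by
  obtain ⟨ld, hld⟩ := hP.limit_zero_d
  obtain ⟨lu, hlu⟩ := hP.limit_zero_u
  have hO := orderedThresholds hR hP hC
  have hD := hR.base.densities
  have hxt : 0 < xt := hP.peak_u_pos.trans hC.lt_til
  have hth : xt < xh := hC.til_lt.trans hC.lt_hat
  obtain ⟨X, hX, hXh⟩ := ((eventually_kFun_pos hD hR.base.rate_pos hR.base.inc hP.source_d.lower
    hld hP.peak_d hP.peak_d_pos hP.limit_infinity_d).and (eventually_gt_atTop xh)).exists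
  have hX0 : 0 < X := hxt.trans (hth.trans hXh)
  have hle : ∀ z ∈ Ioc 0 xu, kFun m ψr pr r θu z - pr z / ps z * kFun m ψs ps s θu z ≤ 0 := by
    intro z hz
    have h1 := kFun_ratio_le hD hR.lt hR.base.inc hR.inc hP.source_u.lower hlu hP.peak_u hz
    have h2 := hR.base.inc.flux_pos z hz.1
    have h3 := hR.inc.flux_pos z hz.1
    have h4 := mul_le_mul_of_nonneg_left h1 (div_pos h2 h3).le
    have h5 : pr z / ps z * (ps z / pr z * kFun m ψr pr r θu z) = kFun m ψr pr r θu z := by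
      field_simp
    linarith
  have hneg : kFun m ψr pr r θu x - pr x / ps x * kFun m ψs ps s θu x ≤ 0 := by
    rcases le_total x xu with h | h
    · exact hle x ⟨hx.1, h⟩
    · exact (hO.h1_anti.antitoneOn ⟨hP.peak_u_pos, hC.lt_til.le⟩ hx h).trans
        (hle xu ⟨hP.peak_u_pos, le_rfl⟩)
  have hpos : 0 ≤ kFun m ψr pr r θd X - pr X / qs X * lFun m φs qs s θd X := by
    have h2 := hR.base.inc.flux_pos X hX0
    have h3 := hR.dec.flux_pos X hX0
    have := mul_neg_of_pos_of_neg (div_pos h2 h3) (hC.hat_neg X hXh)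
    linarith
  have hlow : kFun m ψr pr r θd xh - pr xh / qs xh * lFun m φs qs s θd xh ≤
      kFun m ψr pr r θu x - pr x / ps x * kFun m ψs ps s θu x := by
    have h1 := hO.h1_anti.antitoneOn hx ⟨hxt, le_rfl⟩ hx.2
    rw [hC.til_zero, mul_zero, sub_zero] at h1
    rw [hC.hat_zero, mul_zero, sub_zero]
    have h2 := kFun_d_lt_kFun_u hR.base hP hxt
    have h3 := kFun_strictAntiOn hD hR.base.inc hP.source_d.lower hP.peak_d
      ⟨hxt, (hth.trans hC.hat_lt).le⟩ ⟨hxt.trans hth, hC.hat_lt.le⟩ hth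
    linarith
  obtain ⟨y, hy, hye⟩ := intermediate_value_Icc hXh.le (hO.q1_cont.mono fun z hz => hz.1)
    (show _ ∈ Icc _ _ from ⟨hlow, hneg.trans hpos⟩)
  exact ⟨y, hy.1, hye⟩

/-- At `x̃` the correction vanishes and for `y ≥ x̂` it has a favourable sign, so `L_{θ_u}(x̃) <
L_{θ_u}(y) < L_{θ_d}(y)` suffices. -/
theorem poisson_low (hR : RatePair S m r ψr pr φr qr B s ψs ps φs qs)
    (hP : PayoffPair m ψr φr θd θu xd xu)
    (hC : SignChanges m ψs ps φs qs s θd θu xd xu x₀ xt xh) {y : ℝ} (hy : y ∈ Ici xh) :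
    lFun m φr qr r θu xt - qr xt / ps xt * kFun m ψs ps s θu xt ≤
      lFun m φr qr r θd y - qr y / qs y * lFun m φs qs s θd y := by
  have hxt : 0 < xt := hP.peak_u_pos.trans hC.lt_til
  have hty : xt < y := (hC.til_lt.trans hC.lt_hat).trans_le hy
  have hy0 := hxt.trans hty
  rw [hC.til_zero, mul_zero, sub_zero]
  have h1 : lFun m φs qs s θd y ≤ 0 := by
    rcases eq_or_lt_of_le (mem_Ici.1 hy) with h | h
    · rw [← h, hC.hat_zero]
    · exact (hC.hat_neg y h).le
  have h2 := mul_nonpos_of_nonneg_of_nonpos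
    (div_pos (hR.base.dec.flux_pos y hy0) (hR.dec.flux_pos y hy0)).le h1
  have h3 := lFun_u_lt_lFun_d hR.base hP hy0
  have h4 := lFun_strictMonoOn hR.base.densities hR.base.dec hP.source_u.upper hP.peak_u
    hP.peak_u_pos hC.lt_til.le (hC.lt_til.trans hty).le hty
  linarith

/-- The test point `(x, y)` supplies the sign of the second equation at the left end `x`, and
`poisson_low` the opposite sign at `x̃`. -/
theorem poisson_exists_solution (hR : RatePair S m r ψr pr φr qr B s ψs ps φs qs)
    (hP : PayoffPair m ψr φr θd θu xd xu)
    (hC : SignChanges m ψs ps φs qs s θd θu xd xu x₀ xt xh) {x y : ℝ} (hx : x ∈ Ioc 0 xt)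
    (hy : y ∈ Ici xh)
    (t₁ : kFun m ψr pr r θu x - pr x / ps x * kFun m ψs ps s θu x <
      kFun m ψr pr r θd y - pr y / qs y * lFun m φs qs s θd y)
    (t₂ : lFun m φr qr r θd y - qr y / qs y * lFun m φs qs s θd y <
      lFun m φr qr r θu x - qr x / ps x * kFun m ψs ps s θu x) :
    ∃ a ∈ Ioc 0 xt, ∃ b ∈ Ici xh,
      kFun m ψr pr r θu a - pr a / ps a * kFun m ψs ps s θu a =
        kFun m ψr pr r θd b - pr b / qs b * lFun m φs qs s θd b ∧
      lFun m φr qr r θu a - qr a / ps a * kFun m ψs ps s θu a =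
        lFun m φr qr r θd b - qr b / qs b * lFun m φs qs s θd b := by
  have hO := orderedThresholds hR hP hC
  have hsub : Icc x xt ⊆ Ioc 0 xt := fun z hz => ⟨hx.1.trans_le hz.1, hz.2⟩
  obtain ⟨a, ha, b, hb, e⟩ := exists_solution hx.2 (hO.h1_anti.mono hsub) (hO.h1_cont.mono hsub)
    (hO.h2_cont.mono hsub) hO.q1_mono hO.q1_cont hO.q2_cont
    (fun z hz => poisson_cover hR hP hC (hsub hz))
    (fun z hz hzx => ((hO.q2_mono hz hy ((hO.q1_mono.lt_iff_lt hz hy).1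
      (hzx.trans_lt t₁))).trans t₂).le) (fun z hz _ => poisson_low hR hP hC hz)
  exact ⟨a, hsub ha, b, hb, e⟩

end Poisson

/-! ### Existence of the sign changes for large signal rates -/

section SignChange

variable {S m θ ψs ps φs qs : ℝ → ℝ} {s l x₀ x : ℝ}

theorem exists_signChange_kFun (hD : IsDensityPair S m) (h : IncreasingPair S m s ψs ps)
    (hi : ∀ x, 0 < x → IntegrableOn (fun y => θ y * ψs y * m y) (Ioc 0 x))
    (hl : Tendsto θ (𝓝[>] 0) (𝓝 l)) (hθ : IsPeak θ x₀) (h0 : 0 < x₀) (hx : x₀ < x)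
    (hpos : 0 < kFun m ψs ps s θ x) :
    ∃ z, x₀ < z ∧ z < x ∧ kFun m ψs ps s θ z = 0 ∧
      (∀ y, 0 < y → y < z → kFun m ψs ps s θ y < 0) ∧
      ∀ y, z < y → 0 < kFun m ψs ps s θ y := by
  have hmono := kFun_strictMonoOn hD h hi hθ h0
  have hneg : ∀ y ∈ Ioc 0 x₀, kFun m ψs ps s θ y < 0 := fun y hy => kFun_neg hD h hi hl hθ hy
  obtain ⟨z, hz, hz0⟩ := intermediate_value_Ioo hx.le (f := kFun m ψs ps s θ)
    (fun y hy => (kFun_hasDerivAt hD h hθ.differentiable hi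
      (h0.trans_le hy.1)).continuousAt.continuousWithinAt)
    (show (0 : ℝ) ∈ Ioo _ _ from ⟨hneg x₀ ⟨h0, le_rfl⟩, hpos⟩)
  refine ⟨z, hz.1, hz.2, hz0, fun y hy hyz => ?_, fun y hy => ?_⟩
  · rcases le_total y x₀ with h' | h'
    · exact hneg y ⟨hy, h'⟩
    · exact hz0 ▸ hmono h' hz.1.le hyz
  · exact hz0 ▸ hmono hz.1.le (hz.1.trans hy).le hy

theorem exists_signChange_lFun (hD : IsDensityPair S m) (hs : 0 < s)
    (h : DecreasingPair S m s φs qs)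
    (hi : ∀ x, 0 < x → IntegrableOn (fun y => θ y * φs y * m y) (Ioi x))
    (hθ : IsPeak θ x₀) (hlim : Tendsto θ atTop atBot) (hx0 : 0 < x) (hx : x < x₀)
    (hpos : 0 < lFun m φs qs s θ x) :
    ∃ z, x < z ∧ z < x₀ ∧ lFun m φs qs s θ z = 0 ∧
      (∀ y, 0 < y → y < z → 0 < lFun m φs qs s θ y) ∧
      ∀ y, z < y → lFun m φs qs s θ y < 0 := by
  have hanti := lFun_strictAntiOn hD h hi hθ
  have hneg : ∀ y, x₀ ≤ y → lFun m φs qs s θ y < 0 := fun y hy =>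
    lFun_neg hD hs h hi hθ (hx0.trans hx) hlim hy
  obtain ⟨z, hz, hz0⟩ := intermediate_value_Ioo' hx.le (f := lFun m φs qs s θ)
    (fun y hy => (lFun_hasDerivAt hD h hθ.differentiable hi
      (hx0.trans_le hy.1)).continuousAt.continuousWithinAt)
    (show (0 : ℝ) ∈ Ioo _ _ from ⟨hneg x₀ le_rfl, hpos⟩)
  have hzp := hx0.trans hz.1
  refine ⟨z, hz.1, hz.2, hz0, fun y hy hyz => ?_, fun y hy => ?_⟩
  · exact hz0 ▸ hanti ⟨hy, (hyz.trans hz.2).le⟩ ⟨hzp, hz.2.le⟩ hyz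
  · rcases le_total y x₀ with h' | h'
    · exact hz0 ▸ hanti ⟨hzp, hz.2.le⟩ ⟨hzp.trans hy, h'⟩ hy
    · exact hneg y h'

end SignChange

/-! ### Families of fundamental solutions -/

/-- Fundamental solutions at all rates. -/
structure RateFamily (S m : ℝ → ℝ) (r : ℝ) (ψ p φ q : ℝ → ℝ → ℝ) (B : ℝ) : Prop where
  base : FundamentalSystem S m r (ψ r) (p r) (φ r) (q r) B
  inc : ∀ s, 0 < s → IncreasingPair S m s (ψ s) (p s)
  dec : ∀ s, 0 < s → DecreasingPair S m s (φ s) (q s)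

section RateFamily

variable {S m θd θu : ℝ → ℝ} {ψ p φ q : ℝ → ℝ → ℝ} {r B s xd xu x₀ xt xh : ℝ}

theorem RateFamily.pair (hW : RateFamily S m r ψ p φ q B) (hrs : r < s) :
    RatePair S m r (ψ r) (p r) (φ r) (q r) B s (ψ s) (p s) (φ s) (q s) :=
  ⟨hW.base, hrs, hW.inc s (hW.base.rate_pos.trans hrs), hW.dec s (hW.base.rate_pos.trans hrs)⟩

theorem RateFamily.tendsto_kFun (hW : RateFamily S m r ψ p φ q B)
    (hP : PayoffPair m (ψ r) (φ r) θd θu xd xu) {x : ℝ} (hx : x ∈ Ioc 0 xu) (c d : ℝ) :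
    Tendsto (fun s => c - d / p s x * kFun m (ψ s) (p s) s θu x) atTop (𝓝 c) := by
  obtain ⟨l, hl⟩ := hP.limit_zero_u
  have := ((tendsto_kFun_div hW.base.densities hW.base.rate_pos hW.inc hP.source_u.lower hl
    hP.peak_u hx).const_mul d).const_sub c
  rw [mul_zero, sub_zero] at this
  exact this.congr fun s => by ring

theorem RateFamily.tendsto_lFun (hW : RateFamily S m r ψ p φ q B)
    (hP : PayoffPair m (ψ r) (φ r) θd θu xd xu) {x : ℝ} (hx : x ∈ Ici xd) (c d : ℝ) :
    Tendsto (fun s => c - d / q s x * lFun m (φ s) (q s) s θd x) atTop (𝓝 c) := by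
  have := ((tendsto_lFun_div hW.base.densities hW.base.rate_pos hW.dec hP.source_d.upper
    hP.peak_d hP.peak_d_pos hP.limit_infinity_d hx).const_mul d).const_sub c
  rw [mul_zero, sub_zero] at this
  exact this.congr fun s => by ring

/-- Any zeros with the given signs are located: `K^s_{θ_u} < 0` up to its peak and `K^s_{θ_u}(x₀) >
0` place `x̃` in `(x_u*, x₀)`, and similarly `x̂` lies in `(x₀, x_d*)`. -/
theorem RatePair.signChanges {ψr pr φr qr ψs ps φs qs : ℝ → ℝ}
    (hR : RatePair S m r ψr pr φr qr B s ψs ps φs qs)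
    (hP : PayoffPair m ψr φr θd θu xd xu) (h₀ : 0 < x₀)
    (hK : 0 < kFun m ψs ps s θu x₀) (hL : 0 < lFun m φs qs s θd x₀)
    (t₀ : 0 < xt) (t₁ : kFun m ψs ps s θu xt = 0)
    (t₂ : ∀ x, 0 < x → x < xt → kFun m ψs ps s θu x < 0)
    (u₁ : lFun m φs qs s θd xh = 0) (u₃ : ∀ x, xh < x → lFun m φs qs s θd x < 0) :
    SignChanges m ψs ps φs qs s θd θu xd xu x₀ xt xh := by
  obtain ⟨l, hl⟩ := hP.limit_zero_u
  have hD := hR.base.densities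
  have hs := hR.base.rate_pos.trans hR.lt
  refine ⟨?_, ?_, ?_, ?_, t₁, t₂, u₁, u₃⟩
  · by_contra! h
    exact (kFun_neg hD hR.inc (hR.lower hP.source_u) hl hP.peak_u ⟨t₀, h⟩).ne t₁
  · by_contra! h
    rcases eq_or_lt_of_le h with rfl | h
    · exact hK.ne' t₁
    · exact (t₂ x₀ h₀ h).not_gt hK
  · by_contra! h
    rcases eq_or_lt_of_le h with rfl | h
    · exact hL.ne' u₁
    · exact (u₃ x₀ h).not_gt hL
  · by_contra! h
    exact (lFun_neg hD hs hR.dec (hR.upper hP.source_d) hP.peak_d hP.peak_d_pos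
      hP.limit_infinity_d h).ne u₁

end RateFamily

/-! ### The threshold equations of the Poisson control problem -/

/-- The assertions on the threshold equations at the rate `s = r + λ`. -/
structure PoissonThresholds (μ σ ψs φs : ℝ → ℝ) (s : ℝ) (ψr φr θd θu gd gu : ℝ → ℝ)
    (xh xt a b : ℝ) : Prop where
  sign_l : IsSignChangeL μ σ φs s θd xh
  sign_k : IsSignChangeK μ σ ψs s θu xt
  wellDefined : CompInvWellDefined (Hfun μ σ ψs s ψr gu) (Hfun μ σ ψs s φr gu)
    (Qfun μ σ φs s gd ψr) (Qfun μ σ φs s gd φr) (Ioc 0 xt) (Ici xh) (Ioc 0 xt)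
  fixedPoint : IsSelfMapWithUniqueFixedPoint (compInv (Hfun μ σ ψs s ψr gu)
    (Hfun μ σ ψs s φr gu) (Qfun μ σ φs s gd ψr) (Qfun μ σ φs s gd φr) (Ioc 0 xt) (Ici xh))
    (Ioc 0 xt) a
  unique : IsUniqueSolution (Hfun μ σ ψs s ψr gu) (Hfun μ σ ψs s φr gu)
    (Qfun μ σ φs s gd ψr) (Qfun μ σ φs s gd φr) (Ioc 0 xt) (Ici xh) a b

theorem Kfun_eq_kFun (μ σ ψ f : ℝ → ℝ) (s : ℝ) :
    Kfun μ σ ψ s f = kFun (speedDensity μ σ) ψ (flux μ σ ψ) s f := rfl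

theorem Lfun_eq_lFun (μ σ φ f : ℝ → ℝ) (s : ℝ) :
    Lfun μ σ φ s f = lFun (speedDensity μ σ) φ (coflux μ σ φ) s f :=
  funext fun x => Lfun_eq μ σ φ f s x

section PoissonThresholds

variable {μ σ θd θu gd gu : ℝ → ℝ} {ψ φ : ℝ → ℝ → ℝ} {r B xd xu : ℝ}

local notation "𝔖" => scaleDensity μ σ
local notation "𝔪" => speedDensity μ σ
local notation "𝔭" => fun s => flux μ σ (ψ s)
local notation "𝔮" => fun s => coflux μ σ (φ s)

/-- One test point with strict singular inequalities is enough for existence. The corrections tend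
to `0` at `x` and at `y`, so the inequalities hold for the Poisson curves at all large rates. -/
theorem eventually_poissonThresholds (hW : RateFamily 𝔖 𝔪 r ψ 𝔭 φ 𝔮 B)
    (hP : PayoffPair 𝔪 (ψ r) (φ r) θd θu xd xu)
    (hgd : ∀ x, 0 < x → gd x = -green 𝔪 (ψ r) (φ r) B θd x)
    (hgu : ∀ x, 0 < x → gu x = -green 𝔪 (ψ r) (φ r) B θu x) {x y : ℝ} (hx : x ∈ Ioc 0 xu)
    (hy : y ∈ Ici xd) (t₁ : Kfun μ σ (ψ r) r θu x < Kfun μ σ (ψ r) r θd y)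
    (t₂ : Lfun μ σ (φ r) r θd y < Lfun μ σ (φ r) r θu x) :
    ∀ᶠ s in atTop, ∃ xh xt a b, PoissonThresholds μ σ (ψ s) (φ s) s (ψ r) (φ r) θd θu gd gu
      xh xt a b := by
  obtain ⟨x₀, h₁, h₂⟩ := exists_between hP.peak_lt
  have hx₀ := hP.peak_u_pos.trans h₁
  have hD := hW.base.densities
  have hr := hW.base.rate_pos
  obtain ⟨l, hl⟩ := hP.limit_zero_u
  rw [Kfun_eq_kFun, Kfun_eq_kFun] at t₁
  rw [Lfun_eq_lFun, Lfun_eq_lFun] at t₂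
  filter_upwards [eventually_gt_atTop r,
    eventually_kFun_pos_rate hD hr hW.inc hP.source_u.lower hl hP.peak_u hP.peak_u_pos h₁,
    eventually_lFun_pos_rate hD hr hW.dec hP.source_d.upper hP.peak_d hP.limit_infinity_d hx₀ h₂,
    (hW.tendsto_kFun hP hx _ (flux μ σ (ψ r) x)).eventually_lt
      (hW.tendsto_lFun hP hy _ (flux μ σ (ψ r) y)) t₁,
    (hW.tendsto_lFun hP hy _ (coflux μ σ (φ r) y)).eventually_lt
      (hW.tendsto_kFun hP hx _ (coflux μ σ (φ r) x)) t₂] with s hrs hK hL i₁ i₂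
  have hR := hW.pair hrs
  have hs := hr.trans hrs
  obtain ⟨xt, k₁, -, k₂, k₃, k₄⟩ := exists_signChange_kFun hD hR.inc (hR.lower hP.source_u) hl
    hP.peak_u hP.peak_u_pos h₁ hK
  obtain ⟨xh, l₁, -, l₂, l₃, l₄⟩ := exists_signChange_lFun hD hs hR.dec (hR.upper hP.source_d)
    hP.peak_d hP.limit_infinity_d hx₀ h₂ hL
  have hxt := hP.peak_u_pos.trans k₁
  have hxh := hx₀.trans l₁
  have hC := hR.signChanges hP hx₀ hK hL hxt k₂ k₃ l₂ l₄
  have hO := orderedThresholds hR hP hC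
  obtain ⟨a, ha, b, hb, e₁, e₂⟩ := poisson_exists_solution hR hP hC ⟨hx.1, hx.2.trans k₁.le⟩
    (hC.hat_lt.le.trans hy) i₁ i₂
  have hl0 : s - r ≠ 0 := (sub_pos.2 hrs).ne'
  obtain ⟨c₁, c₂, c₃⟩ := uniqueSolution_and_fixedPoint le_rfl hO.h1_anti hO.h2_anti hO.h2_cont
    hO.q1_mono hO.q2_mono hO.h_slope hO.q_slope (fun z hz => poisson_cover hR hP hC hz)
    (fun _ _ z hz _ => poisson_low hR hP hC hz) ha hb e₁ e₂ (neg_ne_zero.2 hl0) hl0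
    (H₁ := Hfun μ σ (ψ s) s (ψ r) gu) (H₂ := Hfun μ σ (ψ s) s (φ r) gu)
    (Q₁ := Qfun μ σ (φ s) s gd (ψ r)) (Q₂ := Qfun μ σ (φ s) s gd (φ r))
    (fun z hz => by
      rw [neg_mul, Hfun_inc hW.base hrs hR.inc hP.source_u hgu hz.1, Kfun_eq_kFun, Kfun_eq_kFun]
      ring)
    (fun z hz => by
      rw [Hfun_dec hW.base hrs hR.inc hP.source_u hgu hz.1, Kfun_eq_kFun, Lfun_eq_lFun])
    (fun z hz => by
      rw [neg_mul, Qfun_inc hW.base hrs hR.dec hP.source_d hgd (hxh.trans_le hz), Kfun_eq_kFun,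
        Lfun_eq_lFun]
      ring)
    (fun z hz => by
      rw [Qfun_dec hW.base hrs hR.dec hP.source_d hgd (hxh.trans_le hz), Lfun_eq_lFun,
        Lfun_eq_lFun])
  exact ⟨xh, xt, a, b, ⟨hxh, Lfun_eq_lFun μ σ _ _ s ▸ l₂, Lfun_eq_lFun μ σ _ _ s ▸ l₃,
    Lfun_eq_lFun μ σ _ _ s ▸ l₄⟩, ⟨hxt, k₂, k₃, k₄⟩, c₂, c₃, c₁⟩

/-- For large rates the solution lies on the side of a test point that the strict inequalities
of the singular problem indicate. -/
theorem eventually_poissonThresholds_compare (hW : RateFamily 𝔖 𝔪 r ψ 𝔭 φ 𝔮 B)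
    (hP : PayoffPair 𝔪 (ψ r) (φ r) θd θu xd xu)
    (hgd : ∀ x, 0 < x → gd x = -green 𝔪 (ψ r) (φ r) B θd x)
    (hgu : ∀ x, 0 < x → gu x = -green 𝔪 (ψ r) (φ r) B θu x) {x y : ℝ} (hx : x ∈ Ioc 0 xu)
    (hy : y ∈ Ici xd) :
    (Kfun μ σ (ψ r) r θu x < Kfun μ σ (ψ r) r θd y →
      Lfun μ σ (φ r) r θd y < Lfun μ σ (φ r) r θu x →
      ∀ᶠ s in atTop, ∀ xh xt a b, PoissonThresholds μ σ (ψ s) (φ s) s (ψ r) (φ r) θd θu gd gu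
        xh xt a b → x < a) ∧
    (Kfun μ σ (ψ r) r θd y < Kfun μ σ (ψ r) r θu x →
      Lfun μ σ (φ r) r θu x < Lfun μ σ (φ r) r θd y →
      ∀ᶠ s in atTop, ∀ xh xt a b, PoissonThresholds μ σ (ψ s) (φ s) s (ψ r) (φ r) θd θu gd gu
        xh xt a b → a < x) := by
  obtain ⟨x₀, h₁, h₂⟩ := exists_between hP.peak_lt
  have hx₀ := hP.peak_u_pos.trans h₁
  have hD := hW.base.densities
  have hr := hW.base.rate_pos
  obtain ⟨l, hl⟩ := hP.limit_zero_u
  have main : ∀ᶠ s in atTop, ∀ xh xt a b,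
      PoissonThresholds μ σ (ψ s) (φ s) s (ψ r) (φ r) θd θu gd gu xh xt a b →
      RatePair 𝔖 𝔪 r (ψ r) (flux μ σ (ψ r)) (φ r) (coflux μ σ (φ r)) B s
        (ψ s) (flux μ σ (ψ s)) (φ s) (coflux μ σ (φ s)) ∧
      SignChanges 𝔪 (ψ s) (flux μ σ (ψ s)) (φ s) (coflux μ σ (φ s)) s θd θu xd xu x₀ xt xh ∧
      a ∈ Ioc 0 xt ∧ b ∈ Ici xh ∧
      kFun 𝔪 (ψ r) (flux μ σ (ψ r)) r θu a -
          flux μ σ (ψ r) a / flux μ σ (ψ s) a * kFun 𝔪 (ψ s) (flux μ σ (ψ s)) s θu a =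
        kFun 𝔪 (ψ r) (flux μ σ (ψ r)) r θd b -
          flux μ σ (ψ r) b / coflux μ σ (φ s) b * lFun 𝔪 (φ s) (coflux μ σ (φ s)) s θd b ∧
      lFun 𝔪 (φ r) (coflux μ σ (φ r)) r θu a -
          coflux μ σ (φ r) a / flux μ σ (ψ s) a * kFun 𝔪 (ψ s) (flux μ σ (ψ s)) s θu a =
        lFun 𝔪 (φ r) (coflux μ σ (φ r)) r θd b -
          coflux μ σ (φ r) b / coflux μ σ (φ s) b * lFun 𝔪 (φ s) (coflux μ σ (φ s)) s θd b := by
    filter_upwards [eventually_gt_atTop r,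
      eventually_kFun_pos_rate hD hr hW.inc hP.source_u.lower hl hP.peak_u hP.peak_u_pos h₁,
      eventually_lFun_pos_rate hD hr hW.dec hP.source_d.upper hP.peak_d hP.limit_infinity_d hx₀
        h₂] with s hrs hK hL xh xt a b hG
    have hR := hW.pair hrs
    obtain ⟨t₀, t₁, t₂, -⟩ := hG.sign_k
    obtain ⟨u₀, u₁, -, u₃⟩ := hG.sign_l
    obtain ⟨ha, hb, e₁, e₂, -⟩ := hG.unique
    rw [Lfun_eq_lFun] at u₁ u₃
    refine ⟨hR, hR.signChanges hP hx₀ hK hL t₀ t₁ t₂ u₁ u₃, ha, hb, ?_, ?_⟩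
    · have i₁ := Hfun_inc hW.base hrs hR.inc hP.source_u hgu ha.1
      have i₂ := Qfun_inc hW.base hrs hR.dec hP.source_d hgd (u₀.trans_le hb)
      rw [e₁, i₂, Lfun_eq_lFun] at i₁
      simp only [Kfun_eq_kFun] at i₁
      linarith
    · have i₁ := Hfun_dec hW.base hrs hR.inc hP.source_u hgu ha.1
      have i₂ := Qfun_dec hW.base hrs hR.dec hP.source_d hgd (u₀.trans_le hb)
      rw [e₂, i₂] at i₁
      simp only [Kfun_eq_kFun, Lfun_eq_lFun] at i₁
      exact i₁.symm
  have hc : 0 ≤ coflux μ σ (φ r) x₀ / flux μ σ (ψ r) x₀ :=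
    (div_pos (hW.base.dec.flux_pos x₀ hx₀) (hW.base.inc.flux_pos x₀ hx₀)).le
  simp only [Kfun_eq_kFun, Lfun_eq_lFun]
  constructor
  · intro t₁ t₂
    filter_upwards [main,
      (hW.tendsto_kFun hP hx _ (flux μ σ (ψ r) x)).eventually_lt
        (hW.tendsto_lFun hP hy _ (flux μ σ (ψ r) y)) t₁,
      (hW.tendsto_lFun hP hy _ (coflux μ σ (φ r) y)).eventually_lt
        (hW.tendsto_kFun hP hx _ (coflux μ σ (φ r) x)) t₂] with s hm i₁ i₂ xh xt a b hG
    obtain ⟨hR, hC, ha, hb, e₁, e₂⟩ := hm xh xt a b hG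
    have hO := orderedThresholds hR hP hC
    exact lt_solution hO.h2_anti hO.q2_mono hO.h_slope hO.q_slope hc ha hb e₁ e₂
      ⟨hx.1, hx.2.trans hC.lt_til.le⟩ (hC.hat_lt.le.trans hy) i₁ i₂
  · intro t₁ t₂
    filter_upwards [main,
      (hW.tendsto_lFun hP hy _ (flux μ σ (ψ r) y)).eventually_lt
        (hW.tendsto_kFun hP hx _ (flux μ σ (ψ r) x)) t₁,
      (hW.tendsto_kFun hP hx _ (coflux μ σ (φ r) x)).eventually_lt
        (hW.tendsto_lFun hP hy _ (coflux μ σ (φ r) y)) t₂] with s hm i₁ i₂ xh xt a b hG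
    obtain ⟨hR, hC, ha, hb, e₁, e₂⟩ := hm xh xt a b hG
    have hO := orderedThresholds hR hP hC
    exact solution_lt hO.h2_anti hO.q2_mono hO.h_slope hO.q_slope hc ha hb e₁ e₂
      ⟨hx.1, hx.2.trans hC.lt_til.le⟩ (hC.hat_lt.le.trans hy) i₁ i₂

end PoissonThresholds

/-! ### The standing assumptions -/

section Assumptions

variable {μ σ π ψ φ : ℝ → ℝ} {r γd γu xd xu : ℝ}

theorem isSource_of_inL1 {f : ℝ → ℝ} (hc : ContinuousOn f (Ioi 0)) (hf : InL1 μ σ ψ φ f) :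
    IsSource (speedDensity μ σ) ψ φ f :=
  ⟨hc, fun x hx => by simpa only [mul_comm (ψ _)] using (hf x hx).1,
    fun x hx => by simpa only [mul_comm (φ _)] using (hf x hx).2⟩

theorem IsSource.linear_combination {m f g : ℝ → ℝ} (hf : IsSource m ψ φ f)
    (hg : IsSource m ψ φ g) (c d : ℝ) : IsSource m ψ φ (fun y => c * f y + d * g y) := by
  refine ⟨(continuousOn_const.mul hf.continuousOn).add (continuousOn_const.mul hg.continuousOn),
    fun x hx => ?_, fun x hx => ?_⟩
  · refine (((hf.lower x hx).const_mul c).add ((hg.lower x hx).const_mul d)).congr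
      (.of_forall fun y => ?_)
    simp only [Pi.add_apply]
    ring
  · refine (((hf.upper x hx).const_mul c).add ((hg.upper x hx).const_mul d)).congr
      (.of_forall fun y => ?_)
    simp only [Pi.add_apply]
    ring

theorem MainAssumptions.source_d (hA : MainAssumptions μ σ π ψ φ r γd γu xd xu) :
    IsSource (speedDensity μ σ) ψ φ (theta μ π r γd) :=
  isSource_of_inL1 hA.peak_d.differentiable.continuousOn hA.theta_d_mem

theorem MainAssumptions.source_u (hA : MainAssumptions μ σ π ψ φ r γd γu xd xu) :
    IsSource (speedDensity μ σ) ψ φ (theta μ π r γu) :=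
  isSource_of_inL1 hA.peak_u.differentiable.continuousOn hA.theta_u_mem

/-- `μ - r x` is `(θ_u - θ_d)/(γ_u - γ_d)`, so it inherits integrability from the two yields. -/
theorem MainAssumptions.source_drift (hA : MainAssumptions μ σ π ψ φ r γd γu xd xu) :
    IsSource (speedDensity μ σ) ψ φ (fun y => μ y - r * y) := by
  have h := hA.source_u.linear_combination hA.source_d (γu - γd)⁻¹ (-(γu - γd)⁻¹)
  have hne : γu - γd ≠ 0 := (sub_pos.2 hA.price_lt).ne'
  convert h using 2 with y
  simp only [theta]
  field_simp
  ring

theorem MainAssumptions.source_payoff (hA : MainAssumptions μ σ π ψ φ r γd γu xd xu) :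
    IsSource (speedDensity μ σ) ψ φ π := by
  have h := hA.source_u.linear_combination hA.source_drift 1 (-γu)
  convert h using 2 with y
  simp only [theta]
  ring

theorem MainAssumptions.deriv_lt (hX : IsNaturalDiffusion μ σ)
    (hA : MainAssumptions μ σ π ψ φ r γd γu xd xu) {x : ℝ} (hx : 0 < x) :
    deriv (theta μ π r γu) x < deriv (theta μ π r γd) x := by
  have h1 := ((hX.drift_differentiable.differentiableAt (Ioi_mem_nhds hx)).hasDerivAt.sub
    ((hasDerivAt_id x).const_mul r)).const_mul (γu - γd)
  have h2 := (hA.peak_d.differentiable.differentiableAt (Ioi_mem_nhds hx)).hasDerivAt.add h1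
  have h3 : HasDerivAt (theta μ π r γu)
      (deriv (theta μ π r γd) x + (γu - γd) * (deriv μ x - r * 1)) x := by
    refine h2.congr_of_eventuallyEq (.of_forall fun y => ?_)
    simp only [theta, Pi.add_apply, Pi.sub_apply, id]
    ring
  rw [h3.deriv]
  have := mul_pos (sub_pos.2 hA.price_lt) (sub_pos.2 (hA.drift_deriv_lt x hx))
  linarith

theorem MainAssumptions.payoffPair (hX : IsNaturalDiffusion μ σ)
    (hA : MainAssumptions μ σ π ψ φ r γd γu xd xu) (hu : 0 < xu) :
    PayoffPair (speedDensity μ σ) ψ φ (theta μ π r γd) (theta μ π r γu) xd xu := by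
  refine ⟨hA.source_d, hA.source_u, hA.peak_d, hA.peak_u, hu, ?_,
    hA.limit_zero_d.imp fun _ h => h.2, hA.limit_zero_u.imp fun _ h => h.2,
    hA.limit_infinity_d, hA.limit_infinity_u, fun x hx => hA.deriv_lt hX hx⟩
  -- At `x_u*` one has `θ_d' > θ_u' = 0`, so `x_u*` lies strictly below the peak of `θ_d`.
  have h1 := hA.deriv_lt hX hu
  rw [hA.peak_u.deriv_zero hu] at h1
  by_contra! h
  rcases eq_or_lt_of_le h with h | h
  · exact h1.ne' (h ▸ hA.peak_d.deriv_zero (h ▸ hu))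
  · exact (hA.peak_d.deriv_neg xu hu h).not_gt h1

theorem rateFamily {ψ φ : ℝ → ℝ → ℝ} (hr : 0 < r) (hX : IsNaturalDiffusion μ σ)
    (hψ : ∀ s, 0 < s → IsIncreasingFundamental μ σ s (ψ s))
    (hφ : ∀ s, 0 < s → IsDecreasingFundamental μ σ s (φ s)) :
    ∃ B, RateFamily (scaleDensity μ σ) (speedDensity μ σ) r ψ (fun s => flux μ σ (ψ s)) φ
      (fun s => coflux μ σ (φ s)) B := by
  have hi := fun s hs => (hψ s hs).increasingPair hs hX
  have hd := fun s hs => (hφ s hs).decreasingPair hs hX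
  obtain ⟨B, hB, hw⟩ := exists_wronskian_eq (hi r hr) (hd r hr)
  exact ⟨B, ⟨isDensityPair hX, hr, hi r hr, hd r hr, hB, hw⟩, hi, hd⟩

end Assumptions

end PoissonControl

end

/-! ### The theorem. -/

theorem mainTheorem4
    (μ σ π : ℝ → ℝ) (r γd γu xd xu : ℝ) (ψ φ : ℝ → ℝ → ℝ)
    (hr : 0 < r)
    (hX : PoissonControl.IsNaturalDiffusion μ σ)
    (hψ : ∀ s, 0 < s → PoissonControl.IsIncreasingFundamental μ σ s (ψ s))
    (hφ : ∀ s, 0 < s → PoissonControl.IsDecreasingFundamental μ σ s (φ s))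
    (hA : PoissonControl.MainAssumptions μ σ π (ψ r) (φ r) r γd γu xd xu)
    (aS bS : ℝ) (haS : aS ∈ Set.Ioc 0 xu) (hbS : bS ∈ Set.Ici xd)
    (hL : PoissonControl.Lfun μ σ (φ r) r (PoissonControl.theta μ π r γu) aS =
      PoissonControl.Lfun μ σ (φ r) r (PoissonControl.theta μ π r γd) bS)
    (hK : PoissonControl.Kfun μ σ (ψ r) r (PoissonControl.theta μ π r γu) aS =
      PoissonControl.Kfun μ σ (ψ r) r (PoissonControl.theta μ π r γd) bS) :
    let θd := PoissonControl.theta μ π r γd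
    let θu := PoissonControl.theta μ π r γu
    let gd := PoissonControl.gain μ σ π (ψ r) (φ r) γd
    let gu := PoissonControl.gain μ σ π (ψ r) (φ r) γu
    let Ku := PoissonControl.Kfun μ σ (ψ r) r θu
    let Kd := PoissonControl.Kfun μ σ (ψ r) r θd
    let Lu := PoissonControl.Lfun μ σ (φ r) r θu
    let Ld := PoissonControl.Lfun μ σ (φ r) r θd
    let Hψ := fun l : ℝ => PoissonControl.Hfun μ σ (ψ (r + l)) (r + l) (ψ r) gu
    let Hφ := fun l : ℝ => PoissonControl.Hfun μ σ (ψ (r + l)) (r + l) (φ r) gu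
    let Qψ := fun l : ℝ => PoissonControl.Qfun μ σ (φ (r + l)) (r + l) gd (ψ r)
    let Qφ := fun l : ℝ => PoissonControl.Qfun μ σ (φ (r + l)) (r + l) gd (φ r)
    PoissonControl.IsUniqueSolution Ku Lu Kd Ld (Set.Ioc 0 xu) (Set.Ici xd) aS bS ∧
    PoissonControl.CompInvWellDefined Ku Lu Kd Ld
      (Set.Ioc 0 xu) (Set.Ici xd) (Set.Ioc 0 aS) ∧
    PoissonControl.IsSelfMapWithUniqueFixedPoint
      (PoissonControl.compInv Ku Lu Kd Ld (Set.Ioc 0 xu) (Set.Ici xd)) (Set.Ioc 0 aS) aS ∧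
    ∃ xhat xtil a b : ℝ → ℝ,
      (∀ᶠ l : ℝ in Filter.atTop,
        PoissonControl.IsSignChangeL μ σ (φ (r + l)) (r + l) θd (xhat l) ∧
        PoissonControl.IsSignChangeK μ σ (ψ (r + l)) (r + l) θu (xtil l) ∧
        PoissonControl.CompInvWellDefined (Hψ l) (Hφ l) (Qψ l) (Qφ l)
          (Set.Ioc 0 (xtil l)) (Set.Ici (xhat l)) (Set.Ioc 0 (xtil l)) ∧
        PoissonControl.IsSelfMapWithUniqueFixedPoint
          (PoissonControl.compInv (Hψ l) (Hφ l) (Qψ l) (Qφ l)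
            (Set.Ioc 0 (xtil l)) (Set.Ici (xhat l))) (Set.Ioc 0 (xtil l)) (a l) ∧
        PoissonControl.IsUniqueSolution (Hψ l) (Hφ l) (Qψ l) (Qφ l)
          (Set.Ioc 0 (xtil l)) (Set.Ici (xhat l)) (a l) (b l)) ∧
      Filter.Tendsto a Filter.atTop (𝓝 aS) := by
  obtain ⟨B, hW⟩ := PoissonControl.rateFamily hr hX hψ hφ
  have hP := hA.payoffPair hX (haS.1.trans_le haS.2)
  have hid := PoissonControl.isSource_of_inL1 continuousOn_id hA.id_mem
  have hg : ∀ γ x, 0 < x → PoissonControl.gain μ σ π (ψ r) (φ r) γ x =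
      -PoissonControl.green (PoissonControl.speedDensity μ σ) (ψ r) (φ r) B
        (PoissonControl.theta μ π r γ) x := fun γ x hx =>
    PoissonControl.gain_eq_neg_green hX hW.base hA.source_drift hid hA.source_payoff hx
  have hL' := hL
  simp only [PoissonControl.Lfun_eq_lFun] at hL'
  have hlt := PoissonControl.singular_lt_peak hW.base hP haS hbS hL'
  have hleft := fun x hx hxa =>
    PoissonControl.singular_test_left hW.base hP haS hbS hK hL' (x := x) hx hxa
  have hright := fun x hxa hxu =>
    PoissonControl.singular_test_right hW.base hP haS hbS hK hL' (x := x) hxa hxu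
  have h₁ := PoissonControl.singular_solution hW.base hP haS hbS hK hL'
  simp only [← PoissonControl.Lfun_eq_lFun, ← PoissonControl.Kfun_eq_kFun] at hleft hright h₁
  intro θd θu gd gu Ku Kd Lu Ld Hψ Hφ Qψ Qφ
  refine ⟨h₁.1, h₁.2.1, h₁.2.2, ?_⟩
  have hshift : Tendsto (fun l : ℝ => r + l) atTop atTop :=
    tendsto_atTop_add_const_left atTop r tendsto_id
  -- Any point of `(0, a_s*)` would serve as the test point for existence.
  have hx := half_lt_self haS.1
  obtain ⟨y, hy, t₁, t₂⟩ := hleft _ (half_pos haS.1) hx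
  obtain ⟨xhat, hxhat⟩ := (hshift.eventually (PoissonControl.eventually_poissonThresholds hW hP
    (hg γd) (hg γu) ⟨half_pos haS.1, hx.le.trans haS.2⟩ hy t₁ t₂)).choice
  obtain ⟨xtil, hxtil⟩ := hxhat.choice
  obtain ⟨a, ha⟩ := hxtil.choice
  obtain ⟨b, hb⟩ := ha.choice
  refine ⟨xhat, xtil, a, b, hb.mono fun l h => ⟨h.1, h.2, h.3, h.4, h.5⟩,
    tendsto_order.2 ⟨fun c hc => ?_, fun c hc => ?_⟩⟩
  -- The maximum with `0` keeps the test point in the state space when `c ≤ 0`.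
  · obtain ⟨x, hx₁, hx₂⟩ := exists_between (max_lt haS.1 hc)
    obtain ⟨y, hy, t₁, t₂⟩ := hleft x ((le_max_left _ _).trans_lt hx₁) hx₂
    filter_upwards [hb, hshift.eventually ((PoissonControl.eventually_poissonThresholds_compare hW
      hP (hg γd) (hg γu) ⟨(le_max_left _ _).trans_lt hx₁, hx₂.le.trans haS.2⟩ hy).1 t₁ t₂)]
      with l hl hc'
    exact ((le_max_right _ _).trans_lt hx₁).trans (hc' _ _ _ _ hl)
  -- The test point must lie below the peak `x_u*` as well as below `c`; `a_s* < x_u*` makes this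
  -- possible.
  · obtain ⟨x, hx₁, hx₂⟩ := exists_between (lt_min hlt hc)
    have hxu := (hx₂.trans_le (min_le_left _ _)).le
    obtain ⟨y, hy, t₁, t₂⟩ := hright x hx₁ hxu
    filter_upwards [hb, hshift.eventually ((PoissonControl.eventually_poissonThresholds_compare hW
      hP (hg γd) (hg γu) ⟨haS.1.trans hx₁, hxu⟩ hy).2 t₁ t₂)] with l hl hc'
    exact (hc' _ _ _ _ hl).trans (hx₂.trans_le (min_le_right _ _))
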